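/- Let $0<d<\pi$, $\mu>0$ and $\mu/2<\nu<\mu/2+1$. **Function space.** Let $\Lambda_d=\{\tanh(\zeta/2):\zeta\in\mathbb C,\ |\operatorname{Im}\zeta|<d\}$ and $w_\mu(z)=(1-z^2)^{\mu/2}$ (principal branch). Let $\boldsymbol H^\infty(\Lambda_d,w_\mu)$ be the space of analytic functions $f:\Lambda_d\to\mathbb C$ with $\|f\|:=\sup_{z\in\Lambda_d}|f(z)/w_\mu(z)|<\infty$. For an approximation procedure $A$ put $$\mathcal N(A):=\sup_{f\in \boldsymbol H^\infty(\Lambda_d,w_\mu),\ \|f\|\le 1}\ \sup_{x\in(-1,1)}|f(x)-(Af)(x)|\in[0,\infty].$$ Let $E_n^{\min}$ be the infimum of $\mathcal N(A)$ over all $n$-point formulas $(Af)(x)=\sum_{j=1}^{\ell}\sum_{k=0}^{m_j-1}f^{(k)}(a_j)\,\phi_{jk}(x)$, where $1\le\ell\le n$, the $m_j\ge 0$ are integers with $m_1+\dots+m_\ell=n$, $a_j\in\Lambda_d$, and the $\phi_{jk}$ are analytic on $\Lambda_d$. **Sampling points.** Let $r=d\mu/\pi$. For a positive integer $N$ let $N_0=N-\lceil\frac{\pi}{4}\sqrt{Nr}\rceil$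 and $\varphi(x)=\exp(\pi\sqrt{x/r})$ for $x\ge 0$. For $k=1,\dots,N$ let $$a_k=\begin{cases}\varphi(k-1)/\varphi(N_0)& (k\le N_0),\\ \varphi(k-3/2)/\varphi(N_0)& (k=N_0+1),\\ 1-\dfrac{k-N_0-1}{5(N-N_0-1)}& (k\ge N_0+2),\end{cases}$$ $$b_{\pm k}=\pm\sqrt{\frac{1-a_k}{1+a_k}},\qquad \beta_{\pm k}=\tanh\Bigl(\frac{2d}{\pi}\operatorname{arctanh} b_{\pm k}\Bigr).$$ Call $N$ *admissible* if $N_0\ne 0$ and the $2N$ points $\beta_k$ $(k=\pm1,\dots,\pm N)$ are pairwise distinct. **Formula.** All sums and products below run over the indices $\pm1,\dots,\pm N$. Let $$\sigma_k=\prod_{\ell\neq k}\frac{1-b_\ell b_k}{b_k-b_\ell},\qquad B_N(z;\boldsymbol\beta,d)=\prod_{k}\tanh\Bigl[\frac{\pi}{2d}(\operatorname{arctanh}z-\operatorname{arctanh}\beta_k)\Bigr],$$ $$\tilde f_{\nu,N}(x)=\sum_{k}f(\beta_k)\,\frac{2d\sigma_k}{\pi}\,\frac{(1-x^2)^\nu}{(1-\beta_k^2)^{\nu-1}}\,\frac{B_N(x;\boldsymbol\beta,d)}{x-\beta_k},$$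 where the quotient $B_N(x;\boldsymbol\beta,d)/(x-\beta_k)$ is continued to its removable singularity $x=\beta_k$. **Theorem.** There is $C>0$, independent of $N$, such that for every admissible $N\ge1$ $$\sup_{f\in \boldsymbol H^\infty(\Lambda_d,w_\mu),\ \|f\|\le1}\ \sup_{x\in(-1,1)}\bigl|f(x)-\tilde f_{\nu,N}(x)\bigr|\le C\exp\bigl(-\sqrt{\pi d\mu N}\bigr).$$ Moreover, the formula is optimal in order: there is $c>0$, independent of $N$, with $c\exp(-\sqrt{\pi d\mu N})\le E_{2N}^{\min}$ for every $N\ge1$, and $E_{2N}^{\min}$ is at most the left-hand side of the displayed bound for every admissible $N\ge1$. -/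

import Mathlib

namespace Ganelius

noncomputable section

open scoped ENNReal

/-! ### The weighted Hardy space -/

/-- The region `Λ_d`: the image of the strip `|Im ζ| < d` under `ζ ↦ tanh (ζ / 2)`. -/
def region (d : ℝ) : Set ℂ :=
  (fun ζ : ℂ => Complex.tanh (ζ / 2)) '' {ζ : ℂ | |ζ.im| < d}

/-- The weight `w_μ(z) = (1 - z²)^(μ/2)`. For `0 < d < π` and `z ∈ Λ_d` the number `1 - z²` lies
in the slit plane, so the principal power is the analytic branch that is positive on `(-1, 1)`. -/
def weight (μ : ℝ) (z : ℂ) : ℂ := (1 - z ^ 2) ^ ((μ / 2 : ℝ) : ℂ)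

/-- The norm `‖f‖ = sup_{z ∈ Λ_d} |f(z) / w_μ(z)|`, with value `∞` when the supremum is infinite.
-/
def hNorm (d μ : ℝ) (f : ℂ → ℂ) : ℝ≥0∞ := ⨆ z ∈ region d, ‖f z / weight μ z‖ₑ

/-- `H^∞(Λ_d, w_μ)`: functions analytic in `Λ_d` (their values outside the open set `Λ_d` are
irrelevant) with finite norm. -/
def hSpace (d μ : ℝ) : Set (ℂ → ℂ) :=
  {f | AnalyticOnNhd ℂ f (region d) ∧ hNorm d μ f < ∞}

/-- The worst-case error of an approximation procedure `f ↦ A f` on `(-1, 1)`, over the closed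
unit ball of `H^∞(Λ_d, w_μ)`:
`sup_{f ∈ H^∞, ‖f‖ ≤ 1} sup_{x ∈ (-1,1)} |f(x) - (A f)(x)|`, valued in `[0, ∞]`. -/
def errorNorm (d μ : ℝ) (A : (ℂ → ℂ) → ℂ → ℂ) : ℝ≥0∞ :=
  ⨆ f ∈ {f : ℂ → ℂ | f ∈ hSpace d μ ∧ hNorm d μ f ≤ 1},
    ⨆ x ∈ Set.Ioo (-1 : ℝ) 1, ‖f (x : ℂ) - A f (x : ℂ)‖ₑ

/-- The approximation formula
`f(x) ≈ ∑_{j=1}^{ℓ} ∑_{k=0}^{m_j - 1} f^{(k)}(a_j) φ_{jk}(x)`. -/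
def generalFormula {l : ℕ} (m : Fin l → ℕ) (a : Fin l → ℂ)
    (φ : (j : Fin l) → Fin (m j) → ℂ → ℂ) (f : ℂ → ℂ) (z : ℂ) : ℂ :=
  ∑ j : Fin l, ∑ k : Fin (m j), iteratedDeriv (k : ℕ) f (a j) * φ j k z

/-- The minimum error norm `E_n^min(H^∞(Λ_d, w_μ))`: the infimum of the error norm over all
`n`-point formulas, that is over `1 ≤ ℓ ≤ n`, multiplicities `m_1 + ⋯ + m_ℓ = n`, sampling points
`a_j ∈ Λ_d` and basis functions `φ_{jk}` analytic on `Λ_d`. -/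
def minError (d μ : ℝ) (n : ℕ) : ℝ≥0∞ :=
  ⨅ (l : ℕ) (_ : 1 ≤ l ∧ l ≤ n) (m : Fin l → ℕ) (_ : ∑ j, m j = n)
    (a : Fin l → ℂ) (_ : ∀ j, a j ∈ region d)
    (φ : (j : Fin l) → Fin (m j) → ℂ → ℂ) (_ : ∀ j k, AnalyticOnNhd ℂ (φ j k) (region d)),
    errorNorm d μ (generalFormula m a φ)

/-! ### The modified Ganelius points -/

/-- `N₀ = N - ⌈(π/4) √(N r)⌉`, an integer (it may fail to be positive for small `N`). -/
def cutoff (r : ℝ) (N : ℕ) : ℤ := (N : ℤ) - ⌈Real.pi / 4 * √((N : ℝ) * r)⌉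

/-- `φ(x) = exp (π √(x / r))`. -/
def phi (r x : ℝ) : ℝ := Real.exp (Real.pi * √(x / r))

/-- The modified Ganelius points `a_k` (used for `1 ≤ k ≤ N`). -/
def ganelius (r : ℝ) (N : ℕ) (k : ℤ) : ℝ :=
  if k ≤ cutoff r N then phi r ((k : ℝ) - 1) / phi r (cutoff r N)
  else if k = cutoff r N + 1 then phi r ((k : ℝ) - 3 / 2) / phi r (cutoff r N)
  else 1 - ((k : ℝ) - cutoff r N - 1) / (5 * ((N : ℝ) - cutoff r N - 1))

/-- The index set `{-N, …, -1, 1, …, N}`. -/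
def idx (N : ℕ) : Finset ℤ := (Finset.Icc (-(N : ℤ)) N).erase 0

/-- `b_k = √((1 - a_k) / (1 + a_k))` and `b_{-k} = -b_k` for `k = 1, …, N`, where the points `a_k`
are taken with the parameter `r = d μ / π`. -/
def bPoint (d μ : ℝ) (N : ℕ) (k : ℤ) : ℝ :=
  if 0 < k then
    √((1 - ganelius (d * μ / Real.pi) N k) / (1 + ganelius (d * μ / Real.pi) N k))
  else
    -√((1 - ganelius (d * μ / Real.pi) N (-k)) / (1 + ganelius (d * μ / Real.pi) N (-k)))

/-- The sampling points `β_k = tanh ((2d/π) arctanh b_k)`. -/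
def betaPoint (d μ : ℝ) (N : ℕ) (k : ℤ) : ℝ :=
  Real.tanh (2 * d / Real.pi * Real.artanh (bPoint d μ N k))

/-- The coefficients `σ_k = ∏_{ℓ ≠ k} (1 - b_ℓ b_k) / (b_k - b_ℓ)`, over `ℓ = ±1, …, ±N`. -/
def sigma (d μ : ℝ) (N : ℕ) (k : ℤ) : ℝ :=
  ∏ l ∈ (idx N).erase k,
    (1 - bPoint d μ N l * bPoint d μ N k) / (bPoint d μ N k - bPoint d μ N l)

/-- The approximation formula is defined: `N₀ ≠ 0` (for `N₀ = 0` the point `a_1` would involve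
`φ(-1/2)`), and the `2N` sampling points are pairwise distinct, so that no denominator
`b_k - b_ℓ` of a coefficient `σ_k` vanishes. -/
def FormulaDefined (d μ : ℝ) (N : ℕ) : Prop :=
  cutoff (d * μ / Real.pi) N ≠ 0 ∧ Set.InjOn (betaPoint d μ N) (idx N : Set ℤ)

/-! ### The approximation formula -/

/-- The principal branch of the inverse hyperbolic tangent. -/
def cartanh (z : ℂ) : ℂ := 1 / 2 * Complex.log ((1 + z) / (1 - z))

/-- The generalized Blaschke product
`B_N(z; β, d) = ∏_{k = ±1, …, ±N} tanh [(π / 2d) (arctanh z - arctanh β_k)]`. -/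
def blaschke (d μ : ℝ) (N : ℕ) (z : ℂ) : ℂ :=
  ∏ k ∈ idx N,
    Complex.tanh ((Real.pi / (2 * d) : ℝ) * (cartanh z - cartanh (betaPoint d μ N k : ℂ)))

/-- The formula
`f̃_{ν,N}(z) = ∑_{k = ±1, …, ±N} f(β_k) (2dσ_k/π) (1 - z²)^ν / (1 - β_k²)^(ν-1) * B_N(z)/(z - β_k)`.
As `B_N(β_k) = 0`, the quotient `B_N(z)/(z - β_k)` is written as the divided difference
`dslope B_N β_k z`: it is the quotient for `z ≠ β_k`, and at the removable singularity `z = β_k`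
it takes the limit value `B_N'(β_k)`. -/
def formula (d μ ν : ℝ) (N : ℕ) (f : ℂ → ℂ) (z : ℂ) : ℂ :=
  ∑ k ∈ idx N,
    f (betaPoint d μ N k : ℂ) * ((2 * d * sigma d μ N k / Real.pi : ℝ) : ℂ)
      * ((1 - z ^ 2) ^ (ν : ℂ) / (((1 - betaPoint d μ N k ^ 2) ^ (ν - 1) : ℝ) : ℂ))
      * dslope (blaschke d μ N) (betaPoint d μ N k : ℂ) z

end

end Ganelius

namespace Ganelius

open Real MeasureTheory Set Filter Topology

/-! ### The function `log coth (v / 2)` -/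

/-! Upper bound. The substitution z = tanh(ζ/2) turns Λ_d into the strip |Im ζ| < d, a point x of
(-1,1) into a real ξ, and the β_k into real nodes. The error of the formula at x is (1 - x²)^ν
B_N(x) times the sum of all residues of a Cauchy integrand built from f / ((1 - z²)^ν B_N)
(`sub_formula_eq`). On lines |Im ζ| = η with η close to d the modulus of B_N is bounded below, so
this sum is at most C cosh(ξ/2)^(2ν-μ), with C independent of the nodes; the boundary integral
converges because |2ν - μ - 1| < 1 (`norm_sum_numer_residues_le`). The error is therefore
O(cosh(ξ/2)^(-μ) |B_N(x)|).

Put t = 1/cosh(πξ/(2d)). The power of cosh is O(t^r), and pairing the indices ±k gives |B_N(x)| = ∏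
|t - a_k|/(t + a_k) (`norm_blaschke`). What remains is a real extremal estimate, t^r ∏ |t - a_k|/(t
+ a_k) = O(e^(-π√(rN))) (`rpow_mul_ganeliusProd_le`), where π√(rN) = √(πdμN).

For this estimate write t = exp(κ(√y - √N₀)) with κ = π/√r. The logarithm of the product over the
first N₀ + 1 points is minus a sum of values of log coth(κ|√x - √y|/2), and this sum dominates the
integral over [0, N₀] up to O(1) (`le_sum_kern`). The integral is π√r √y, which cancels the growth
of t^r, minus a truncation loss proportional to t√y. The points placed near 1 contribute a factor
e^(-2t) each, and their number is chosen to pay for that loss (`ganeliusProd_le`).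

Lower bound. The weight times a Blaschke product vanishing at the sampling points, with their
multiplicities, lies in the unit ball and is annihilated by the formula. Averaging minus its
logarithm over a suitable interval produces a point where it is at least exp(-√(πdμN))
(`exists_potential_le`, `exp_le_minError`). The same integral of log coth, π²/4, fixes the rate on
both sides. -/

/-- `logCoth v = log coth (v / 2)`, for `v > 0`. -/
noncomputable def logCoth (v : ℝ) : ℝ := log (1 + exp (-v)) - log (1 - exp (-v))

/-- This is the Taylor series of log((1+x)/(1-x)) at x = e^(-v). Its terms are positive and
explicit, so decay, lower bounds and the total integral can be read off termwise. -/
lemma hasSum_logCoth {v : ℝ} (hv : 0 < v) :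
    HasSum (fun k : ℕ => 2 / (2 * (k : ℝ) + 1) * exp (-((2 * (k : ℝ) + 1) * v))) (logCoth v) := by
  have h1 : |exp (-v)| < 1 := by
    rw [abs_of_pos (exp_pos _)]; rw [exp_lt_one_iff]; linarith
  refine (hasSum_log_sub_log_of_abs_lt_one h1).congr_fun fun k => ?_
  rw [← exp_nat_mul]
  have : ((2 * k + 1 : ℕ) : ℝ) * -v = -((2 * (k : ℝ) + 1) * v) := by push_cast; ring
  rw [this]; ring

lemma two_mul_exp_le_logCoth {v : ℝ} (hv : 0 < v) : 2 * exp (-v) ≤ logCoth v := by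
  have := sum_le_hasSum {0} (fun k _ => by positivity) (hasSum_logCoth hv)
  simpa using this

lemma logCoth_nonneg {v : ℝ} (hv : 0 ≤ v) : 0 ≤ logCoth v := by
  rcases hv.eq_or_lt with rfl | hv
  -- Since `log 0 = 0`, the value at the singularity is log 2.
  · simp [logCoth]; positivity
  · exact le_trans (by positivity) (two_mul_exp_le_logCoth hv)

/-- Every exponent 2k+1 of the series is at least 1, so a shift by v gains at least e^(-v) in each
term. -/
lemma logCoth_add_le {u v : ℝ} (hu : 0 < u) (hv : 0 ≤ v) :
    logCoth (u + v) ≤ exp (-v) * logCoth u := by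
  refine hasSum_le (fun k => ?_) (hasSum_logCoth (by linarith : 0 < u + v))
    ((hasSum_logCoth hu).mul_left (exp (-v)))
  have h : exp (-((2 * (k : ℝ) + 1) * (u + v))) ≤ exp (-v) * exp (-((2 * (k : ℝ) + 1) * u)) := by
    rw [← exp_add]
    apply exp_le_exp.2
    have : 0 ≤ (k : ℝ) * v := by positivity
    linarith
  calc _ ≤ 2 / (2 * (k : ℝ) + 1) * (exp (-v) * exp (-((2 * (k : ℝ) + 1) * u))) := by gcongr
    _ = _ := by ring

lemma logCoth_anti {u v : ℝ} (hu : 0 < u) (huv : u ≤ v) : logCoth v ≤ logCoth u := by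
  have h := logCoth_add_le hu (sub_nonneg.2 huv)
  rw [add_sub_cancel] at h
  refine h.trans (mul_le_of_le_one_left (logCoth_nonneg hu.le) (exp_le_one_iff.2 (by linarith)))

lemma one_sub_exp_pos {v : ℝ} (hv : 0 < v) : 0 < 1 - exp (-v) := by
  have : exp (-v) < 1 := by rw [exp_lt_one_iff]; linarith
  linarith

/-- Together with `logCoth_le` this fixes the singularity as -log v up to a bounded error on bounded
intervals; that precision is needed near the pole of the kernel. -/
lemma neg_log_le_logCoth {v : ℝ} (hv : 0 < v) : -log v ≤ logCoth v := by
  have h1 : 0 ≤ log (1 + exp (-v)) := log_nonneg (by linarith [exp_pos (-v)])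
  have h2 : log (1 - exp (-v)) ≤ log v :=
    log_le_log (one_sub_exp_pos hv) (by linarith [add_one_le_exp (-v)])
  unfold logCoth; linarith

lemma logCoth_le {v : ℝ} (hv : 0 < v) : logCoth v ≤ log 2 + v - log v := by
  have h1 : log (1 + exp (-v)) ≤ log 2 :=
    log_le_log (by positivity) (by linarith [one_sub_exp_pos hv])
  have h2 : log (v * exp (-v)) ≤ log (1 - exp (-v)) := by
    refine log_le_log (by positivity) ?_
    have h3 : (v + 1) * exp (-v) ≤ exp v * exp (-v) := by gcongr; exact add_one_le_exp v
    rw [← exp_add, add_neg_cancel, exp_zero] at h3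
    linarith
  rw [log_mul hv.ne' (exp_pos _).ne', log_exp] at h2
  unfold logCoth; linarith

lemma hasDerivAt_logCoth {v : ℝ} (hv : 0 < v) : HasDerivAt logCoth (-(sinh v)⁻¹) v := by
  have h0 := one_sub_exp_pos hv
  have h1 : HasDerivAt (fun v => exp (-v)) (-exp (-v)) v := by
    simpa using (hasDerivAt_neg v).exp
  have h2 := ((h1.const_add 1).log (by positivity)).sub ((h1.const_sub 1).log h0.ne')
  refine h2.congr_deriv ?_
  have h3 : exp v * exp (-v) = 1 := by rw [← exp_add]; simp
  have h4 : exp v - exp (-v) ≠ 0 := by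
    have : exp (-v) < exp v := exp_lt_exp.2 (by linarith)
    linarith
  have h5 : (1 + exp (-v)) ≠ 0 := by positivity
  rw [sinh_eq]
  field_simp
  linear_combination (-2 : ℝ) * h3

lemma measurable_logCoth : Measurable logCoth := by unfold logCoth; fun_prop

lemma hasSum_odd_zeta_two :
    HasSum (fun k : ℕ => 1 / (2 * (k : ℝ) + 1) ^ 2) (π ^ 2 / 8) := by
  have h := hasSum_zeta_two
  have he : HasSum (fun k : ℕ => (1 : ℝ) / ((2 * k : ℕ) : ℝ) ^ 2) (1 / 4 * (π ^ 2 / 6)) := by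
    refine (h.mul_left (1 / 4 : ℝ)).congr_fun fun k => ?_
    push_cast
    rw [mul_pow, one_div_mul_one_div]
    norm_num
  have hinj : Function.Injective (fun k : ℕ => 2 * k + 1) := fun a b hab => by
    simpa using hab
  obtain ⟨S, ho⟩ := h.summable.comp_injective hinj
  have hu : 1 / 4 * (π ^ 2 / 6) + S = π ^ 2 / 6 :=
    (HasSum.even_add_odd (f := fun n : ℕ => (1 : ℝ) / (n : ℝ) ^ 2) he ho).unique h
  have hs : S = π ^ 2 / 8 := by linarith
  rw [← hs]
  refine ho.congr_fun fun k => ?_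
  simp

/-- Termwise integration gives 2 ∑ 1/(2k+1)², the odd part of ζ(2). -/
lemma integral_logCoth : ∫ v in Ioi (0 : ℝ), logCoth v = π ^ 2 / 4 := by
  have hI : ∀ k : ℕ, IntegrableOn
      (fun v : ℝ => 2 / (2 * (k : ℝ) + 1) * exp (-((2 * (k : ℝ) + 1) * v))) (Ioi 0) := fun k => by
    have := integrableOn_exp_mul_Ioi (a := -(2 * (k : ℝ) + 1))
      (by linarith [k.cast_nonneg (α := ℝ)]) 0
    simp only [neg_mul] at this
    exact this.const_mul (2 / (2 * (k : ℝ) + 1))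
  have hV : ∀ k : ℕ, ∫ v in Ioi (0 : ℝ), 2 / (2 * (k : ℝ) + 1) * exp (-((2 * (k : ℝ) + 1) * v))
      = 2 * (1 / (2 * (k : ℝ) + 1) ^ 2) := fun k => by
    have hk : (2 * (k : ℝ) + 1) ≠ 0 := by positivity
    have := integral_exp_mul_Ioi (a := -(2 * (k : ℝ) + 1)) (by linarith [k.cast_nonneg (α := ℝ)]) 0
    rw [integral_const_mul]
    simp only [neg_mul] at this
    rw [this]
    simp only [mul_zero, neg_zero, exp_zero]
    field_simp
  have hsum := (hasSum_odd_zeta_two.mul_left 2)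
  have h := hasSum_integral_of_summable_integral_norm (μ := volume.restrict (Ioi (0 : ℝ))) hI (by
    refine hsum.summable.congr fun k => ?_
    rw [← hV k]
    refine integral_congr_ae (Eventually.of_forall fun v => ?_)
    simp only [norm_eq_abs]
    exact (abs_of_nonneg (by positivity)).symm)
  simp only [hV] at h
  have h2 := h.unique hsum
  rw [show π ^ 2 / 4 = 2 * (π ^ 2 / 8) by ring, ← h2]
  exact setIntegral_congr_fun measurableSet_Ioi fun v hv => (hasSum_logCoth hv).tsum_eq.symm

lemma integrableOn_logCoth : IntegrableOn logCoth (Ioi 0) := by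
  -- A nonintegrable function has Bochner integral 0, so the nonzero value just found already proves
  -- integrability.
  apply Integrable.of_integral_ne_zero
  rw [integral_logCoth]
  positivity

lemma integrableOn_mul_logCoth : IntegrableOn (fun v => v * logCoth v) (Ioi 0) := by
  have h : IntegrableOn (fun v => logCoth (v / 2)) (Ioi 0) := by
    have := (integrableOn_Ioi_comp_mul_left_iff logCoth 0 (a := (1 / 2 : ℝ)) (by norm_num)).2
      (by simpa using integrableOn_logCoth)
    simpa [div_eq_inv_mul] using this
  refine (h.const_mul 2).mono' (measurable_id.mul measurable_logCoth).aestronglyMeasurable ?_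
  refine (ae_restrict_iff' measurableSet_Ioi).2 (Eventually.of_forall fun v hv => ?_)
  have hv : 0 < v := hv
  have h1 := logCoth_add_le (half_pos hv) (half_pos hv).le
  rw [add_halves] at h1
  rw [norm_eq_abs, abs_of_nonneg (mul_nonneg hv.le (logCoth_nonneg hv.le))]
  have h2 : (v / 2) * exp (-(v / 2)) ≤ 1 := by
    have h3 : (v / 2) * exp (-(v / 2)) ≤ exp (v / 2) * exp (-(v / 2)) := by
      gcongr; linarith [add_one_le_exp (v / 2)]
    rwa [← exp_add, add_neg_cancel, exp_zero] at h3
  have h4 := logCoth_nonneg (half_pos hv).le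
  calc v * logCoth v ≤ v * (exp (-(v / 2)) * logCoth (v / 2)) := by gcongr
    _ = 2 * ((v / 2) * exp (-(v / 2)) * logCoth (v / 2)) := by ring
    _ ≤ 2 * (1 * logCoth (v / 2)) := by gcongr
    _ = _ := by ring

/-- The ratio is (1 - e^(-v))/(1 + e^(-v)) with v = |log t - log a|. In logarithmic coordinates the
Ganelius product becomes a sum of translates of `logCoth`. -/
lemma abs_sub_div_add {t a : ℝ} (ht : 0 < t) (ha : 0 < a) (hta : t ≠ a) :
    |t - a| / (t + a) = exp (-logCoth |log t - log a|) := by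
  wlog h : a < t generalizing t a
  · have := this ha ht hta.symm (lt_of_le_of_ne (not_lt.1 h) hta)
    rw [abs_sub_comm, add_comm t a, abs_sub_comm (log t), this]
  have h1 : log a < log t := log_lt_log ha h
  have h2 : 0 < |log t - log a| := abs_pos.2 (by linarith)
  rw [logCoth, neg_sub, exp_sub, exp_log (one_sub_exp_pos h2), exp_log (by positivity),
    abs_of_pos (by linarith : 0 < log t - log a), abs_of_pos (by linarith : 0 < t - a), neg_sub,
    exp_sub, exp_log ha, exp_log ht]
  field_simp

lemma abs_tanh_eq {u : ℝ} (hu : u ≠ 0) : |tanh u| = exp (-logCoth (2 * |u|)) := by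
  have h1 : exp u ≠ exp (-u) := fun h => hu (by have := exp_injective h; linarith)
  have h := abs_sub_div_add (exp_pos u) (exp_pos (-u)) h1
  rw [log_exp, log_exp, sub_neg_eq_add, ← two_mul, abs_mul, abs_two] at h
  rw [← h, tanh_eq_sinh_div_cosh, sinh_eq, cosh_eq, abs_div, abs_div, abs_div, abs_two,
    abs_of_pos (by positivity : 0 < exp u + exp (-u))]
  field_simp

end Ganelius

namespace Ganelius

open Real MeasureTheory Set Filter Topology

/-! ### Comparison of sums and integrals through a primitive -/

lemma integrable_comp_abs {f : ℝ → ℝ} (hf : IntegrableOn f (Ioi 0)) :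
    Integrable fun x => f |x| := by
  have h1 : IntegrableOn (fun x => f |x|) (Ioi 0) :=
    hf.congr_fun (fun x hx => by rw [abs_of_pos hx]) measurableSet_Ioi
  have h2 : IntegrableOn (fun x => f |x|) (Iic 0) := by
    rw [← Measure.map_neg_eq_self (volume : Measure ℝ)]
    let m : MeasurableEmbedding fun x : ℝ => -x := (Homeomorph.neg ℝ).measurableEmbedding
    rw [m.integrableOn_map_iff]
    simp_rw [Function.comp_def, abs_neg, neg_preimage, neg_Iic, neg_zero]
    exact Iff.mpr integrableOn_Ici_iff_integrableOn_Ioi h1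
  rw [← integrableOn_univ, ← Iic_union_Ioi (a := (0 : ℝ))]
  exact h2.union h1

lemma sub_le_sub_of_hasDerivAt_le {F H f h : ℝ → ℝ} {a b : ℝ} (hab : a ≤ b)
    (hF : ContinuousOn F (Icc a b)) (hH : ContinuousOn H (Icc a b))
    (hF' : ∀ x ∈ Ioo a b, HasDerivAt F (f x) x) (hH' : ∀ x ∈ Ioo a b, HasDerivAt H (h x) x)
    (hfh : ∀ x ∈ Ioo a b, f x ≤ h x) : F b - F a ≤ H b - H a := by
  have hm : MonotoneOn (H - F) (Icc a b) := by
    refine monotoneOn_of_deriv_nonneg (convex_Icc a b) (hH.sub hF) ?_ ?_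
    · rw [interior_Icc]
      exact fun x hx => ((hH' x hx).sub (hF' x hx)).differentiableAt.differentiableWithinAt
    · rw [interior_Icc]
      intro x hx
      rw [((hH' x hx).sub (hF' x hx)).deriv]
      linarith [hfh x hx]
  have := hm (left_mem_Icc.2 hab) (right_mem_Icc.2 hab) hab
  simp only [Pi.sub_apply] at this
  linarith

/-- A convex function lies below its chord, and the chord has an explicit quadratic primitive. -/
lemma sub_le_trapezoid {F f : ℝ → ℝ} {a : ℝ} (hF : ContinuousOn F (Icc a (a + 1)))
    (hF' : ∀ x ∈ Ioo a (a + 1), HasDerivAt F (f x) x) (hf : ConvexOn ℝ (Icc a (a + 1)) f) :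
    F (a + 1) - F a ≤ (f a + f (a + 1)) / 2 := by
  have hH : ∀ x, HasDerivAt (fun x => f a * (x - a) + (f (a + 1) - f a) * (x - a) ^ 2 / 2)
      (f a + (f (a + 1) - f a) * (x - a)) x := fun x => by
    have h1 := (hasDerivAt_id x).sub_const a
    refine ((h1.const_mul (f a)).add
      (((h1.pow 2).const_mul (f (a + 1) - f a)).div_const 2)).congr_deriv ?_
    simp; ring
  have h := sub_le_sub_of_hasDerivAt_le (F := F) (f := f) (by linarith : a ≤ a + 1) hF
    (fun x _ => (hH x).continuousAt.continuousWithinAt) hF' (fun x _ => hH x) (fun x hx => by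
      have h2 := hf.2 (left_mem_Icc.2 (by linarith)) (right_mem_Icc.2 (by linarith : a ≤ a + 1))
        (by linarith [hx.2] : 0 ≤ a + 1 - x) (by linarith [hx.1] : 0 ≤ x - a) (by ring)
      have h3 : (a + 1 - x) • a + (x - a) • (a + 1) = x := by simp only [smul_eq_mul]; ring
      rw [h3] at h2
      simp only [smul_eq_mul] at h2
      linarith)
  simp only [sub_self, add_sub_cancel_left] at h
  linarith

/-! ### The kernel of the points exp(κ√x) and its primitive -/

/-- The kernel `log |(φ(x) + φ(y)) / (φ(x) - φ(y))|` for `φ(x) = exp (κ √x)`. -/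
noncomputable def kern (κ y x : ℝ) : ℝ := logCoth |κ * (√x - √y)|

/-- A primitive of `kern κ y` on `[0, ∞)`. -/
noncomputable def kernPrim (κ y x : ℝ) : ℝ :=
  ∫ u in (0 : ℝ)..(κ * (√x - √y)), 2 / κ * (√y + u / κ) * logCoth |u|

lemma kern_nonneg (κ y x : ℝ) : 0 ≤ kern κ y x := logCoth_nonneg (abs_nonneg _)

lemma integrable_logCoth_abs : Integrable fun u => logCoth |u| :=
  integrable_comp_abs integrableOn_logCoth

lemma integrable_mul_logCoth_abs : Integrable fun u => u * logCoth |u| := by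
  refine (integrable_comp_abs integrableOn_mul_logCoth).mono'
    (measurable_id.mul (measurable_logCoth.comp measurable_abs)).aestronglyMeasurable ?_
  refine Eventually.of_forall fun u => ?_
  rw [norm_eq_abs, abs_mul, abs_of_nonneg (logCoth_nonneg (abs_nonneg u))]

lemma integrable_kernPrim (κ y : ℝ) :
    Integrable fun u => 2 / κ * (√y + u / κ) * logCoth |u| := by
  refine ((integrable_logCoth_abs.const_mul (2 / κ * √y)).add
    (integrable_mul_logCoth_abs.const_mul (2 / κ ^ 2))).congr (Eventually.of_forall fun u => ?_)
  simp only [Pi.add_apply]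
  by_cases h : κ = 0
  · simp [h]
  · field_simp

lemma continuous_kernPrim (κ y : ℝ) : Continuous (kernPrim κ y) :=
  ((integrable_kernPrim κ y).continuous_primitive 0).comp (by fun_prop)

/-- The integrand of `kernPrim` comes from the substitution x = (√y + u/κ)², dx = (2/κ)(√y + u/κ)
du, which the chain rule undoes. The primitive stays continuous across x = y, where the kernel is
singular. -/
lemma hasDerivAt_kernPrim {κ y x : ℝ} (hκ : 0 < κ) (hy : 0 ≤ y) (hx : 0 < x) (hxy : x ≠ y) :
    HasDerivAt (kernPrim κ y) (kern κ y x) x := by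
  have hs : √x - √y ≠ 0 := sub_ne_zero.2 fun h => hxy ((sqrt_inj hx.le hy).1 h)
  have hv : 0 < |κ * (√x - √y)| := abs_pos.2 (mul_ne_zero hκ.ne' hs)
  have hc : ContinuousAt (fun u => 2 / κ * (√y + u / κ) * logCoth |u|) (κ * (√x - √y)) := by
    have h1 : ContinuousAt (fun u : ℝ => logCoth |u|) (κ * (√x - √y)) :=
      ContinuousAt.comp (f := fun u : ℝ => |u|) (hasDerivAt_logCoth hv).continuousAt
        continuous_abs.continuousAt
    exact ContinuousAt.mul (by fun_prop) h1
  have h1 := intervalIntegral.integral_hasDerivAt_right (a := 0)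
    (integrable_kernPrim κ y).intervalIntegrable
    ((measurable_const.mul (measurable_const.add (measurable_id.div_const κ))).mul
      (measurable_logCoth.comp measurable_abs)).stronglyMeasurable.stronglyMeasurableAtFilter hc
  have h2 : HasDerivAt (fun x => κ * (√x - √y)) (κ * (1 / (2 * √x))) x :=
    ((hasDerivAt_sqrt hx.ne').sub_const _).const_mul κ
  refine (h1.comp x h2).congr_deriv ?_
  have : √x ≠ 0 := (sqrt_pos.2 hx).ne'
  simp only [kern]
  field_simp
  ring

/-- By `logCoth_add_le` the tail beyond X is at most e^(-X) times the whole integral. The inequality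
is proved on [0, T + X] and T tends to infinity. -/
lemma le_intervalIntegral_logCoth {X : ℝ} (hX : 0 ≤ X) :
    π ^ 2 / 4 * (1 - exp (-X)) ≤ ∫ u in (0 : ℝ)..X, logCoth |u| := by
  have hI : ∀ a b : ℝ, IntervalIntegrable (fun u => logCoth |u|) volume a b :=
    fun a b => integrable_logCoth_abs.intervalIntegrable
  have hint : ∫ u in Ioi (0 : ℝ), logCoth |u| = π ^ 2 / 4 := by
    rw [← integral_logCoth]
    exact setIntegral_congr_fun measurableSet_Ioi fun u hu => by simp only [abs_of_pos (show 0 < u from hu)]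
  have hle : ∀ T : ℝ, 0 ≤ T → ∫ u in (0 : ℝ)..T, logCoth |u| ≤ π ^ 2 / 4 := fun T hT => by
    rw [← hint, intervalIntegral.integral_of_le hT]
    exact setIntegral_mono_set integrable_logCoth_abs.integrableOn
      (Eventually.of_forall fun u => logCoth_nonneg (abs_nonneg _))
      Ioc_subset_Ioi_self.eventuallyLE
  have key : ∀ T : ℝ, 0 ≤ T → ∫ u in (0 : ℝ)..(T + X), logCoth |u|
      ≤ (∫ u in (0 : ℝ)..X, logCoth |u|) + exp (-X) * (π ^ 2 / 4) := fun T hT => by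
    rw [← intervalIntegral.integral_add_adjacent_intervals (hI 0 X) (hI X (T + X))]
    have h1 : ∫ u in X..(T + X), logCoth |u| = ∫ u in (0 : ℝ)..T, logCoth |u + X| := by
      rw [intervalIntegral.integral_comp_add_right (fun u => logCoth |u|), zero_add]
    have h2 : ∫ u in (0 : ℝ)..T, logCoth |u + X| ≤ ∫ u in (0 : ℝ)..T, exp (-X) * logCoth |u| := by
      refine intervalIntegral.integral_mono_on_of_le_Ioo hT
        (integrable_logCoth_abs.comp_add_right X).intervalIntegrable
        ((hI 0 T).const_mul _) fun u hu => ?_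
      rw [abs_of_pos hu.1, abs_of_pos (by linarith [hu.1])]
      exact logCoth_add_le hu.1 hX
    rw [intervalIntegral.integral_const_mul] at h2
    have h3 := mul_le_mul_of_nonneg_left (hle T hT) (exp_pos (-X)).le
    linarith
  have hlim := intervalIntegral_tendsto_integral_Ioi (μ := volume) (f := fun u => logCoth |u|) 0
    integrable_logCoth_abs.integrableOn (tendsto_atTop_add_const_right atTop X tendsto_id)
  rw [hint] at hlim
  have := le_of_tendsto hlim ((eventually_ge_atTop 0).mono key)
  linarith

/-- In the variable u the integral is 2√y/κ times the mass of `logCoth |u|` on [-κ√y, κ(√n - √y)],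
plus a first moment bounded by an absolutely convergent integral. The left truncation costs √y
e^(-κ√y), which is bounded. The right truncation is not bounded after multiplication by √y and is
kept explicitly. -/
lemma le_kernPrim_sub {κ : ℝ} (hκ : 0 < κ) : ∃ C : ℝ, ∀ y n : ℝ, 0 ≤ y → y ≤ n →
    π ^ 2 * √y / (2 * κ) * (2 - exp (-(κ * (√n - √y)))) - C ≤ kernPrim κ y n - kernPrim κ y 0 := by
  refine ⟨π ^ 2 / (2 * κ ^ 2) + 2 / κ ^ 2 * (∫ u : ℝ, |u * logCoth (|u|)|), fun y n hy hyn => ?_⟩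
  have hsq : √y ≤ √n := sqrt_le_sqrt hyn
  have hδ : 0 ≤ κ * (√n - √y) := mul_nonneg hκ.le (by linarith)
  have hsplit : kernPrim κ y n - kernPrim κ y 0
      = ∫ u in (-(κ * √y))..(κ * (√n - √y)), (2 / κ * √y * logCoth |u| + 2 / κ ^ 2 * (u * logCoth |u|)) := by
    have h0 : kernPrim κ y 0 = ∫ u in (0 : ℝ)..(-(κ * √y)), 2 / κ * (√y + u / κ) * logCoth |u| := by
      simp [kernPrim]
    rw [h0, kernPrim, intervalIntegral.integral_interval_sub_left
      (integrable_kernPrim κ y).intervalIntegrable (integrable_kernPrim κ y).intervalIntegrable]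
    refine intervalIntegral.integral_congr fun u _ => ?_
    field_simp
  have hL : ∫ u in (-(κ * √y))..(κ * (√n - √y)), logCoth |u|
      = (∫ u in (0 : ℝ)..(κ * √y), logCoth |u|) + ∫ u in (0 : ℝ)..(κ * (√n - √y)), logCoth |u| := by
    rw [← intervalIntegral.integral_add_adjacent_intervals (b := 0)
      integrable_logCoth_abs.intervalIntegrable integrable_logCoth_abs.intervalIntegrable]
    congr 1
    have := intervalIntegral.integral_comp_neg (a := 0) (b := κ * √y) (fun u => logCoth |u|)
    simp only [abs_neg, neg_zero] at this
    exact this.symm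
  have hM : -(∫ u : ℝ, |u * logCoth (|u|)|)
      ≤ ∫ u in (-(κ * √y))..(κ * (√n - √y)), u * logCoth |u| := by
    have hle : -(κ * √y) ≤ κ * (√n - √y) := by
      have : 0 ≤ κ * √y := by positivity
      linarith
    have h1 := intervalIntegral.abs_integral_le_integral_abs (f := fun u => u * logCoth |u|)
      (μ := volume) hle
    have h2 : ∫ u in (-(κ * √y))..(κ * (√n - √y)), |u * logCoth (|u|)| ≤ ∫ u : ℝ, |u * logCoth (|u|)| := by
      rw [intervalIntegral.integral_of_le hle]
      exact setIntegral_le_integral integrable_mul_logCoth_abs.abs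
        (Eventually.of_forall fun u => abs_nonneg _)
    exact (neg_le_neg (h1.trans h2)).trans (neg_abs_le _)
  rw [hsplit, intervalIntegral.integral_add
    (integrable_logCoth_abs.const_mul _).intervalIntegrable
    (integrable_mul_logCoth_abs.const_mul _).intervalIntegrable,
    intervalIntegral.integral_const_mul, intervalIntegral.integral_const_mul, hL]
  have h1 := le_intervalIntegral_logCoth (by positivity : 0 ≤ κ * √y)
  have h2 := le_intervalIntegral_logCoth hδ
  have h3 : √y * exp (-(κ * √y)) ≤ 1 / κ := by
    rw [le_div_iff₀ hκ]
    have h4 : (κ * √y) * exp (-(κ * √y)) ≤ exp (κ * √y) * exp (-(κ * √y)) := by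
      gcongr; linarith [add_one_le_exp (κ * √y)]
    rw [← exp_add, add_neg_cancel, exp_zero] at h4
    linarith
  have h5 := mul_le_mul_of_nonneg_left (add_le_add h1 h2) (by positivity : 0 ≤ 2 / κ * √y)
  have h6 := mul_le_mul_of_nonneg_left hM (by positivity : 0 ≤ 2 / κ ^ 2)
  have h7 := mul_le_mul_of_nonneg_left h3 (by positivity : 0 ≤ π ^ 2 / (2 * κ))
  have e1 : 2 / κ * √y * (π ^ 2 / 4 * (1 - exp (-(κ * √y))) + π ^ 2 / 4 * (1 - exp (-(κ * (√n - √y)))))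
      = π ^ 2 * √y / (2 * κ) * (2 - exp (-(κ * (√n - √y)))) - π ^ 2 / (2 * κ) * (√y * exp (-(κ * √y))) := by
    field_simp; ring
  have e2 : π ^ 2 / (2 * κ) * (1 / κ) = π ^ 2 / (2 * κ ^ 2) := by field_simp
  rw [e1] at h5
  rw [e2] at h7
  linarith

end Ganelius

namespace Ganelius

open Real MeasureTheory Set Filter Topology

/-! ### Convexity, monotonicity and size of the kernel on either side of y -/

lemma hasDerivAt_kern_of_lt {κ y x : ℝ} (hκ : 0 < κ) (hy : 0 ≤ y) (hx : y < x) :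
    HasDerivAt (kern κ y) (-(κ / (2 * (√x * sinh (κ * (√x - √y)))))) x := by
  have hx0 : 0 < x := hy.trans_lt hx
  have hs : √y < √x := sqrt_lt_sqrt hy hx
  have hv : 0 < κ * (√x - √y) := mul_pos hκ (by linarith)
  have h2 : HasDerivAt (fun x => κ * (√x - √y)) (κ * (1 / (2 * √x))) x :=
    ((hasDerivAt_sqrt hx0.ne').sub_const _).const_mul κ
  have h3 := (hasDerivAt_logCoth hv).comp x h2
  have h4 : kern κ y =ᶠ[𝓝 x] logCoth ∘ fun x => κ * (√x - √y) := by
    filter_upwards [lt_mem_nhds hx] with z hz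
    have : √y < √z := sqrt_lt_sqrt hy hz
    rw [kern, Function.comp, abs_of_pos (mul_pos hκ (by linarith))]
  refine (h3.congr_of_eventuallyEq h4).congr_deriv ?_
  have := (sqrt_pos.2 hx0).ne'
  have := (sinh_pos_iff.2 hv).ne'
  field_simp

lemma hasDerivAt_kern_of_gt {κ y x : ℝ} (hκ : 0 < κ) (hx0 : 0 < x) (hx : x < y) :
    HasDerivAt (kern κ y) (κ / (2 * (√x * sinh (κ * (√y - √x))))) x := by
  have hs : √x < √y := sqrt_lt_sqrt hx0.le hx
  have hv : 0 < κ * (√y - √x) := mul_pos hκ (by linarith)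
  have h2 : HasDerivAt (fun x => κ * (√y - √x)) (κ * (-(1 / (2 * √x)))) x :=
    ((hasDerivAt_sqrt hx0.ne').const_sub _).const_mul κ
  have h3 := (hasDerivAt_logCoth hv).comp x h2
  have h4 : kern κ y =ᶠ[𝓝 x] logCoth ∘ fun x => κ * (√y - √x) := by
    filter_upwards [lt_mem_nhds hx0, gt_mem_nhds hx] with z hz0 hz
    have : √z < √y := sqrt_lt_sqrt hz0.le hz
    rw [kern, Function.comp, abs_of_neg (mul_neg_of_pos_of_neg hκ (by linarith))]
    congr 1; ring
  refine (h3.congr_of_eventuallyEq h4).congr_deriv ?_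
  have := (sqrt_pos.2 hx0).ne'
  have := (sinh_pos_iff.2 hv).ne'
  field_simp

lemma convexOn_kern_Ioi {κ y : ℝ} (hκ : 0 < κ) (hy : 0 ≤ y) : ConvexOn ℝ (Ioi y) (kern κ y) := by
  have hd := fun x (hx : x ∈ Ioi y) => hasDerivAt_kern_of_lt hκ hy hx
  refine MonotoneOn.convexOn_of_deriv (convex_Ioi y)
    (fun x hx => (hd x hx).continuousAt.continuousWithinAt) ?_ ?_
  · rw [interior_Ioi]
    exact fun x hx => (hd x hx).differentiableAt.differentiableWithinAt
  · rw [interior_Ioi]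
    intro a ha b hb hab
    rw [(hd a ha).deriv, (hd b hb).deriv]
    have h1 : √y < √a := sqrt_lt_sqrt hy ha
    have h2 : √a ≤ √b := sqrt_le_sqrt hab
    have h0 : 0 ≤ √y := sqrt_nonneg y
    have h3 : 0 < sinh (κ * (√a - √y)) := sinh_pos_iff.2 (mul_pos hκ (by linarith))
    have h4 : sinh (κ * (√a - √y)) ≤ sinh (κ * (√b - √y)) := sinh_le_sinh.2 (by gcongr)
    have h5 : 0 < √a := by linarith
    apply neg_le_neg
    gcongr

lemma antitoneOn_mul_sinh {κ Y : ℝ} (hκ : 0 < κ) :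
    AntitoneOn (fun s => s * sinh (κ * (Y - s))) (Icc (1 / κ) Y) := by
  have hd : ∀ s, HasDerivAt (fun s => s * sinh (κ * (Y - s)))
      (1 * sinh (κ * (Y - s)) + s * (cosh (κ * (Y - s)) * (κ * (-1)))) s := fun s =>
    (hasDerivAt_id s).mul ((((hasDerivAt_id s).const_sub Y).const_mul κ).sinh)
  refine antitoneOn_of_deriv_nonpos (convex_Icc _ _)
    (fun s _ => (hd s).continuousAt.continuousWithinAt)
    (fun s _ => (hd s).differentiableAt.differentiableWithinAt) ?_
  rw [interior_Icc]
  intro s hs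
  rw [(hd s).deriv]
  have h1 : 1 ≤ κ * s := by
    have := (div_lt_iff₀ hκ).1 hs.1
    linarith
  have h2 := sinh_lt_cosh (κ * (Y - s))
  have h3 := mul_le_mul_of_nonneg_right h1 (cosh_pos (κ * (Y - s))).le
  linarith

/-- Left of y the derivative is κ / (2√x sinh(κ(√y - √x))). In the denominator √x grows while sinh
shrinks; by `antitoneOn_mul_sinh` the second effect wins once κ√x ≥ 1, hence the threshold 1/κ². -/
lemma convexOn_kern_Ico {κ y : ℝ} (hκ : 0 < κ) : ConvexOn ℝ (Ico (1 / κ ^ 2) y) (kern κ y) := by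
  have h0 : 0 < 1 / κ ^ 2 := by positivity
  have hd := fun x (hx : x ∈ Ico (1 / κ ^ 2) y) => hasDerivAt_kern_of_gt hκ (h0.trans_le hx.1) hx.2
  refine MonotoneOn.convexOn_of_deriv (convex_Ico _ _)
    (fun x hx => (hd x hx).continuousAt.continuousWithinAt) ?_ ?_
  · rw [interior_Ico]
    exact fun x hx => (hd x (Ioo_subset_Ico_self hx)).differentiableAt.differentiableWithinAt
  · rw [interior_Ico]
    intro a ha b hb hab
    rw [(hd a (Ioo_subset_Ico_self ha)).deriv, (hd b (Ioo_subset_Ico_self hb)).deriv]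
    have hsq : √(1 / κ ^ 2) = 1 / κ := by rw [one_div, sqrt_inv, sqrt_sq hκ.le, one_div]
    have h1 : 1 / κ ≤ √a := hsq ▸ sqrt_le_sqrt ha.1.le
    have h2 : √a ≤ √b := sqrt_le_sqrt hab
    have h3 : √b < √y := sqrt_lt_sqrt (h0.trans hb.1).le hb.2
    have h4 : 0 < sinh (κ * (√b - √b) + κ * (√y - √b)) := sinh_pos_iff.2 (by
      have := mul_pos hκ (sub_pos.2 h3); linarith)
    rw [sub_self, mul_zero, zero_add] at h4
    have h5 : 0 < √b := lt_of_lt_of_le (by positivity) (h1.trans h2)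
    have h6 := antitoneOn_mul_sinh (Y := √y) hκ ⟨h1, by linarith⟩ ⟨by linarith, h3.le⟩ h2
    simp only at h6
    gcongr

lemma kern_anti_of_lt {κ y x x' : ℝ} (hκ : 0 < κ) (hy : 0 ≤ y) (hx : y < x) (hxx : x ≤ x') :
    kern κ y x' ≤ kern κ y x := by
  have h1 : √y < √x := sqrt_lt_sqrt hy hx
  have h2 : √x ≤ √x' := sqrt_le_sqrt hxx
  have h3 : 0 < κ * (√x - √y) := mul_pos hκ (by linarith)
  have h4 : κ * (√x - √y) ≤ κ * (√x' - √y) := by gcongr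
  rw [kern, kern, abs_of_pos h3, abs_of_pos (h3.trans_le h4)]
  exact logCoth_anti h3 h4

lemma kern_mono_of_gt {κ y x x' : ℝ} (hκ : 0 < κ) (hx : x ≤ x') (hxx : x' < y) (h0 : 0 ≤ x') :
    kern κ y x ≤ kern κ y x' := by
  have h1 : √x' < √y := sqrt_lt_sqrt h0 hxx
  have h2 : √x ≤ √x' := sqrt_le_sqrt hx
  have h3 : κ * (√x' - √y) < 0 := mul_neg_of_pos_of_neg hκ (by linarith)
  have h4 : κ * (√x - √y) ≤ κ * (√x' - √y) := by gcongr
  rw [kern, kern, abs_of_neg h3, abs_of_neg (h4.trans_lt h3)]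
  exact logCoth_anti (by linarith) (by linarith)

lemma abs_sqrt_sub_sqrt {x y : ℝ} (hx : 0 ≤ x) (hy : 0 < y) :
    |√x - √y| = |x - y| / (√x + √y) := by
  have h : 0 < √x + √y := by have := sqrt_pos.2 hy; positivity
  rw [eq_div_iff h.ne', show |√x - √y| * (√x + √y) = |√x - √y| * |√x + √y| by rw [abs_of_pos h],
    ← abs_mul]
  congr 1
  have h1 := mul_self_sqrt hx
  have h2 := mul_self_sqrt hy.le
  linarith

/-- Within distance 1 of y one has |√x - √y| ≤ 1/√y. The resulting log √y at the two ends of the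
cell around y is what offsets the integral over that cell. -/
lemma log_sqrt_sub_le_kern {κ y x : ℝ} (hκ : 0 < κ) (hy : 1 ≤ y) (hx : 0 ≤ x) (hxy : x ≠ y)
    (h : |x - y| ≤ 1) : log (√y) - log κ ≤ kern κ y x := by
  have hy0 : 0 < y := by linarith
  have hsy : 0 < √y := sqrt_pos.2 hy0
  have hv : 0 < |κ * (√x - √y)| :=
    abs_pos.2 (mul_ne_zero hκ.ne' (sub_ne_zero.2 fun h => hxy ((sqrt_inj hx hy0.le).1 h)))
  have hle : |κ * (√x - √y)| ≤ κ / √y := by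
    rw [abs_mul, abs_of_pos hκ, abs_sqrt_sub_sqrt hx hy0, div_eq_mul_one_div κ]
    gcongr
    linarith [sqrt_nonneg x]
  have h2 := log_le_log hv hle
  rw [log_div hκ.ne' hsy.ne'] at h2
  have := neg_log_le_logCoth hv
  unfold kern
  linarith

lemma kern_le_of_near {κ y x : ℝ} (hκ : 0 < κ) (hy : 1 ≤ y) (hx : 0 ≤ x) (hxy : x ≠ y)
    (h : |x - y| ≤ 1) : kern κ y x ≤ (log 2 + κ - log κ + log 3 + log (√y)) - log (x - y) := by
  have hy0 : 0 < y := by linarith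
  have hsy : 1 ≤ √y := one_le_sqrt.2 hy
  have hsx := sqrt_nonneg x
  have hd : 0 < |x - y| := abs_pos.2 (sub_ne_zero.2 hxy)
  have heq : |κ * (√x - √y)| = κ * |x - y| / (√x + √y) := by
    rw [abs_mul, abs_of_pos hκ, abs_sqrt_sub_sqrt hx hy0, mul_div_assoc]
  have hsum : 0 < √x + √y := by linarith
  have hv : 0 < κ * |x - y| / (√x + √y) := by positivity
  have h1 : κ * |x - y| / (√x + √y) ≤ κ := by
    rw [div_le_iff₀ hsum]
    have : |x - y| ≤ √x + √y := by linarith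
    gcongr
  have h2 := logCoth_le hv
  rw [log_div (by positivity) hsum.ne', log_mul hκ.ne' hd.ne', log_abs] at h2
  have h3 : √x ≤ 2 * √y := by
    rw [show (2 : ℝ) * √y = √(4 * y) by rw [sqrt_mul (by norm_num), show (4 : ℝ) = 2 ^ 2 by norm_num, sqrt_sq (by norm_num)]]
    exact sqrt_le_sqrt (by linarith [(abs_le.1 h).2])
  have h4 : log (√x + √y) ≤ log (3 * √y) := log_le_log hsum (by linarith)
  rw [log_mul (by norm_num) (by positivity)] at h4
  rw [kern, heq]
  linarith

/-- The trapezoid rule fails on the cell containing y, so the kernel is replaced there by a constant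
minus log |x - y|, whose primitive is explicit. The 3 is the length of the cell plus two terms -θ
log θ ≤ 1. -/
lemma kernPrim_cell_le {κ y m : ℝ} (hκ : 0 < κ) (hy : 1 ≤ y) (hm : 0 ≤ m) (hmy : m < y)
    (hym : y ≤ m + 1) :
    kernPrim κ y (m + 1) - kernPrim κ y m ≤ log 2 + κ - log κ + log 3 + log (√y) + 3 := by
  set B := log 2 + κ - log κ + log 3 + log (√y) with hB
  -- `log` of a negative number is the logarithm of its absolute value, so a single H serves on both
  -- sides of y.
  let H : ℝ → ℝ := fun x => B * x - ((x - y) * log (x - y) - x)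
  have hHc : Continuous H := by
    have : Continuous fun x : ℝ => (x - y) * log (x - y) :=
      continuous_mul_log.comp (continuous_id.sub continuous_const)
    simp only [H]
    fun_prop
  have hH : ∀ x, x ≠ y → HasDerivAt H (B - log (x - y)) x := fun x hx => by
    have h1 := (hasDerivAt_mul_log (sub_ne_zero.2 hx)).comp x ((hasDerivAt_id x).sub_const y)
    refine (((hasDerivAt_id x).const_mul B).sub (h1.sub (hasDerivAt_id x))).congr_deriv ?_
    simp
  have hcell : ∀ a b, m ≤ a → a ≤ b → b ≤ m + 1 → (∀ x ∈ Ioo a b, x ≠ y) →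
      kernPrim κ y b - kernPrim κ y a ≤ H b - H a := fun a b ha hab hb hne =>
    sub_le_sub_of_hasDerivAt_le hab (continuous_kernPrim κ y).continuousOn hHc.continuousOn
      (fun x hx => hasDerivAt_kernPrim hκ (by linarith) (by linarith [hx.1]) (hne x hx))
      (fun x hx => hH x (hne x hx)) (fun x hx => kern_le_of_near hκ hy (by linarith [hx.1])
        (hne x hx) (abs_le.2 ⟨by linarith [hx.1], by linarith [hx.2]⟩))
  have h1 := hcell m y le_rfl hmy.le hym (fun x hx => hx.2.ne)
  have h2 := hcell y (m + 1) hmy.le hym le_rfl (fun x hx => hx.1.ne')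
  have hθ : ∀ θ : ℝ, 0 ≤ θ → -(θ * log θ) ≤ 1 := fun θ h0 => by
    rcases h0.eq_or_lt with rfl | h0
    · simp
    · have := one_sub_inv_le_log_of_pos h0
      have h3 := mul_le_mul_of_nonneg_left this h0.le
      rw [mul_sub, mul_inv_cancel₀ h0.ne'] at h3
      linarith
  have h3 := hθ (m + 1 - y) (by linarith)
  have h4 := hθ (y - m) (by linarith)
  have h5 : (m - y) * log (m - y) = -((y - m) * log (y - m)) := by
    rw [← log_neg_eq_log, neg_sub]; ring
  simp only [H] at h1 h2
  rw [h5] at h1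
  simp only [sub_self, log_zero, mul_zero] at h1 h2
  linarith

/-! ### Sums of the kernel against its integral -/

lemma kernPrim_sub_le_left {κ y : ℝ} (hκ : 0 < κ) {k₀ : ℕ} (hk : (k₀ : ℝ) < y) :
    kernPrim κ y k₀ - kernPrim κ y 0 ≤ ∑ j ∈ Finset.range (k₀ + 1), kern κ y j := by
  induction k₀ with
  | zero => simp [kern_nonneg]
  | succ k ih =>
    push_cast at hk ⊢
    have hk0 : (0 : ℝ) ≤ k := k.cast_nonneg
    rw [Finset.sum_range_succ]
    have h1 := ih (by linarith)
    have h2 := sub_le_sub_of_hasDerivAt_le (a := (k : ℝ)) (b := k + 1) (F := kernPrim κ y)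
      (f := kern κ y) (H := fun x => kern κ y (k + 1) * x) (h := fun _ => kern κ y (k + 1))
      (by linarith) (continuous_kernPrim κ y).continuousOn (by fun_prop)
      (fun x hx => hasDerivAt_kernPrim hκ (by linarith) (by linarith [hx.1]) (by linarith [hx.2]))
      (fun x _ => by simpa using (hasDerivAt_id x).const_mul (kern κ y (k + 1)))
      (fun x hx => kern_mono_of_gt hκ hx.2.le hk (by linarith))
    push_cast
    linarith

/-- Below k₀ only monotonicity is available and right endpoints are used; from k₀ on, trapezoids.
Compared with the full sum this leaves a surplus of half the value at k, at the price of half the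
value at k₀, which is bounded when y stays away from k₀. -/
lemma kernPrim_sub_le_middle {κ y : ℝ} (hκ : 0 < κ) {k₀ k : ℕ} (hk₀ : 1 / κ ^ 2 ≤ k₀)
    (hle : k₀ ≤ k) (hk : (k : ℝ) < y) :
    kernPrim κ y k - kernPrim κ y 0 + kern κ y k / 2 - kern κ y k₀ / 2
      ≤ ∑ j ∈ Finset.range (k + 1), kern κ y j := by
  induction k, hle using Nat.le_induction with
  | base => linarith [kernPrim_sub_le_left hκ hk]
  | succ k hle ih =>
    push_cast at hk ⊢
    rw [Finset.sum_range_succ]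
    have h1 := ih (by linarith)
    have hkk : (k₀ : ℝ) ≤ k := by exact_mod_cast hle
    have h0 : 0 < 1 / κ ^ 2 := by positivity
    have h2 := sub_le_trapezoid (a := (k : ℝ)) (F := kernPrim κ y) (f := kern κ y)
      (continuous_kernPrim κ y).continuousOn
      (fun x hx => hasDerivAt_kernPrim hκ (by linarith) (by linarith [hx.1]) (by linarith [hx.2]))
      ((convexOn_kern_Ico hκ).subset (fun x hx => ⟨by linarith [hx.1], by linarith [hx.2]⟩)
        (convex_Icc _ _))
    push_cast
    linarith

lemma kernPrim_sub_le_right {κ y : ℝ} (hκ : 0 < κ) (hy : 0 ≤ y) {m k : ℕ} (hle : m ≤ k)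
    (hm : y < m) :
    kernPrim κ y k - kernPrim κ y m + kern κ y m / 2 - kern κ y k / 2
      ≤ ∑ j ∈ Finset.Ico m k, kern κ y j := by
  induction k, hle using Nat.le_induction with
  | base => simp
  | succ k hle ih =>
    rw [Finset.sum_Ico_succ_top hle]
    have hkk : (m : ℝ) ≤ k := by exact_mod_cast hle
    have h2 := sub_le_trapezoid (a := (k : ℝ)) (F := kernPrim κ y) (f := kern κ y)
      (continuous_kernPrim κ y).continuousOn
      (fun x hx => hasDerivAt_kernPrim hκ hy (by linarith [hx.1]) (by linarith [hx.1]))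
      ((convexOn_kern_Ioi hκ hy).subset (fun x hx => by
        simp only [mem_Ioi]; linarith [hx.1]) (convex_Icc _ _))
    push_cast
    linarith

/-- Trapezoids on both sides of the cell [m, m+1] around y leave half the kernel at m and at m+1,
together at least log √y - log κ, and the cell itself costs log √y + O(1). The extra node n - 1/2
repairs the right end, where the point n is absent from the sum. -/
lemma le_sum_kern {κ : ℝ} (hκ : 0 < κ) : ∃ C : ℝ, ∀ (n : ℕ) (y : ℝ), 0 ≤ y → y ≤ n → 1 ≤ n →
    (∀ j : ℕ, j < n → (j : ℝ) ≠ y) → (n : ℝ) - 1 / 2 ≠ y →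
    π ^ 2 * √y / (2 * κ) * (2 - exp (-(κ * (√n - √y)))) - C
      ≤ ∑ j ∈ Finset.range n, kern κ y j + kern κ y (n - 1 / 2) := by
  obtain ⟨C₁, hC₁⟩ := le_kernPrim_sub hκ
  set k₀ : ℕ := ⌈1 / κ ^ 2⌉₊ with hk₀
  have hk₀' : 1 / κ ^ 2 ≤ k₀ := Nat.le_ceil _
  have hgap : 0 < κ * (√((k₀ : ℝ) + 1) - √(k₀ : ℝ)) :=
    mul_pos hκ (sub_pos.2 (sqrt_lt_sqrt (by positivity) (by linarith)))
  set G := logCoth (κ * (√((k₀ : ℝ) + 1) - √(k₀ : ℝ))) with hG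
  have hG0 : 0 ≤ G := logCoth_nonneg hgap.le
  set D := |C₁| + G + |log 2 + κ - log κ + log 3 + 3| + 2 * |log κ| with hD
  have hD0 : 0 ≤ D := by positivity
  refine ⟨π ^ 2 * √((k₀ : ℝ) + 1) / (2 * κ) * 2 + D, fun n y hy hyn hn hne hne' => ?_⟩
  have hnn : 0 ≤ ∑ j ∈ Finset.range n, kern κ y j + kern κ y (n - 1 / 2) :=
    add_nonneg (Finset.sum_nonneg fun _ _ => kern_nonneg _ _ _) (kern_nonneg _ _ _)
  have hexp := exp_pos (-(κ * (√n - √y)))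
  rcases le_or_gt y (k₀ + 1) with hy1 | hy1
  -- For bounded y the main term is bounded, and nonnegativity of the sum is enough.
  · have h1 : √y ≤ √((k₀ : ℝ) + 1) := sqrt_le_sqrt hy1
    have h2 : π ^ 2 * √y / (2 * κ) * (2 - exp (-(κ * (√n - √y))))
        ≤ π ^ 2 * √y / (2 * κ) * 2 := by gcongr; linarith
    have h3 : π ^ 2 * √y / (2 * κ) * 2 ≤ π ^ 2 * √((k₀ : ℝ) + 1) / (2 * κ) * 2 := by gcongr
    linarith
  have hk₀0 : (0 : ℝ) ≤ k₀ := k₀.cast_nonneg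
  have hy1' : 1 ≤ y := by linarith
  obtain ⟨m, hm⟩ : ∃ m, ⌈y⌉₊ = m + 1 :=
    Nat.exists_eq_succ_of_ne_zero (Nat.ceil_pos.2 (by linarith)).ne'
  have hmy : (m : ℝ) < y := Nat.lt_ceil.1 (by omega)
  have hym : y ≤ m + 1 := by have := Nat.le_ceil y; rw [hm] at this; exact_mod_cast this
  have hmn : m + 1 ≤ n := hm ▸ Nat.ceil_le.2 hyn
  have hk₀m : k₀ ≤ m := by
    have : (k₀ : ℝ) < m + 1 - 0 := by linarith
    have : k₀ < m + 1 := by exact_mod_cast (by linarith : (k₀ : ℝ) < m + 1)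
    omega
  have hlog : 0 ≤ log (√y) := log_nonneg (one_le_sqrt.2 hy1')
  have hm0 : (0 : ℝ) ≤ m := m.cast_nonneg
  have hmid := kernPrim_sub_le_middle hκ hk₀' hk₀m hmy
  have hcell := kernPrim_cell_le hκ hy1' hm0 hmy hym
  have htot := hC₁ y n hy hyn
  have hgm := log_sqrt_sub_le_kern hκ hy1' hm0 hmy.ne (abs_le.2 ⟨by linarith, by linarith⟩)
  have hgk : kern κ y k₀ ≤ G := by
    have h1 : √((k₀ : ℝ) + 1) ≤ √y := sqrt_le_sqrt hy1.le
    have h2 : √(k₀ : ℝ) < √((k₀ : ℝ) + 1) := sqrt_lt_sqrt (by positivity) (by linarith)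
    rw [kern, abs_of_neg (mul_neg_of_pos_of_neg hκ (by linarith))]
    refine logCoth_anti hgap ?_
    rw [← mul_neg]
    gcongr
    linarith
  have a1 := le_abs_self C₁
  have a2 := le_abs_self (log 2 + κ - log κ + log 3 + 3)
  have a3 := le_abs_self (log κ)
  have a5 := abs_nonneg (log κ)
  have a4 : 0 ≤ π ^ 2 * √((k₀ : ℝ) + 1) / (2 * κ) * 2 := by positivity
  rcases hmn.eq_or_lt with hmn | hmn
  -- Here y lies in the last cell: the node n - 1/2 is within distance 1 of y and replaces the
  -- missing right endpoint.
  · have hcast : (n : ℝ) = m + 1 := by rw [← hmn]; push_cast; ring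
    have hge := log_sqrt_sub_le_kern hκ hy1' (by rw [hcast]; linarith) hne'
      (abs_le.2 ⟨by rw [hcast]; linarith, by rw [hcast]; linarith⟩)
    rw [hcast] at htot hge ⊢
    rw [← hmn]
    linarith
  · have hcast : (m : ℝ) + 1 + 1 ≤ n := by exact_mod_cast hmn
    have hym' : y < ((m + 1 : ℕ) : ℝ) :=
      lt_of_le_of_ne (by push_cast; exact hym) (hne (m + 1) hmn).symm
    have hright := kernPrim_sub_le_right hκ hy hmn.le hym'
    have hgm1 := log_sqrt_sub_le_kern hκ hy1' (by positivity) hym'.ne'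
      (abs_le.2 ⟨by push_cast; linarith, by push_cast; linarith⟩)
    -- The right-hand trapezoids lack half the kernel at n; the node n - 1/2 lies between y and n
    -- and covers it.
    have hlast : kern κ y n ≤ kern κ y (n - 1 / 2) :=
      kern_anti_of_lt hκ hy (by linarith) (by linarith)
    rw [← Finset.sum_range_add_sum_Ico _ hmn.le]
    push_cast at hright hgm1
    have hlast0 := kern_nonneg κ y n
    linarith

end Ganelius

namespace Ganelius

open Real Set Filter Topology

/-! ### The modified Ganelius points -/

lemma cutoff_add_one_le {r : ℝ} (hr : 0 < r) {N : ℕ} (hN : 1 ≤ N) : cutoff r N + 1 ≤ N := by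
  have hN0 : (0 : ℝ) < N := by exact_mod_cast hN
  have : 0 < ⌈π / 4 * √((N : ℝ) * r)⌉ := Int.ceil_pos.2 (by positivity)
  unfold cutoff
  omega

lemma phi_eq {r : ℝ} {x : ℝ} (hx : 0 ≤ x) : phi r x = exp (π / √r * √x) := by
  rw [phi, sqrt_div hx]
  congr 1
  ring

lemma ganelius_mem_Ico {r : ℝ} {N : ℕ} {k : ℤ} (hk : cutoff r N + 2 ≤ k) (hkN : k ≤ N) :
    ganelius r N k ∈ Ico (4 / 5 : ℝ) 1 := by
  have h1 : (cutoff r N : ℝ) + 2 ≤ k := by exact_mod_cast hk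
  have h2 : (k : ℝ) ≤ N := by exact_mod_cast hkN
  rw [ganelius, if_neg (by omega), if_neg (by omega)]
  have h3 : 0 < 5 * ((N : ℝ) - cutoff r N - 1) := by linarith
  constructor
  · have : ((k : ℝ) - cutoff r N - 1) / (5 * ((N : ℝ) - cutoff r N - 1)) ≤ 1 / 5 := by
      rw [div_le_iff₀ h3]; linarith
    linarith
  · have : 0 < ((k : ℝ) - cutoff r N - 1) / (5 * ((N : ℝ) - cutoff r N - 1)) :=
      div_pos (by linarith) h3
    linarith

lemma ganelius_mem_Ioc {r : ℝ} (hr : 0 < r) {N : ℕ} {k : ℤ}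
    (hkN : k ≤ N) : ganelius r N k ∈ Ioc (0 : ℝ) 1 := by
  rcases le_or_gt (cutoff r N + 2) k with h | h
  · have := ganelius_mem_Ico h hkN
    exact ⟨by linarith [this.1], this.2.le⟩
  -- This also covers negative arguments, even a negative cutoff: there `√` is 0 and `phi` is 1, and
  -- `√` is monotone on all of ℝ.
  have key : ∀ x : ℝ, x ≤ cutoff r N → phi r x / phi r (cutoff r N) ∈ Ioc (0 : ℝ) 1 := by
    intro x hx
    refine ⟨div_pos (exp_pos _) (exp_pos _), (div_le_one (exp_pos _)).2 ?_⟩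
    unfold phi
    gcongr
  unfold ganelius
  split_ifs with h1 h2
  · have : (k : ℝ) ≤ cutoff r N := by exact_mod_cast h1
    exact key _ (by linarith)
  · have : (k : ℝ) = cutoff r N + 1 := by exact_mod_cast h2
    exact key _ (by linarith)
  · omega

/-- For t < 4/5 the bound `logCoth v ≥ 2 e^(-v)` reads 2t/a ≥ 2t. For t ≥ 4/5 both numbers lie in
[4/5, 1], so the ratio is at most (1/5)/(8/5) = 1/8 ≤ e^(-2). -/
lemma abs_sub_div_add_le_exp {t a : ℝ} (ht : t ∈ Ioc (0 : ℝ) 1) (ha : a ∈ Ico (4 / 5 : ℝ) 1) :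
    |t - a| / (t + a) ≤ exp (-(2 * t)) := by
  have ha0 : 0 < a := by linarith [ha.1]
  rcases lt_or_ge t (4 / 5) with h | h
  · have hta : t < a := h.trans_le ha.1
    rw [abs_sub_div_add ht.1 ha0 hta.ne]
    have hlog : log t < log a := log_lt_log ht.1 hta
    have hv : 0 < |log t - log a| := abs_pos.2 (by linarith)
    have h1 := two_mul_exp_le_logCoth hv
    rw [abs_of_neg (by linarith : log t - log a < 0), neg_neg, exp_sub, exp_log ht.1,
      exp_log ha0] at h1
    rw [abs_of_neg (by linarith : log t - log a < 0)]
    have h2 : t ≤ t / a := by rw [le_div_iff₀ ha0]; nlinarith [ha.2, ht.1]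
    exact exp_le_exp.2 (by linarith)
  · have h1 : |t - a| ≤ 1 / 5 := abs_le.2 ⟨by linarith [ha.2], by linarith [ht.2, ha.1]⟩
    have h2 : exp 2 ≤ 8 := by
      have h3 := exp_one_lt_d9
      have h4 : exp 2 = exp 1 * exp 1 := by rw [← exp_add]; norm_num
      rw [h4]
      nlinarith [exp_pos 1]
    have h5 : exp (-2) ≤ exp (-(2 * t)) := exp_le_exp.2 (by linarith [ht.2])
    have h6 : 1 / 8 ≤ exp (-2) := by
      rw [exp_neg, ← one_div]
      exact one_div_le_one_div_of_le (exp_pos _) h2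
    calc |t - a| / (t + a) ≤ (1 / 5) / (8 / 5) := by
          gcongr; linarith [ha.1]
      _ = 1 / 8 := by norm_num
      _ ≤ _ := h6.trans h5

/-- `∏_{k=1}^N |t - a_k| / (t + a_k)`. -/
noncomputable def ganeliusProd (r : ℝ) (N : ℕ) (t : ℝ) : ℝ :=
  ∏ j ∈ Finset.range N, |t - ganelius r N ((j : ℤ) + 1)| / (t + ganelius r N ((j : ℤ) + 1))

lemma abs_sub_div_add_mem {t a : ℝ} (ht : 0 < t) (ha : 0 < a) :
    |t - a| / (t + a) ∈ Icc (0 : ℝ) 1 := by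
  refine ⟨by positivity, (div_le_one (by positivity)).2 (abs_le.2 ⟨by linarith, by linarith⟩)⟩

lemma ganeliusProd_mem_Icc {r : ℝ} (hr : 0 < r) {N : ℕ} {t : ℝ} (ht : 0 < t) :
    ganeliusProd r N t ∈ Icc (0 : ℝ) 1 := by
  have h : ∀ j ∈ Finset.range N, |t - ganelius r N ((j : ℤ) + 1)|
      / (t + ganelius r N ((j : ℤ) + 1)) ∈ Icc (0 : ℝ) 1 := fun j hj => by
    have h1 := Finset.mem_range.1 hj
    exact abs_sub_div_add_mem ht (ganelius_mem_Ioc hr (by omega)).1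
  exact ⟨Finset.prod_nonneg fun j hj => (h j hj).1,
    Finset.prod_le_one (fun j hj => (h j hj).1) (fun j hj => (h j hj).2)⟩

/-- With t = exp(κ(√y - √n)), the points of index at most n + 1 have the same form with y replaced
by 0, …, n-1 and n - 1/2, so their factors are exp(-`kern`) and `le_sum_kern` applies; its
truncation exponential is t itself. Each of the q remaining points gives e^(-2t). -/
lemma ganeliusProd_le {r : ℝ} (hr : 0 < r) : ∃ C : ℝ, ∀ N n q : ℕ, cutoff r N = n → 1 ≤ n →
    N = n + 1 + q → ∀ y : ℝ, 0 ≤ y → y ≤ n → ∀ t : ℝ, t = exp (π / √r * (√y - √n)) →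
    ganeliusProd r N t ≤ exp (C - π * √r * √y / 2 * (2 - t) - 2 * t * q) := by
  have hsr : 0 < √r := sqrt_pos.2 hr
  set κ := π / √r with hκ
  have hκ0 : 0 < κ := by positivity
  obtain ⟨C, hC⟩ := le_sum_kern hκ0
  refine ⟨C, fun N n q hcut hn hN y hy hyn t ht => ?_⟩
  have ht0 : 0 < t := ht ▸ exp_pos _
  have hlt : log t = κ * (√y - √n) := by rw [ht, log_exp]
  have ht1 : t ≤ 1 := by
    rw [ht]
    exact exp_le_one_iff.2 (mul_nonpos_of_nonneg_of_nonpos hκ0.le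
      (sub_nonpos.2 (sqrt_le_sqrt hyn)))
  have hn1 : (1 : ℝ) ≤ n := by exact_mod_cast hn
  have hcut' : (cutoff r N : ℝ) = n := by rw [hcut]; simp
  have hpt : ∀ x : ℝ, 0 ≤ x → phi r x / phi r (cutoff r N) = exp (κ * √x - κ * √n) := fun x hx => by
    rw [hcut', phi_eq hx, phi_eq (by linarith), ← exp_sub]
  have hgj : ∀ j : ℕ, j < n → ganelius r N ((j : ℤ) + 1) = exp (κ * √j - κ * √n) := fun j hj => by
    rw [ganelius, if_pos (by omega), ← hpt j j.cast_nonneg]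
    push_cast; congr 2; ring
  have hgn : ganelius r N ((n : ℤ) + 1) = exp (κ * √((n : ℝ) - 1 / 2) - κ * √n) := by
    rw [ganelius, if_neg (by omega), if_pos (by omega), ← hpt _ (by linarith)]
    push_cast; congr 2; ring
  have hfac : ∀ x : ℝ, 0 ≤ x → x ≠ y → |t - exp (κ * √x - κ * √n)| / (t + exp (κ * √x - κ * √n))
      = exp (-kern κ y x) := fun x hx hxy => by
    have hs : √x ≠ √y := fun h => hxy ((sqrt_inj hx hy).1 h)
    rw [abs_sub_div_add ht0 (exp_pos _), log_exp, hlt, kern]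
    · congr 3
      rw [← abs_neg]
      congr 1
      ring
    · rw [ht]
      intro h
      have h1 := exp_injective h
      have : κ * (√y - √x) = 0 := by linarith
      rcases mul_eq_zero.1 this with h | h
      · exact hκ0.ne' h
      · exact hs (by linarith)
  have hzero : ∀ x : ℝ, 0 ≤ x → x = y → t - exp (κ * √x - κ * √n) = 0 := fun x _ hxy => by
    rw [ht, hxy, mul_sub, sub_self]
  -- If t is one of these points the product vanishes. The case is separate because `kern` is finite
  -- at its pole by convention.
  by_cases hex : (∃ j : ℕ, j < n ∧ (j : ℝ) = y) ∨ (n : ℝ) - 1 / 2 = y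
  · have hz : ganeliusProd r N t = 0 := by
      rcases hex with ⟨j, hj, hjy⟩ | hny
      · refine Finset.prod_eq_zero (i := j) (Finset.mem_range.2 (by omega)) ?_
        rw [hgj j hj, hzero j j.cast_nonneg hjy, abs_zero, zero_div]
      · refine Finset.prod_eq_zero (i := n) (Finset.mem_range.2 (by omega)) ?_
        rw [hgn, hzero _ (by linarith) hny, abs_zero, zero_div]
    rw [hz]
    exact (exp_pos _).le
  push Not at hex
  have hmain := hC n y hy hyn hn (fun j hj => hex.1 j hj) hex.2
  have he : exp (-(κ * (√n - √y))) = t := by rw [ht]; congr 1; ring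
  have hcoef : π ^ 2 * √y / (2 * κ) = π * √r * √y / 2 := by
    rw [hκ]; field_simp
  rw [he, hcoef] at hmain
  have hsplit : ganeliusProd r N t
      = (∏ j ∈ Finset.range n, exp (-kern κ y j)) * exp (-kern κ y (n - 1 / 2))
        * ∏ i ∈ Finset.range q, |t - ganelius r N (((n + 1 + i : ℕ) : ℤ) + 1)|
          / (t + ganelius r N (((n + 1 + i : ℕ) : ℤ) + 1)) := by
    unfold ganeliusProd
    rw [show Finset.range N = Finset.range (n + 1 + q) by rw [hN], Finset.prod_range_add,
      Finset.prod_range_succ, hgn, hfac _ (by linarith) hex.2]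
    congr 2
    refine Finset.prod_congr rfl fun j hj => ?_
    rw [hgj j (Finset.mem_range.1 hj),
      hfac _ j.cast_nonneg (hex.1 j (Finset.mem_range.1 hj))]
  have hthird : ∏ i ∈ Finset.range q, |t - ganelius r N (((n + 1 + i : ℕ) : ℤ) + 1)|
          / (t + ganelius r N (((n + 1 + i : ℕ) : ℤ) + 1)) ≤ exp (-(2 * t * q)) := by
    have hmem : ∀ i ∈ Finset.range q, ganelius r N (((n + 1 + i : ℕ) : ℤ) + 1) ∈ Ico (4 / 5 : ℝ) 1 :=
      fun i hi => ganelius_mem_Ico (by push_cast; omega) (by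
        have := Finset.mem_range.1 hi; push_cast; omega)
    have h1 := Finset.prod_le_prod (s := Finset.range q)
      (fun i hi => (abs_sub_div_add_mem ht0 (by linarith [(hmem i hi).1])).1)
      (fun i hi => abs_sub_div_add_le_exp ⟨ht0, ht1⟩ (hmem i hi))
    rw [Finset.prod_const, Finset.card_range, ← exp_nat_mul] at h1
    refine h1.trans_eq ?_
    congr 1; ring
  rw [hsplit, ← exp_sum, ← exp_add]
  refine (mul_le_mul_of_nonneg_left hthird (exp_pos _).le).trans ?_
  rw [← exp_add]
  apply exp_le_exp.2
  rw [Finset.sum_neg_distrib]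
  linarith

/-- **Ganelius' estimate** for the modified points. -/
theorem rpow_mul_ganeliusProd_le {r : ℝ} (hr : 0 < r) : ∃ C : ℝ, 0 < C ∧ ∀ N : ℕ, 1 ≤ N →
    cutoff r N ≠ 0 → ∀ t ∈ Ioc (0 : ℝ) 1,
      t ^ r * ganeliusProd r N t ≤ C * exp (-(π * √(r * N))) := by
  have hsr : 0 < √r := sqrt_pos.2 hr
  have hrr : √r * √r = r := mul_self_sqrt hr.le
  obtain ⟨C, hC⟩ := ganeliusProd_le hr
  set A := π * √r * (π / 4 * √r + 1) with hA
  have hA0 : 0 < A := by positivity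
  refine ⟨exp (|C| + 2 + A), exp_pos _, fun N hN h0 t ht => ?_⟩
  have hN1 : (1 : ℝ) ≤ N := by exact_mod_cast hN
  have hsN : 1 ≤ √(N : ℝ) := one_le_sqrt.2 hN1
  have hNN : √(N : ℝ) * √(N : ℝ) = N := mul_self_sqrt (by linarith)
  have hCa := neg_abs_le C
  have hCa' := le_abs_self C
  have hCa'' := abs_nonneg C
  obtain ⟨hG0, hG1⟩ := ganeliusProd_mem_Icc hr (N := N) ht.1
  rw [sqrt_mul hr.le, ← exp_add]
  have hceil : (⌈π / 4 * √((N : ℝ) * r)⌉ : ℝ) = N - cutoff r N := by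
    unfold cutoff; push_cast; ring
  have hc1 := Int.le_ceil (π / 4 * √((N : ℝ) * r))
  have hc2 := Int.ceil_lt_add_one (π / 4 * √((N : ℝ) * r))
  rw [hceil, sqrt_mul (by linarith)] at hc1 hc2
  have hlt := cutoff_add_one_le hr hN
  -- Since N - n is O(√N), √N - √n is bounded, and replacing n by N in the exponent costs only the
  -- constant A.
  have hgap : ∀ x : ℝ, 0 ≤ x → √N * √N - √x * √x ≤ π / 4 * (√N * √r) + 1 →
      π * (√r * √N) - π * √r * √x ≤ A := fun x hx h => by
    have hsx := sqrt_nonneg x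
    have h1 : √N - √x ≤ π / 4 * √r + 1 := by
      by_contra hcon
      push Not at hcon
      have hpos : 0 < π / 4 * √r + 1 := by positivity
      have h4 : (√N - √x) * (√N + √x) = √N * √N - √x * √x := by ring
      have h5 : (π / 4 * √r + 1) * √N < (√N - √x) * (√N + √x) := by
        have : (π / 4 * √r + 1) * √N < (√N - √x) * √N := by gcongr
        have h6 : (√N - √x) * √N ≤ (√N - √x) * (√N + √x) := by
          have : 0 ≤ √N - √x := by linarith
          gcongr; linarith
        linarith
      nlinarith
    have h2 := mul_le_mul_of_nonneg_left h1 (by positivity : 0 ≤ π * √r)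
    rw [hA]; linarith
  rcases lt_or_gt_of_ne h0 with hneg | hpos
  -- A negative cutoff forces N ≤ (π/4)√(Nr), so N is bounded and the trivial bound 1 suffices.
  · have hcut : (cutoff r N : ℝ) ≤ 0 := by exact_mod_cast hneg.le
    have hge : π * (√r * √N) ≤ A := by
      have := hgap 0 le_rfl (by
        rw [sqrt_zero, hNN]
        have : (cutoff r N : ℝ) ≤ -1 := by exact_mod_cast (by omega : cutoff r N ≤ -1)
        linarith)
      simpa using this
    have h1 : t ^ r ≤ 1 := rpow_le_one ht.1.le ht.2 hr.le
    calc t ^ r * ganeliusProd r N t ≤ 1 * 1 := by gcongr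
      _ = exp 0 := by simp
      _ ≤ _ := exp_le_exp.2 (by linarith)
  · obtain ⟨n, hn⟩ := Int.eq_ofNat_of_zero_le hpos.le
    obtain ⟨q, hq⟩ : ∃ q : ℕ, N = n + 1 + q := ⟨N - (n + 1), by omega⟩
    have hcut : (cutoff r N : ℝ) = n := by rw [hn]; simp
    have hn1 : 1 ≤ n := by omega
    have hqr : (N : ℝ) = n + 1 + q := by exact_mod_cast hq
    have hnA := hgap n n.cast_nonneg (by
      rw [hNN, mul_self_sqrt n.cast_nonneg, ← hcut]; linarith)
    have htr : t ^ r = exp (r * log t) := by rw [rpow_def_of_pos ht.1, mul_comm]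
    set κ := π / √r with hκ
    have hκ0 : 0 < κ := by positivity
    have hκr : r * κ = π * √r := by rw [hκ]; field_simp; linarith
    rw [htr]
    rcases le_or_gt (log t / κ + √n) 0 with hl | hl
    -- Here t is too small to be parametrized by a positive √y, and t^r alone has the required size.
    · have hl' : log t ≤ -(κ * √n) := by
        have : log t / κ ≤ -√n := by linarith
        rw [div_le_iff₀ hκ0] at this
        linarith
      calc exp (r * log t) * ganeliusProd r N t ≤ exp (r * -(κ * √n)) * 1 := by gcongr
        _ ≤ _ := by
          rw [mul_one]
          refine exp_le_exp.2 ?_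
          have : r * -(κ * √n) = -(r * κ * √n) := by ring
          rw [this, hκr]
          linarith
    · set y := (log t / κ + √n) ^ 2 with hy
      have hsy : √y = log t / κ + √n := sqrt_sq hl.le
      have hlogt : log t = κ * (√y - √n) := by rw [hsy]; field_simp; ring
      have hlog0 : log t ≤ 0 := log_nonpos ht.1.le ht.2
      have hsyn : √y ≤ √n := by
        have : log t / κ ≤ 0 := div_nonpos_of_nonpos_of_nonneg hlog0 hκ0.le
        linarith
      have hyn : y ≤ n := (sqrt_le_sqrt_iff n.cast_nonneg).1 hsyn
      have hte : t = exp (κ * (√y - √n)) := by rw [← hlogt, exp_log ht.1]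
      have hb := hC N n q hn hn1 hq y (sq_nonneg _) hyn t hte
      refine (mul_le_mul_of_nonneg_left hb (exp_pos _).le).trans ?_
      rw [← exp_add]
      refine exp_le_exp.2 ?_
      have e1 : r * log t = π * √r * √y - π * √r * √n := by
        rw [hlogt, ← mul_assoc, hκr]; ring
      have hsyN : √y ≤ √N := hsyn.trans (sqrt_le_sqrt (by rw [hqr]; linarith))
      -- This is the role of π/4 in the cutoff: 2tq ≥ (π/2)√r√N t - 2t, which pays for the
      -- truncation loss (π/2)√r√y t up to the constant 2.
      have h1 : π / 4 * (√N * √r) - 1 ≤ q := by rw [hcut] at hc1; linarith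
      have h2 := mul_le_mul_of_nonneg_left h1 (by linarith [ht.1] : 0 ≤ 2 * t)
      have h3 : π * √r * √y / 2 * t ≤ π * √r * √N / 2 * t := by
        have := ht.1.le
        gcongr
      have h4 := ht.2
      rw [e1]
      linarith

end Ganelius

namespace Ganelius

open Real MeasureTheory Set Filter Topology
open Complex (I)

/-! ### Residues in a strip -/

/-- The boundary integral over the rectangle `[-R, R] × [-η, η]`. -/
noncomputable def rectIntegral (η : ℝ) (f : ℂ → ℂ) (R : ℝ) : ℂ :=
  (∫ x : ℝ in (-R)..R, f (x + (-η : ℝ) * I)) - (∫ x : ℝ in (-R)..R, f (x + η * I))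
    + I • (∫ y : ℝ in (-η)..η, f (R + y * I)) - I • (∫ y : ℝ in (-η)..η, f ((-R : ℝ) + y * I))

/-- A closed set that contains the sides of the rectangle `[-R, R] × [-η, η]`. -/
def rectSides (η R : ℝ) : Set ℂ := {ζ | |ζ.im| ≤ η ∧ (|ζ.im| = η ∨ |ζ.re| = R)}

section rectIntegral

variable {η R : ℝ} {f g : ℂ → ℂ}

lemma intervalIntegrable_of_rectSides (hη : 0 ≤ η) (hR : 0 ≤ R)
    (hf : ContinuousOn f (rectSides η R)) :
    IntervalIntegrable (fun x : ℝ => f (x + (-η : ℝ) * I)) volume (-R) R ∧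
    IntervalIntegrable (fun x : ℝ => f (x + η * I)) volume (-R) R ∧
    IntervalIntegrable (fun y : ℝ => f (R + y * I)) volume (-η) η ∧
    IntervalIntegrable (fun y : ℝ => f ((-R : ℝ) + y * I)) volume (-η) η := by
  have hy : ∀ y ∈ uIcc (-η) η, |y| ≤ η := fun y hy => by
    rw [uIcc_of_le (by linarith)] at hy; exact abs_le.2 hy
  refine ⟨?_, ?_, ?_, ?_⟩ <;> refine ContinuousOn.intervalIntegrable
    (hf.comp (Continuous.continuousOn (by fun_prop)) fun x hx => ?_)
  · simp [rectSides, abs_of_nonneg hη]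
  · simp [rectSides, abs_of_nonneg hη]
  · simpa [rectSides, abs_of_nonneg hR] using hy x hx
  · simpa [rectSides, abs_of_nonneg hR] using hy x hx

lemma rectIntegral_add (hη : 0 ≤ η) (hR : 0 ≤ R) (hf : ContinuousOn f (rectSides η R))
    (hg : ContinuousOn g (rectSides η R)) :
    rectIntegral η (fun ζ => f ζ + g ζ) R = rectIntegral η f R + rectIntegral η g R := by
  obtain ⟨f1, f2, f3, f4⟩ := intervalIntegrable_of_rectSides hη hR hf
  obtain ⟨g1, g2, g3, g4⟩ := intervalIntegrable_of_rectSides hη hR hg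
  simp only [rectIntegral]
  rw [intervalIntegral.integral_add f1 g1, intervalIntegral.integral_add f2 g2,
    intervalIntegral.integral_add f3 g3, intervalIntegral.integral_add f4 g4]
  simp only [smul_eq_mul]
  ring

lemma rectIntegral_const_mul (c : ℂ) :
    rectIntegral η (fun ζ => c * f ζ) R = c * rectIntegral η f R := by
  simp only [rectIntegral, intervalIntegral.integral_const_mul, smul_eq_mul]
  ring

lemma rectIntegral_sum {ι : Type*} (s : Finset ι) (c : ι → ℂ) (k : ι → ℂ → ℂ) (hη : 0 ≤ η)
    (hR : 0 ≤ R) (hk : ∀ i ∈ s, ContinuousOn (k i) (rectSides η R)) :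
    rectIntegral η (fun ζ => ∑ i ∈ s, c i * k i ζ) R = ∑ i ∈ s, c i * rectIntegral η (k i) R := by
  classical
  induction s using Finset.induction_on with
  | empty => simp [rectIntegral]
  | insert a s ha ih =>
    simp only [Finset.sum_insert ha]
    rw [rectIntegral_add (f := fun ζ => c a * k a ζ) (g := fun ζ => ∑ i ∈ s, c i * k i ζ) hη hR
      (continuousOn_const.mul (hk a (Finset.mem_insert_self a s)))
      (continuousOn_finsetSum _ fun i hi =>
        continuousOn_const.mul (hk i (Finset.mem_insert_of_mem hi))),
      rectIntegral_const_mul, ih fun i hi => hk i (Finset.mem_insert_of_mem hi)]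

lemma rectIntegral_congr (hη : 0 ≤ η) (hR : 0 ≤ R) (h : ∀ ζ ∈ rectSides η R, f ζ = g ζ) :
    rectIntegral η f R = rectIntegral η g R := by
  have hy : ∀ y ∈ uIcc (-η) η, |y| ≤ η := fun y hy => by
    rw [uIcc_of_le (by linarith)] at hy; exact abs_le.2 hy
  unfold rectIntegral
  congr 1
  · congr 1
    · congr 1 <;> refine intervalIntegral.integral_congr fun x _ => h _ ?_
      · simp [rectSides, abs_of_nonneg hη]
      · simp [rectSides, abs_of_nonneg hη]
    · congr 1
      refine intervalIntegral.integral_congr fun x hx => h _ ?_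
      simpa [rectSides, abs_of_nonneg hR] using hy x hx
  · congr 1
    refine intervalIntegral.integral_congr fun x hx => h _ ?_
    simpa [rectSides, abs_of_nonneg hR] using hy x hx

lemma rectIntegral_eq_zero {d : ℝ} (hη : 0 ≤ η) (hηd : η < d)
    (hf : DifferentiableOn ℂ f {ζ | |ζ.im| < d}) : rectIntegral η f R = 0 := by
  have := Complex.integral_boundary_rect_eq_zero_of_differentiableOn f
    ((-R : ℝ) + (-η : ℝ) * I) (R + η * I) (hf.mono fun ζ hζ => by
      have h2 := hζ.2
      simp only [Complex.add_im, Complex.ofReal_im, Complex.mul_im, Complex.ofReal_re,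
        Complex.I_re, Complex.I_im, mul_zero, mul_one, zero_add, add_zero, mem_preimage] at h2
      rw [uIcc_of_le (by linarith)] at h2
      exact (abs_le.2 h2).trans_lt hηd)
  simpa [rectIntegral] using this

end rectIntegral

lemma integral_poisson {η : ℝ} (hη : 0 < η) (q : ℝ) :
    Integrable (fun x : ℝ => η / ((x - q) ^ 2 + η ^ 2)) ∧
      ∫ x : ℝ, η / ((x - q) ^ 2 + η ^ 2) = π := by
  have h : (fun x : ℝ => η / ((x - q) ^ 2 + η ^ 2))
      = fun x => η⁻¹ * (fun z : ℝ => (1 + (η⁻¹ * z) ^ 2)⁻¹) (x - q) := by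
    funext x
    have : (x - q) ^ 2 + η ^ 2 ≠ 0 := by positivity
    have : 1 + (η⁻¹ * (x - q)) ^ 2 ≠ 0 := by positivity
    field_simp
    ring
  have hi : Integrable fun z : ℝ => (1 + (η⁻¹ * z) ^ 2)⁻¹ :=
    integrable_inv_one_add_sq.comp_mul_left' (inv_ne_zero hη.ne')
  rw [h]
  refine ⟨(hi.comp_sub_right q).const_mul _, ?_⟩
  rw [integral_const_mul, integral_sub_right_eq_self (fun z : ℝ => (1 + (η⁻¹ * z) ^ 2)⁻¹),
    Measure.integral_comp_mul_left (fun z : ℝ => (1 + z ^ 2)⁻¹), integral_univ_inv_one_add_sq,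
    inv_inv, abs_of_pos hη, smul_eq_mul, inv_mul_cancel_left₀ hη.ne']

lemma continuousOn_inv_sub_rectSides {η q R : ℝ} (hη : 0 < η) (hR : |q| < R) :
    ContinuousOn (fun ζ : ℂ => (ζ - q)⁻¹) (rectSides η R) := by
  refine ContinuousOn.inv₀ (by fun_prop) fun ζ hζ h => ?_
  have h' : ζ = q := sub_eq_zero.1 h
  rcases hζ.2 with h1 | h1
  · rw [h'] at h1; simp at h1; exact hη.ne h1
  · rw [h'] at h1; simp at h1; exact hR.ne h1

/-- The two horizontal sides combine into 2i times the Poisson kernel, of integral π; the vertical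
sides are O(1/R). With Cauchy's theorem for the regular part this serves as the residue theorem. -/
lemma tendsto_rectIntegral_inv {η : ℝ} (hη : 0 < η) (q : ℝ) :
    Tendsto (rectIntegral η fun ζ => (ζ - q)⁻¹) atTop (𝓝 (2 * π * I)) := by
  obtain ⟨hi, hv⟩ := integral_poisson hη q
  have h1 : Tendsto (fun R : ℝ => ((∫ x : ℝ in (-R)..R, η / ((x - q) ^ 2 + η ^ 2) : ℝ) : ℂ) * (2 * I))
      atTop (𝓝 (π * (2 * I))) := by
    have := intervalIntegral_tendsto_integral hi tendsto_neg_atTop_atBot tendsto_id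
    rw [hv] at this
    exact ((Complex.continuous_ofReal.tendsto _).comp this).mul_const _
  have hside : ∀ R y : ℝ, |q| < R → ‖((R : ℂ) + y * I - q)⁻¹‖ ≤ (R - |q|)⁻¹ ∧
      ‖(((-R : ℝ) : ℂ) + y * I - q)⁻¹‖ ≤ (R - |q|)⁻¹ := fun R y hR => by
    rw [norm_inv, norm_inv]
    have hq := abs_le.1 (le_refl |q|)
    constructor <;> refine inv_anti₀ (by linarith) (le_trans ?_ (Complex.abs_re_le_norm _))
    · have : ((R : ℂ) + y * I - q).re = R - q := by simp
      rw [this]; exact le_trans (by linarith) (le_abs_self _)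
    · have : (((-R : ℝ) : ℂ) + y * I - q).re = -R - q := by simp
      rw [this]; exact le_trans (by linarith) (neg_le_abs _)
  have h2 : Tendsto (fun R : ℝ => I • (∫ y : ℝ in (-η)..η, ((R : ℂ) + y * I - q)⁻¹)
      - I • (∫ y : ℝ in (-η)..η, (((-R : ℝ) : ℂ) + y * I - q)⁻¹)) atTop (𝓝 0) := by
    have h3 : Tendsto (fun R : ℝ => 2 * ((R - |q|)⁻¹ * |η - -η|)) atTop (𝓝 0) := by
      have : Tendsto (fun R : ℝ => (R - |q|)⁻¹) atTop (𝓝 0) :=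
        tendsto_inv_atTop_zero.comp (tendsto_atTop_add_const_right atTop (-|q|) tendsto_id)
      simpa using (this.mul_const |η - -η|).const_mul 2
    refine squeeze_zero_norm' ?_ h3
    filter_upwards [eventually_gt_atTop |q|] with R hR
    refine (norm_sub_le _ _).trans ?_
    rw [norm_smul, norm_smul, Complex.norm_I, one_mul, one_mul, two_mul]
    exact add_le_add
      (intervalIntegral.norm_integral_le_of_norm_le_const fun y _ => (hside R y hR).1)
      (intervalIntegral.norm_integral_le_of_norm_le_const fun y _ => (hside R y hR).2)
  have h3 := h1.add h2
  rw [add_zero, show (π : ℂ) * (2 * I) = 2 * π * I by ring] at h3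
  refine h3.congr' ?_
  filter_upwards [eventually_gt_atTop |q|] with R hR
  have hR0 : 0 ≤ R := (abs_nonneg q).trans hR.le
  obtain ⟨f1, f2, -, -⟩ := intervalIntegrable_of_rectSides hη.le hR0
    (continuousOn_inv_sub_rectSides hη hR)
  rw [rectIntegral, add_sub_assoc, ← intervalIntegral.integral_sub f1 f2]
  congr 1
  rw [← intervalIntegral.integral_ofReal, ← intervalIntegral.integral_mul_const]
  refine intervalIntegral.integral_congr fun x _ => ?_
  have e1 : (x : ℂ) + (-η : ℝ) * I - q ≠ 0 := fun h => by
    have := congrArg Complex.im h; simp at this; exact hη.ne' this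
  have e2 : (x : ℂ) + η * I - q ≠ 0 := fun h => by
    have := congrArg Complex.im h; simp at this; exact hη.ne' this
  have e3 : (((x - q) ^ 2 + η ^ 2 : ℝ) : ℂ) ≠ 0 := by
    have : (0 : ℝ) < (x - q) ^ 2 + η ^ 2 := by positivity
    exact_mod_cast this.ne'
  have e4 : (((x - q) ^ 2 + η ^ 2 : ℝ) : ℂ) = ((x : ℂ) + (-η : ℝ) * I - q) * ((x : ℂ) + η * I - q) := by
    push_cast
    linear_combination ((η : ℂ) ^ 2) * Complex.I_sq
  rw [e4] at e3
  simp only [Complex.ofReal_div]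
  rw [e4, ← sub_eq_zero]
  field_simp
  push_cast
  ring

/-- The sum of the residues of a function with simple poles on the real line is bounded by its
integrals over the two boundary lines of a strip. -/
lemma norm_sum_residues_le {ι : Type*} {η d : ℝ} (hη : 0 < η) (hηd : η < d) (s : Finset ι)
    (q : ι → ℝ) (c : ι → ℂ) {H F : ℂ → ℂ} {G : ℝ → ℝ}
    (hH : DifferentiableOn ℂ H {ζ | |ζ.im| < d})
    (hF : ∀ ζ : ℂ, |ζ.im| < d → (∀ i ∈ s, ζ ≠ q i) → F ζ = H ζ + ∑ i ∈ s, c i * (ζ - q i)⁻¹)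
    (hG : Integrable G) (hFG : ∀ ζ : ℂ, |ζ.im| = η → ‖F ζ‖ ≤ G ζ.re)
    (hdecay : ∀ ε > 0, ∀ᶠ R in atTop, ∀ ζ : ℂ, |ζ.im| ≤ η → |ζ.re| = R → ‖F ζ‖ ≤ ε) :
    π * ‖∑ i ∈ s, c i‖ ≤ ∫ x, G x := by
  have hev : ∀ᶠ R in atTop, 0 ≤ R ∧ ∀ i ∈ s, |q i| < R :=
    (eventually_ge_atTop 0).and
      ((Finset.eventually_all s).2 fun i _ => eventually_gt_atTop |q i|)
  have hlim : Tendsto (rectIntegral η F) atTop (𝓝 (∑ i ∈ s, c i * (2 * π * I))) := by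
    have h1 : Tendsto (fun R => ∑ i ∈ s, c i * rectIntegral η (fun ζ => (ζ - q i)⁻¹) R) atTop
        (𝓝 (∑ i ∈ s, c i * (2 * π * I))) :=
      tendsto_finsetSum s fun i _ => (tendsto_rectIntegral_inv hη (q i)).const_mul (c i)
    refine h1.congr' ?_
    filter_upwards [hev] with R hR
    have hside : ∀ i ∈ s, ContinuousOn (fun ζ : ℂ => (ζ - q i)⁻¹) (rectSides η R) :=
      fun i hi => continuousOn_inv_sub_rectSides hη (hR.2 i hi)
    rw [rectIntegral_congr hη.le hR.1 (f := F)
      (g := fun ζ => H ζ + ∑ i ∈ s, c i * (ζ - q i)⁻¹) fun ζ hζ =>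
        hF ζ (hζ.1.trans_lt hηd) fun i hi h => ?_,
      rectIntegral_add (g := fun ζ => ∑ i ∈ s, c i * (ζ - q i)⁻¹) hη.le hR.1 (hH.continuousOn.mono fun ζ hζ => hζ.1.trans_lt hηd)
        (continuousOn_finsetSum _ fun i hi => continuousOn_const.mul (hside i hi)),
      rectIntegral_eq_zero hη.le hηd hH, zero_add,
      rectIntegral_sum s c _ hη.le hR.1 hside]
    have h2 := hR.2 i hi
    rcases hζ.2 with h3 | h3 <;> rw [h] at h3 <;> simp at h3
    · exact hη.ne h3
    · exact h2.ne h3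
  have hG0 : ∀ x, 0 ≤ G x := fun x => by
    have := (norm_nonneg _).trans (hFG (x + η * I) (by simp [abs_of_pos hη]))
    simpa using this
  -- Each horizontal side contributes at most ∫ G and each vertical side at most 2ηε.
  have hbound : ∀ ε > 0, ‖∑ i ∈ s, c i * (2 * π * I)‖ ≤ (2 * ∫ x, G x) + ε * (4 * η) := by
    intro ε hε
    refine le_of_tendsto hlim.norm ?_
    filter_upwards [hdecay ε hε, eventually_ge_atTop 0] with R hR hR0
    have hhor : ∀ τ : ℝ, |τ| = η → ‖∫ x : ℝ in (-R)..R, F (x + τ * I)‖ ≤ ∫ x, G x := fun τ hτ => by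
      refine (intervalIntegral.norm_integral_le_of_norm_le (by linarith)
        (Eventually.of_forall fun x _ => ?_) hG.intervalIntegrable).trans ?_
      · simpa using hFG (x + τ * I) (by simpa using hτ)
      · rw [intervalIntegral.integral_of_le (by linarith)]
        exact setIntegral_le_integral hG (Eventually.of_forall hG0)
    have hver : ∀ τ : ℝ, |τ| = R → ‖I • ∫ y : ℝ in (-η)..η, F (τ + y * I)‖ ≤ ε * (2 * η) :=
      fun τ hτ => by
      rw [norm_smul, Complex.norm_I, one_mul]
      refine (intervalIntegral.norm_integral_le_of_norm_le_const (C := ε) fun y hy => ?_).trans ?_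
      · rw [uIoc_of_le (by linarith)] at hy
        exact hR _ (by simpa using abs_le.2 ⟨hy.1.le, hy.2⟩) (by simpa using hτ)
      · rw [abs_of_pos (by linarith)]; gcongr; linarith
    have b1 := hhor (-η) (by rw [abs_neg, abs_of_pos hη])
    have b2 := hhor η (abs_of_pos hη)
    have b3 := hver R (abs_of_nonneg hR0)
    have b4 := hver (-R) (by rw [abs_neg, abs_of_nonneg hR0])
    unfold rectIntegral
    refine (norm_sub_le _ _).trans ?_
    refine (add_le_add (norm_add_le _ _) le_rfl).trans ?_
    have b5 := norm_sub_le (∫ x : ℝ in (-R)..R, F (x + (-η : ℝ) * I))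
      (∫ x : ℝ in (-R)..R, F (x + η * I))
    linarith
  have hle : ‖∑ i ∈ s, c i * (2 * π * I)‖ ≤ 2 * ∫ x, G x := by
    refine le_of_forall_pos_le_add fun δ hδ => ?_
    have := hbound (δ / (4 * η)) (by positivity)
    rwa [div_mul_cancel₀ _ (by positivity : (4 * η) ≠ 0)] at this
  rw [← Finset.sum_mul, norm_mul] at hle
  have hn : ‖(2 * π * I : ℂ)‖ = 2 * π := by simp [abs_of_pos pi_pos]
  rw [hn] at hle
  linarith

/-- Partial fractions for a quotient `A / ∏ h i` whose denominator has simple real zeros. -/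
lemma norm_sum_residues_div_prod_le {ι : Type*} [DecidableEq ι] {η d : ℝ} (hη : 0 < η)
    (hηd : η < d) (s : Finset ι) {q : ι → ℝ} (hq : Set.InjOn q s) {A : ℂ → ℂ} {h : ι → ℂ → ℂ}
    {G : ℝ → ℝ} (hs : s.Nonempty)
    (hA : DifferentiableOn ℂ A {ζ | |ζ.im| < d})
    (hh : ∀ i ∈ s, DifferentiableOn ℂ (h i) {ζ | |ζ.im| < d})
    (hzero : ∀ i ∈ s, ∀ ζ : ℂ, |ζ.im| < d → (h i ζ = 0 ↔ ζ = q i))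
    (hderiv : ∀ i ∈ s, deriv (h i) (q i) ≠ 0)
    (hG : Integrable G) (hFG : ∀ ζ : ℂ, |ζ.im| = η → ‖A ζ / ∏ i ∈ s, h i ζ‖ ≤ G ζ.re)
    (hdecay : ∀ ε > 0, ∀ᶠ R in atTop, ∀ ζ : ℂ, |ζ.im| ≤ η → |ζ.re| = R →
      ‖A ζ / ∏ i ∈ s, h i ζ‖ ≤ ε) :
    π * ‖∑ i ∈ s, A (q i) / (deriv (h i) (q i) * ∏ j ∈ s.erase i, h j (q i))‖ ≤ ∫ x, G x := by
  have hd : 0 < d := hη.trans hηd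
  have hopen : IsOpen {ζ : ℂ | |ζ.im| < d} :=
    isOpen_lt (Complex.continuous_im.abs) continuous_const
  have hqmem : ∀ i, (q i : ℂ) ∈ {ζ : ℂ | |ζ.im| < d} := fun i => by simpa using hd
  have hqinj : Set.InjOn (fun i => (q i : ℂ)) s := fun i hi j hj hij =>
    hq hi hj (Complex.ofReal_injective hij)
  -- Dividing out the simple zero leaves a nonvanishing factor, which is moved into the numerator
  -- `A₂`; only the polynomial ∏ (ζ - q i) remains below.
  let e : ι → ℂ → ℂ := fun i => dslope (h i) (q i)
  have he : ∀ i ∈ s, DifferentiableOn ℂ (e i) {ζ | |ζ.im| < d} := fun i hi =>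
    (Complex.differentiableOn_dslope (hopen.mem_nhds (hqmem i))).2 (hh i hi)
  have hhe : ∀ i ∈ s, ∀ ζ : ℂ, h i ζ = (ζ - q i) * e i ζ := fun i hi ζ => by
    have h1 := sub_smul_dslope (h i) (q i : ℂ) ζ
    rw [(hzero i hi _ (hqmem i)).2 rfl, sub_zero, smul_eq_mul] at h1
    exact h1.symm
  have he0 : ∀ i ∈ s, ∀ ζ : ℂ, |ζ.im| < d → e i ζ ≠ 0 := fun i hi ζ hζ h0 => by
    by_cases hζq : ζ = q i
    · rw [hζq] at h0
      simp only [e, dslope_same] at h0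
      exact hderiv i hi h0
    · have h1 := hhe i hi ζ
      rw [h0, mul_zero] at h1
      exact hζq ((hzero i hi ζ hζ).1 h1)
  let A₂ : ℂ → ℂ := fun ζ => A ζ / ∏ i ∈ s, e i ζ
  have hA₂ : DifferentiableOn ℂ A₂ {ζ | |ζ.im| < d} :=
    hA.div (DifferentiableOn.fun_finsetProd he) fun ζ hζ =>
      Finset.prod_ne_zero_iff.2 fun i hi => he0 i hi ζ hζ
  let w : ι → ℂ := Lagrange.nodalWeight s (fun i => (q i : ℂ))
  have key := norm_sum_residues_le hη hηd s q (fun i => w i * A₂ (q i))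
    (H := fun ζ => ∑ i ∈ s, w i * dslope A₂ (q i) ζ) (F := fun ζ => A ζ / ∏ i ∈ s, h i ζ) (G := G)
    (DifferentiableOn.fun_sum fun i hi => ((Complex.differentiableOn_dslope
      (hopen.mem_nhds (hqmem i))).2 hA₂).const_mul (w i)) (fun ζ hζ hne => ?_) hG hFG hdecay
  · convert key using 3
    refine Finset.sum_congr rfl fun i hi => ?_
    have h1 : ∏ j ∈ s, e j (q i) = deriv (h i) (q i) * ∏ j ∈ s.erase i, e j (q i) := by
      rw [← Finset.mul_prod_erase s _ hi]
      simp only [e, dslope_same]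
    have h2 : ∏ j ∈ s.erase i, h j (q i)
        = (∏ j ∈ s.erase i, ((q i : ℂ) - q j)) * ∏ j ∈ s.erase i, e j (q i) := by
      rw [← Finset.prod_mul_distrib]
      exact Finset.prod_congr rfl fun j hj => hhe j (Finset.mem_of_mem_erase hj) _
    simp only [w, A₂]
    rw [h1, h2, Lagrange.nodalWeight, Finset.prod_inv_distrib, div_eq_mul_inv, div_eq_mul_inv,
      mul_inv, mul_inv, mul_inv]
    ring
  · have hne' : ∀ i ∈ s, ζ - q i ≠ 0 := fun i hi => sub_ne_zero.2 (hne i hi)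
    have h1 : ∏ i ∈ s, h i ζ = (∏ i ∈ s, (ζ - q i)) * ∏ i ∈ s, e i ζ := by
      rw [← Finset.prod_mul_distrib]
      exact Finset.prod_congr rfl fun j hj => hhe j hj _
    -- Lagrange interpolation of the constant 1, divided by the nodal polynomial, is this partial
    -- fraction expansion.
    have h2 : (∏ i ∈ s, (ζ - q i))⁻¹ = ∑ i ∈ s, w i * (ζ - q i)⁻¹ := by
      have h3 := Lagrange.eval_interpolate_not_at_node (s := s) (v := fun i => (q i : ℂ))
        (1 : ι → ℂ) (x := ζ) hne
      rw [Lagrange.interpolate_one hqinj hs, Polynomial.eval_one, Lagrange.eval_nodal] at h3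
      simp only [Pi.one_apply, mul_one] at h3
      exact (eq_inv_of_mul_eq_one_right h3.symm).symm
    have h3 : A ζ / ∏ i ∈ s, h i ζ = (∏ i ∈ s, (ζ - q i))⁻¹ * A₂ ζ := by
      rw [h1, div_eq_mul_inv, mul_inv]; simp only [A₂]; ring
    rw [h3, h2, Finset.sum_mul, ← Finset.sum_add_distrib]
    refine Finset.sum_congr rfl fun i hi => ?_
    have h4 := sub_smul_dslope A₂ (q i : ℂ) ζ
    rw [smul_eq_mul] at h4
    have h5 : A₂ ζ = (ζ - q i) * dslope A₂ (q i) ζ + A₂ (q i) := by rw [h4]; ring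
    rw [h5]
    have := hne' i hi
    field_simp

end Ganelius

namespace Ganelius

open Real Set Filter Topology

/-! ### Geometry of the strip and of its image `Λ_d` -/

section strip

open Complex (I)

lemma sinh_eq_re_im (w : ℂ) :
    Complex.sinh w = (sinh w.re * cos w.im : ℝ) + (cosh w.re * sin w.im : ℝ) * I := by
  conv_lhs => rw [← Complex.re_add_im w]
  rw [Complex.sinh_add, Complex.sinh_mul_I, Complex.cosh_mul_I]
  push_cast
  ring

lemma cosh_eq_re_im (w : ℂ) :
    Complex.cosh w = (cosh w.re * cos w.im : ℝ) + (sinh w.re * sin w.im : ℝ) * I := by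
  conv_lhs => rw [← Complex.re_add_im w]
  rw [Complex.cosh_add, Complex.sinh_mul_I, Complex.cosh_mul_I]
  push_cast
  ring

lemma norm_sq_sinh (w : ℂ) :
    ‖Complex.sinh w‖ ^ 2 = sinh w.re ^ 2 + sin w.im ^ 2 := by
  rw [sinh_eq_re_im w, Complex.sq_norm, Complex.normSq_add_mul_I]
  linear_combination (sin w.im ^ 2) * cosh_sq w.re + sinh w.re ^ 2 * sin_sq_add_cos_sq w.im

lemma norm_sq_cosh (w : ℂ) :
    ‖Complex.cosh w‖ ^ 2 = sinh w.re ^ 2 + cos w.im ^ 2 := by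
  rw [cosh_eq_re_im w, Complex.sq_norm, Complex.normSq_add_mul_I]
  linear_combination (cos w.im ^ 2) * cosh_sq w.re + sinh w.re ^ 2 * sin_sq_add_cos_sq w.im

lemma norm_cosh_le (w : ℂ) : ‖Complex.cosh w‖ ≤ cosh w.re := by
  refine le_of_sq_le_sq ?_ (cosh_pos _).le
  rw [norm_sq_cosh, cosh_sq]
  linarith [cos_sq_le_one w.im]

lemma mul_cosh_le_norm_cosh {κ : ℝ} (hκ : 0 ≤ κ) {w : ℂ} (hw : κ ≤ cos w.im) :
    κ * cosh w.re ≤ ‖Complex.cosh w‖ := by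
  refine le_of_sq_le_sq ?_ (norm_nonneg _)
  rw [norm_sq_cosh, mul_pow, cosh_sq]
  have h1 : κ ^ 2 ≤ cos w.im ^ 2 := by gcongr
  have h2 := cos_sq_le_one w.im
  nlinarith [sq_nonneg (sinh w.re)]

lemma mul_cosh_le_norm_sinh {κ : ℝ} (hκ : 0 ≤ κ) {w : ℂ} (hw : κ ≤ |sin w.im|) :
    κ * cosh w.re ≤ ‖Complex.sinh w‖ := by
  refine le_of_sq_le_sq ?_ (norm_nonneg _)
  rw [norm_sq_sinh, mul_pow, cosh_sq]
  have h1 : κ ^ 2 ≤ sin w.im ^ 2 := by rw [← sq_abs (sin w.im)]; gcongr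
  have h2 := sin_sq_le_one w.im
  nlinarith [sq_nonneg (sinh w.re)]

lemma abs_sinh_le_norm_sinh (w : ℂ) : |sinh w.re| ≤ ‖Complex.sinh w‖ := by
  refine le_of_sq_le_sq ?_ (norm_nonneg _)
  rw [norm_sq_sinh, sq_abs]
  linarith [sq_nonneg (sin w.im)]

lemma sinh_eq_zero_iff_of_abs_im_lt {w : ℂ} (hw : |w.im| < π) : Complex.sinh w = 0 ↔ w = 0 := by
  refine ⟨fun h => ?_, fun h => by rw [h, Complex.sinh_zero]⟩
  have h1 := norm_sq_sinh w
  rw [h, norm_zero] at h1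
  have h2 : sinh w.re = 0 := by nlinarith [sq_nonneg (sinh w.re), sq_nonneg (sin w.im)]
  have h3 : sin w.im = 0 := by nlinarith [sq_nonneg (sinh w.re), sq_nonneg (sin w.im)]
  obtain ⟨h4, h5⟩ := abs_lt.1 hw
  exact Complex.ext (sinh_eq_zero.1 h2) ((sin_eq_zero_iff_of_lt_of_lt h4 h5).1 h3)

lemma cosh_re_pos {w : ℂ} (hw : |w.im| < π / 2) : 0 < (Complex.cosh w).re := by
  have h1 : 0 < cos w.im := cos_pos_of_mem_Ioo (abs_lt.1 hw)
  have h2 := cosh_pos w.re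
  rw [cosh_eq_re_im w]
  simp only [Complex.add_re, Complex.ofReal_re, Complex.re_ofReal_mul, Complex.I_re, mul_zero,
    add_zero]
  positivity

lemma cosh_ne_zero_of_abs_im_lt {w : ℂ} (hw : |w.im| < π / 2) : Complex.cosh w ≠ 0 := fun h => by
  have := cosh_re_pos hw
  rw [h] at this
  simp at this

lemma abs_tanh_re_le_norm_tanh {w : ℂ} (hw : |w.im| < π / 2) :
    |tanh w.re| ≤ ‖Complex.tanh w‖ := by
  have h0 : 0 < ‖Complex.cosh w‖ := norm_pos_iff.2 (cosh_ne_zero_of_abs_im_lt hw)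
  rw [tanh_eq_sinh_div_cosh, Complex.tanh_eq_sinh_div_cosh, norm_div, abs_div,
    abs_of_pos (cosh_pos _)]
  gcongr
  · exact abs_sinh_le_norm_sinh w
  · exact norm_cosh_le w

/-- The squared modulus is (sinh² + sin²)/(sinh² + cos²); as sin ≤ cos here, it is smallest when
sinh = 0. The bound tends to 1 as |Im w| tends to π/4, the image of the edge of the strip. -/
lemma sin_div_cos_le_norm_tanh {w : ℂ} (hw : |w.im| ≤ π / 4) :
    sin |w.im| / cos |w.im| ≤ ‖Complex.tanh w‖ := by
  have h0 : 0 ≤ |w.im| := abs_nonneg _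
  have hpi := pi_pos
  have hs : 0 ≤ sin |w.im| := sin_nonneg_of_nonneg_of_le_pi h0 (by linarith)
  have hc : 0 < cos |w.im| := cos_pos_of_mem_Ioo ⟨by linarith, by linarith⟩
  have hn : 0 < ‖Complex.cosh w‖ :=
    norm_pos_iff.2 (cosh_ne_zero_of_abs_im_lt (by linarith))
  have hsc : sin |w.im| ≤ cos |w.im| := by
    have h1 : sin |w.im| ≤ sin (π / 4) :=
      sin_le_sin_of_le_of_le_pi_div_two (by linarith) (by linarith) hw
    have h2 : cos (π / 4) ≤ cos |w.im| := cos_le_cos_of_nonneg_of_le_pi h0 (by linarith) hw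
    rw [sin_pi_div_four] at h1
    rw [cos_pi_div_four] at h2
    linarith
  rw [Complex.tanh_eq_sinh_div_cosh, norm_div, div_le_div_iff₀ hc hn]
  refine le_of_sq_le_sq ?_ (by positivity)
  rw [mul_pow, mul_pow, norm_sq_sinh, norm_sq_cosh, cos_abs, ← sq_abs (sin w.im)]
  have e1 : |sin w.im| ^ 2 = sin |w.im| ^ 2 := by
    rcases abs_cases w.im with h | h <;> rw [h.1] <;> simp
  rw [e1, ← cos_abs w.im]
  have : sin |w.im| ^ 2 ≤ cos |w.im| ^ 2 := by gcongr
  nlinarith [sq_nonneg (sinh w.re)]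

lemma hasDerivAt_tanh {w : ℂ} (hw : Complex.cosh w ≠ 0) :
    HasDerivAt Complex.tanh ((Complex.cosh w ^ 2)⁻¹) w := by
  have h := (Complex.hasDerivAt_sinh w).div (Complex.hasDerivAt_cosh w) hw
  have he : Complex.tanh = fun z => Complex.sinh z / Complex.cosh z :=
    funext Complex.tanh_eq_sinh_div_cosh
  rw [he]
  refine h.congr_deriv ?_
  rw [← sq, ← sq, Complex.cosh_sq_sub_sinh_sq, one_div]

lemma analyticAt_tanh {w : ℂ} (hw : Complex.cosh w ≠ 0) : AnalyticAt ℂ Complex.tanh w := by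
  have he : Complex.tanh = fun z => Complex.sinh z / Complex.cosh z :=
    funext Complex.tanh_eq_sinh_div_cosh
  rw [he]
  exact Complex.analyticAt_sinh.div Complex.analyticAt_cosh hw

variable {ζ : ℂ}

lemma abs_half_im_lt (hζ : |ζ.im| < π) : |(ζ / 2).im| < π / 2 := by
  have : (ζ / 2).im = ζ.im / 2 := by simp
  rw [this, abs_div, abs_two]
  linarith

lemma cosh_half_ne_zero (hζ : |ζ.im| < π) : Complex.cosh (ζ / 2) ≠ 0 :=
  cosh_ne_zero_of_abs_im_lt (abs_half_im_lt hζ)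

lemma one_sub_tanh_sq (hζ : |ζ.im| < π) :
    1 - Complex.tanh (ζ / 2) ^ 2 = (Complex.cosh (ζ / 2) ^ 2)⁻¹ := by
  have h := cosh_half_ne_zero hζ
  have h1 := Complex.cosh_sq_sub_sinh_sq (ζ / 2)
  rw [Complex.tanh_eq_sinh_div_cosh]
  field_simp
  exact h1

/-- The quantity is 1/cosh²(ζ/2), and cosh(ζ/2) has positive real part, so its square avoids the
negative axis. -/
lemma one_sub_tanh_sq_mem_slitPlane (hζ : |ζ.im| < π) :
    1 - Complex.tanh (ζ / 2) ^ 2 ∈ Complex.slitPlane := by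
  rw [one_sub_tanh_sq hζ]
  have h := cosh_re_pos (abs_half_im_lt hζ)
  have h2 : Complex.cosh (ζ / 2) ^ 2 ∈ Complex.slitPlane := by
    rw [sq]
    refine Complex.mem_slitPlane_iff.2 ?_
    by_cases him : (Complex.cosh (ζ / 2)).im = 0
    · left
      rw [Complex.mul_re, him]
      simp only [mul_zero, sub_zero]
      positivity
    · right
      rw [Complex.mul_im]
      intro h0
      have : (Complex.cosh (ζ / 2)).re * (Complex.cosh (ζ / 2)).im = 0 := by linarith
      rcases mul_eq_zero.1 this with h1 | h1
      · exact h.ne' h1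
      · exact him h1
  have h3 : 0 < Complex.normSq (Complex.cosh (ζ / 2) ^ 2) :=
    Complex.normSq_pos.2 (Complex.slitPlane_ne_zero h2)
  rw [Complex.mem_slitPlane_iff, Complex.inv_re, Complex.inv_im]
  exact (Complex.mem_slitPlane_iff.1 h2).imp (fun h => div_pos h h3)
    fun h => div_ne_zero (neg_ne_zero.2 h) h3.ne'

lemma one_add_div_one_sub_tanh (hζ : |ζ.im| < π) :
    (1 + Complex.tanh (ζ / 2)) / (1 - Complex.tanh (ζ / 2)) = Complex.exp ζ := by
  have h := cosh_half_ne_zero hζ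
  have h1 : Complex.cosh (ζ / 2) + Complex.sinh (ζ / 2) = Complex.exp (ζ / 2) :=
    Complex.cosh_add_sinh _
  have h2 : Complex.cosh (ζ / 2) - Complex.sinh (ζ / 2) = Complex.exp (-(ζ / 2)) :=
    Complex.cosh_sub_sinh _
  have h3 : (1 + Complex.tanh (ζ / 2)) = Complex.exp (ζ / 2) / Complex.cosh (ζ / 2) := by
    rw [Complex.tanh_eq_sinh_div_cosh, ← h1]; field_simp
  have h4 : (1 - Complex.tanh (ζ / 2)) = Complex.exp (-(ζ / 2)) / Complex.cosh (ζ / 2) := by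
    rw [Complex.tanh_eq_sinh_div_cosh, ← h2]; field_simp
  rw [h3, h4, div_div_div_cancel_right₀ h, ← Complex.exp_sub]
  congr 1; ring

lemma exp_mem_slitPlane (hζ : |ζ.im| < π) : Complex.exp ζ ∈ Complex.slitPlane := by
  rw [Complex.mem_slitPlane_iff_arg]
  refine ⟨?_, Complex.exp_ne_zero _⟩
  obtain ⟨h1, h2⟩ := abs_lt.1 hζ
  rw [← Complex.log_im, Complex.log_exp h1 h2.le]
  exact h2.ne

lemma cartanh_tanh (hζ : |ζ.im| < π) : cartanh (Complex.tanh (ζ / 2)) = ζ / 2 := by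
  obtain ⟨h1, h2⟩ := abs_lt.1 hζ
  rw [cartanh, one_add_div_one_sub_tanh hζ, Complex.log_exp h1 h2.le]
  ring

lemma analyticAt_cartanh (hζ : |ζ.im| < π) : AnalyticAt ℂ cartanh (Complex.tanh (ζ / 2)) := by
  have h1 : 1 - Complex.tanh (ζ / 2) ≠ 0 := fun h => by
    have := one_add_div_one_sub_tanh hζ
    rw [h, div_zero] at this
    exact Complex.exp_ne_zero _ this.symm
  unfold cartanh
  refine analyticAt_const.mul (AnalyticAt.clog ?_ ?_)
  · exact (analyticAt_const.add analyticAt_id).div (analyticAt_const.sub analyticAt_id) h1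
  · rw [one_add_div_one_sub_tanh hζ]
    exact exp_mem_slitPlane hζ

lemma analyticAt_one_sub_sq_cpow (hζ : |ζ.im| < π) (s : ℂ) :
    AnalyticAt ℂ (fun z : ℂ => (1 - z ^ 2) ^ s) (Complex.tanh (ζ / 2)) :=
  (analyticAt_const.sub (analyticAt_id.pow 2)).cpow analyticAt_const
    (one_sub_tanh_sq_mem_slitPlane hζ)

lemma norm_one_sub_tanh_sq_cpow (hζ : |ζ.im| < π) (s : ℝ) :
    ‖(1 - Complex.tanh (ζ / 2) ^ 2) ^ (s : ℂ)‖ = ‖Complex.cosh (ζ / 2)‖ ^ (-(2 * s)) := by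
  rw [Complex.norm_cpow_real, one_sub_tanh_sq hζ, norm_inv, norm_pow, rpow_neg (norm_nonneg _),
    rpow_mul (norm_nonneg _), inv_rpow (by positivity)]
  norm_cast

lemma one_sub_tanh_sq_cpow_ne_zero (hζ : |ζ.im| < π) (s : ℂ) :
    (1 - Complex.tanh (ζ / 2) ^ 2) ^ s ≠ 0 := by
  have := Complex.slitPlane_ne_zero (one_sub_tanh_sq_mem_slitPlane hζ)
  rw [Ne, Complex.cpow_eq_zero_iff]
  tauto

lemma norm_weight (hζ : |ζ.im| < π) (μ : ℝ) :
    ‖weight μ (Complex.tanh (ζ / 2))‖ = ‖Complex.cosh (ζ / 2)‖ ^ (-μ) := by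
  rw [weight, norm_one_sub_tanh_sq_cpow hζ]
  congr 2; ring

lemma differentiableAt_tanh_half (hζ : |ζ.im| < π) :
    DifferentiableAt ℂ (fun ζ : ℂ => Complex.tanh (ζ / 2)) ζ :=
  (hasDerivAt_tanh (cosh_half_ne_zero hζ)).differentiableAt.comp (f := fun ζ : ℂ => ζ / 2) ζ
    (by fun_prop)

end strip

lemma ofReal_tanh_half (ξ : ℝ) : Complex.tanh ((ξ : ℂ) / 2) = ((tanh (ξ / 2) : ℝ) : ℂ) := by
  push_cast; rfl

lemma exists_eq_tanh_half {x : ℝ} (hx : x ∈ Ioo (-1 : ℝ) 1) : ∃ ξ : ℝ, x = tanh (ξ / 2) :=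
  ⟨2 * artanh x, by rw [mul_div_cancel_left₀ _ two_ne_zero, tanh_artanh hx]⟩

lemma tanh_half_mem_region {d : ℝ} {ζ : ℂ} (hζ : |ζ.im| < d) :
    Complex.tanh (ζ / 2) ∈ region d := ⟨ζ, hζ, rfl⟩

lemma norm_le_weight {d μ : ℝ} (hdπ : d ≤ π) {f : ℂ → ℂ} (hf : hNorm d μ f ≤ 1) {ζ : ℂ}
    (hζ : |ζ.im| < d) : ‖f (Complex.tanh (ζ / 2))‖ ≤ ‖Complex.cosh (ζ / 2)‖ ^ (-μ) := by
  have hζπ : |ζ.im| < π := hζ.trans_le hdπ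
  have h1 : ‖f (Complex.tanh (ζ / 2)) / weight μ (Complex.tanh (ζ / 2))‖ₑ ≤ 1 :=
    (le_iSup₂ (f := fun z (_ : z ∈ region d) => ‖f z / weight μ z‖ₑ) _
      (tanh_half_mem_region hζ)).trans hf
  rw [← ofReal_norm, ENNReal.ofReal_le_one, norm_div, div_le_one, norm_weight hζπ] at h1
  · exact h1
  · exact norm_pos_iff.2 (one_sub_tanh_sq_cpow_ne_zero hζπ _)

lemma hNorm_le_one {d μ : ℝ} (hdπ : d ≤ π) {f : ℂ → ℂ}
    (hf : ∀ ζ : ℂ, |ζ.im| < d → ‖f (Complex.tanh (ζ / 2))‖ ≤ ‖weight μ (Complex.tanh (ζ / 2))‖) :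
    hNorm d μ f ≤ 1 := by
  refine iSup₂_le fun z hz => ?_
  obtain ⟨ζ, hζ, rfl⟩ := hz
  have hζπ : |ζ.im| < π := lt_of_lt_of_le hζ hdπ
  rw [← ofReal_norm, ENNReal.ofReal_le_one, norm_div]
  exact (div_le_one (norm_pos_iff.2 (one_sub_tanh_sq_cpow_ne_zero hζπ _))).2 (hf ζ hζ)

end Ganelius

namespace Ganelius

open Real MeasureTheory Set Filter Topology

/-! ### The Cauchy integral estimate -/

lemma integrable_exp_neg_mul_abs_sub {a : ℝ} (ha : 0 < a) (ξ : ℝ) :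
    Integrable (fun u : ℝ => exp (-(a * |u - ξ|))) ∧
      ∫ u : ℝ, exp (-(a * |u - ξ|)) = 2 / a := by
  have h1 : IntegrableOn (fun v : ℝ => exp (-(a * v))) (Ioi 0) := by
    simpa only [neg_mul] using integrableOn_exp_mul_Ioi (a := -a) (by linarith) 0
  have h2 : ∫ v in Ioi (0 : ℝ), exp (-(a * v)) = 1 / a := by
    have := integral_exp_mul_Ioi (a := -a) (by linarith) 0
    simp only [neg_mul] at this
    rw [this]
    simp
  refine ⟨(integrable_comp_abs h1).comp_sub_right ξ, ?_⟩
  rw [integral_sub_right_eq_self (fun v : ℝ => exp (-(a * |v|))),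
    integral_comp_abs (f := fun v => exp (-(a * v))), h2]
  ring

lemma tanh_le_abs_tanh {a u : ℝ} (ha : 0 < a) (hu : a ≤ |u|) : tanh a ≤ |tanh u| := by
  have hu0 : u ≠ 0 := abs_pos.1 (ha.trans_le hu)
  refine (le_abs_self _).trans ?_
  rw [abs_tanh_eq ha.ne', abs_tanh_eq hu0, abs_of_pos ha]
  exact exp_le_exp.2 (neg_le_neg (logCoth_anti (by linarith) (by linarith)))

lemma tanh_pos' {a : ℝ} (ha : 0 < a) : 0 < tanh a := by
  rw [tanh_eq_sinh_div_cosh]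
  exact div_pos (sinh_pos_iff.2 ha) (cosh_pos a)

lemma cosh_le_two_mul (x y : ℝ) : cosh x ≤ 2 * cosh y * cosh (x - y) := by
  have h1 : cosh x = cosh y * cosh (x - y) + sinh y * sinh (x - y) := by
    rw [← cosh_add]; congr 1; ring
  have h2 : 0 < cosh (y - (x - y)) := cosh_pos _
  rw [cosh_sub] at h2
  linarith

lemma cosh_rpow_neg_le {l v : ℝ} (hl0 : 0 ≤ l) (hl1 : l ≤ 1) :
    cosh v ^ (-l) ≤ 2 * exp (-(l * |v|)) := by
  have h1 : exp |v| / 2 ≤ cosh v := by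
    rw [← cosh_abs, cosh_eq]
    linarith [exp_pos (-|v|)]
  have h2 : (exp |v| / 2) ^ l ≤ cosh v ^ l := by gcongr
  rw [rpow_neg (cosh_pos v).le]
  calc (cosh v ^ l)⁻¹ ≤ ((exp |v| / 2) ^ l)⁻¹ := by gcongr
    _ = 2 ^ l * exp (-(l * |v|)) := by
      rw [div_rpow (exp_pos _).le (by norm_num), inv_div, ← exp_mul, exp_neg, mul_comm l]
      rfl
    _ ≤ 2 * exp (-(l * |v|)) := by
      gcongr
      calc (2 : ℝ) ^ l ≤ 2 ^ (1 : ℝ) := rpow_le_rpow_of_exponent_le (by norm_num) hl1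
        _ = 2 := rpow_one 2

lemma rpow_le_rpow_abs {x M e : ℝ} (hx : 0 < x) (h1 : x ≤ M) (h2 : x⁻¹ ≤ M) :
    x ^ e ≤ M ^ |e| := by
  rcases le_total 0 e with he | he
  · rw [abs_of_nonneg he]; gcongr
  · rw [abs_of_nonpos he]
    calc x ^ e = (x⁻¹) ^ (-e) := by rw [inv_rpow hx.le, rpow_neg hx.le, inv_inv]
      _ ≤ M ^ (-e) := rpow_le_rpow (by positivity) h2 (by linarith)

/-- The Cauchy kernel of the strip, with the growth factor that belongs to exponent `e`. -/
lemma kernel_le {κ δ e a g s : ℝ} {u ξ : ℝ} (hκ : 0 < κ) (hκ1 : κ ≤ 1) (hδ : 0 < δ)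
    (he : |e| < 1) (hal : κ * cosh (u / 2) ≤ a) (hau : a ≤ cosh (u / 2))
    (hg : g = cosh ((u - ξ) / 2)) (hs : δ * g ≤ s) :
    a ^ e * (cosh (ξ / 2) / 2) / s
      ≤ 2 / (κ * δ) * cosh (ξ / 2) ^ (e + 1) * exp (-((1 - |e|) / 2 * |u - ξ|)) := by
  set b := cosh (ξ / 2) with hb
  have hb0 : 0 < b := cosh_pos _
  have hu0 : 0 < cosh (u / 2) := cosh_pos _
  have hg0 : 0 < g := hg ▸ cosh_pos _
  have ha0 : 0 < a := lt_of_lt_of_le (by positivity) hal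
  have hκ2 : 1 ≤ 2 / κ := by rw [le_div_iff₀ hκ]; linarith
  have e1 : cosh (u / 2) ≤ 2 * b * g := by
    have := cosh_le_two_mul (u / 2) (ξ / 2)
    rwa [← sub_div, ← hg] at this
  have e2 : b ≤ 2 * cosh (u / 2) * g := by
    have := cosh_le_two_mul (ξ / 2) (u / 2)
    rwa [← sub_div, ← cosh_neg ((ξ - u) / 2), ← neg_div, neg_sub, ← hg] at this
  -- Both a/b and b/a are at most (2/κ)g. Hence (a/b)^e costs at most g^|e| up to a factor, and
  -- division by g leaves g^(-(1-|e|)), which decays as |e| < 1.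
  have h1 : a / b ≤ 2 / κ * g := by
    rw [div_le_iff₀ hb0]
    calc a ≤ 2 * b * g := hau.trans e1
      _ = 2 * (g * b) := by ring
      _ ≤ 2 / κ * (g * b) := by
        gcongr
        rw [le_div_iff₀ hκ]; linarith
      _ = _ := by ring
  have h2 : (a / b)⁻¹ ≤ 2 / κ * g := by
    rw [inv_div, div_le_iff₀ ha0]
    calc b ≤ 2 * cosh (u / 2) * g := e2
      _ = 2 / κ * g * (κ * cosh (u / 2)) := by field_simp
      _ ≤ _ := by gcongr
  have h3 : (a / b) ^ e ≤ 2 / κ * g ^ |e| := by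
    refine (rpow_le_rpow_abs (by positivity) h1 h2).trans ?_
    rw [mul_rpow (by positivity) hg0.le]
    gcongr
    calc (2 / κ) ^ |e| ≤ (2 / κ) ^ (1 : ℝ) := rpow_le_rpow_of_exponent_le hκ2 he.le
      _ = _ := rpow_one _
  have h4 : a ^ e * b = (a / b) ^ e * b ^ (e + 1) := by
    rw [div_rpow ha0.le hb0.le, rpow_add hb0, rpow_one]
    have := (rpow_pos_of_pos hb0 e).ne'
    field_simp
  have h5 : g ^ |e| / g = g ^ (-(1 - |e|)) := by
    rw [neg_sub, rpow_sub hg0, rpow_one]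
  have h6 : g ^ (-(1 - |e|)) ≤ 2 * exp (-((1 - |e|) / 2 * |u - ξ|)) := by
    have := cosh_rpow_neg_le (l := 1 - |e|) (v := (u - ξ) / 2) (by linarith) (by linarith [abs_nonneg e])
    rw [← hg, abs_div, abs_two] at this
    convert this using 3
    ring
  have hbe : 0 < b ^ (e + 1) := rpow_pos_of_pos hb0 _
  calc a ^ e * (b / 2) / s ≤ a ^ e * (b / 2) / (δ * g) := by gcongr
    _ = (a / b) ^ e * b ^ (e + 1) / (2 * δ * g) := by rw [← h4]; ring
    _ ≤ (2 / κ * g ^ |e|) * b ^ (e + 1) / (2 * δ * g) := by gcongr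
    _ = 1 / (κ * δ) * b ^ (e + 1) * (g ^ |e| / g) := by field_simp
    _ ≤ 1 / (κ * δ) * b ^ (e + 1) * (2 * exp (-((1 - |e|) / 2 * |u - ξ|))) := by
      rw [h5]; gcongr
    _ = _ := by ring

/-- Functions in the space live on the open strip only, so the contour stays at η < d. Choosing η by
the number n of tanh factors keeps their product at least 1/2, and the constants stay free of n. -/
lemma exists_tan_pow_ge {d : ℝ} (hd : 0 < d) (n : ℕ) :
    ∃ η, d / 2 < η ∧ η < d ∧ 1 / 2 ≤ (sin (π / (4 * d) * η) / cos (π / (4 * d) * η)) ^ n := by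
  have hd4 : π / (4 * d) * d = π / 4 := by field_simp
  have hc : ContinuousAt (fun η => (sin (π / (4 * d) * η) / cos (π / (4 * d) * η)) ^ n) d := by
    refine ContinuousAt.pow (ContinuousAt.div (by fun_prop) (by fun_prop) ?_) n
    rw [hd4, cos_pi_div_four]; positivity
  have hv : (sin (π / (4 * d) * d) / cos (π / (4 * d) * d)) ^ n = 1 := by
    rw [hd4, sin_pi_div_four, cos_pi_div_four, div_self (by positivity), one_pow]
  have h1 : ∀ᶠ η in 𝓝 d, 1 / 2 < (sin (π / (4 * d) * η) / cos (π / (4 * d) * η)) ^ n :=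
    hc.eventually (lt_mem_nhds (by simp only [hv]; norm_num))
  have h2 : ∀ᶠ η in 𝓝[<] d, 1 / 2 < (sin (π / (4 * d) * η) / cos (π / (4 * d) * η)) ^ n :=
    h1.filter_mono nhdsWithin_le_nhds
  have h3 : ∀ᶠ η in 𝓝[<] d, η ∈ Ioo (d / 2) d := Ioo_mem_nhdsLT (by linarith)
  obtain ⟨η, h4, h5⟩ := (h2.and h3).exists
  exact ⟨η, h5.1, h5.2, h4.le⟩

section residues

variable {d : ℝ} {ι : Type*}

/-- The factors `sinh ((ζ - ξ) / 2)` and `tanh (π / (4 d) (ζ - p k))` of the denominator. -/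
noncomputable def poleFactor (d ξ : ℝ) (p : ι → ℝ) : Option ι → ℂ → ℂ
  | none, ζ => Complex.sinh ((ζ - ξ) / 2)
  | some k, ζ => Complex.tanh ((π / (4 * d) : ℝ) * (ζ - p k))

lemma im_scaled (ζ : ℂ) (q : ℝ) :
    ((π / (4 * d) : ℝ) * (ζ - q) : ℂ).im = π / (4 * d) * ζ.im := by
  rw [Complex.im_ofReal_mul]; simp

lemma re_scaled (ζ : ℂ) (q : ℝ) :
    ((π / (4 * d) : ℝ) * (ζ - q) : ℂ).re = π / (4 * d) * (ζ.re - q) := by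
  rw [Complex.re_ofReal_mul]; simp

lemma abs_im_scaled_lt (hd : 0 < d) {ζ : ℂ} (hζ : |ζ.im| < d) (q : ℝ) :
    |((π / (4 * d) : ℝ) * (ζ - q) : ℂ).im| < π / 4 := by
  have hpi := pi_pos
  rw [im_scaled, abs_mul, abs_of_pos (by positivity)]
  calc π / (4 * d) * |ζ.im| < π / (4 * d) * d := by gcongr
    _ = π / 4 := by field_simp

lemma cosh_scaled_ne_zero (hd : 0 < d) {ζ : ℂ} (hζ : |ζ.im| < d) (q : ℝ) :
    Complex.cosh ((π / (4 * d) : ℝ) * (ζ - q)) ≠ 0 :=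
  cosh_ne_zero_of_abs_im_lt ((abs_im_scaled_lt hd hζ q).trans (by linarith [pi_pos]))

lemma hasDerivAt_tanh_scaled (hd : 0 < d) {ζ : ℂ} (hζ : |ζ.im| < d) (q : ℝ) :
    HasDerivAt (fun ζ : ℂ => Complex.tanh ((π / (4 * d) : ℝ) * (ζ - q)))
      ((Complex.cosh ((π / (4 * d) : ℝ) * (ζ - q)) ^ 2)⁻¹ * ((π / (4 * d) : ℝ) * 1)) ζ :=
  HasDerivAt.comp (h₂ := Complex.tanh) (h := fun ζ : ℂ => (π / (4 * d) : ℝ) * (ζ - q)) ζ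
    (hasDerivAt_tanh (cosh_scaled_ne_zero hd hζ q))
    (((hasDerivAt_id ζ).sub_const (q : ℂ)).const_mul ((π / (4 * d) : ℝ) : ℂ))

lemma hasDerivAt_sinh_half (ξ : ℝ) (ζ : ℂ) :
    HasDerivAt (fun ζ : ℂ => Complex.sinh ((ζ - ξ) / 2))
      (Complex.cosh ((ζ - ξ) / 2) * (1 / 2)) ζ :=
  (Complex.hasDerivAt_sinh _).comp ζ (((hasDerivAt_id ζ).sub_const (ξ : ℂ)).div_const 2)

lemma differentiableOn_poleFactor (hd : 0 < d) (ξ : ℝ) (p : ι → ℝ) (i : Option ι) :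
    DifferentiableOn ℂ (poleFactor d ξ p i) {ζ | |ζ.im| < d} := fun ζ hζ => by
  cases i with
  | none => exact (hasDerivAt_sinh_half ξ ζ).differentiableAt.differentiableWithinAt
  | some k => exact (hasDerivAt_tanh_scaled hd hζ (p k)).differentiableAt.differentiableWithinAt

lemma poleFactor_eq_zero_iff (hd : 0 < d) (hdπ : d < π) (ξ : ℝ) (p : ι → ℝ) (i : Option ι) {ζ : ℂ}
    (hζ : |ζ.im| < d) : poleFactor d ξ p i ζ = 0 ↔ ζ = ((i.elim ξ p : ℝ) : ℂ) := by
  have hpi := pi_pos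
  cases i with
  | none =>
    have h1 : |((ζ - ξ) / 2).im| < π := by
      have : ((ζ - ξ) / 2).im = ζ.im / 2 := by simp
      rw [this, abs_div, abs_two]; linarith
    simp only [poleFactor, sinh_eq_zero_iff_of_abs_im_lt h1, Option.elim_none, div_eq_zero_iff,
      OfNat.ofNat_ne_zero, or_false, sub_eq_zero]
  | some k =>
    have h1 : |((π / (4 * d) : ℝ) * (ζ - p k) : ℂ).im| < π :=
      (abs_im_scaled_lt hd hζ (p k)).trans (by linarith)
    have h2 : ((π / (4 * d) : ℝ) : ℂ) ≠ 0 := by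
      rw [Complex.ofReal_ne_zero]; positivity
    simp only [poleFactor, Complex.tanh_eq_sinh_div_cosh, div_eq_zero_iff,
      cosh_scaled_ne_zero hd hζ (p k), or_false, sinh_eq_zero_iff_of_abs_im_lt h1, mul_eq_zero, h2,
      false_or, Option.elim_some, sub_eq_zero]

lemma deriv_poleFactor_none (d ξ : ℝ) (p : ι → ℝ) :
    deriv (poleFactor d ξ p none) (ξ : ℂ) = 1 / 2 := by
  have h := hasDerivAt_sinh_half ξ (ξ : ℂ)
  rw [sub_self, zero_div, Complex.cosh_zero, one_mul] at h
  exact h.deriv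

lemma deriv_poleFactor_some (hd : 0 < d) (ξ : ℝ) (p : ι → ℝ) (k : ι) :
    deriv (poleFactor d ξ p (some k)) (p k : ℂ) = (π / (4 * d) : ℝ) := by
  have h := hasDerivAt_tanh_scaled hd (ζ := (p k : ℂ)) (by simpa using hd) (p k)
  rw [sub_self, mul_zero, Complex.cosh_zero, one_pow, inv_one, one_mul, mul_one] at h
  exact h.deriv

/-- The numerator of the Cauchy integrand. -/
noncomputable def numer (ν ξ : ℝ) (f : ℂ → ℂ) (ζ : ℂ) : ℂ :=
  f (Complex.tanh (ζ / 2)) * ((1 - Complex.tanh (ζ / 2) ^ 2) ^ (ν : ℂ))⁻¹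
    * ((cosh (ξ / 2) : ℝ) / (2 * Complex.cosh (ζ / 2)))

lemma differentiableOn_numer (hdπ : d ≤ π) (ν ξ : ℝ) {f : ℂ → ℂ}
    (hf : AnalyticOnNhd ℂ f (region d)) :
    DifferentiableOn ℂ (numer ν ξ f) {ζ | |ζ.im| < d} := fun ζ hζ => by
  have hζπ : |ζ.im| < π := lt_of_lt_of_le hζ hdπ
  have ht := differentiableAt_tanh_half hζπ
  have h1 : DifferentiableAt ℂ (fun ζ : ℂ => f (Complex.tanh (ζ / 2))) ζ :=
    (hf _ (tanh_half_mem_region hζ)).differentiableAt.comp ζ ht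
  have h2 : DifferentiableAt ℂ (fun ζ : ℂ => (1 - Complex.tanh (ζ / 2) ^ 2) ^ (ν : ℂ)) ζ :=
    DifferentiableAt.comp (g := fun z : ℂ => (1 - z ^ 2) ^ (ν : ℂ)) ζ
      (analyticAt_one_sub_sq_cpow hζπ ν).differentiableAt ht
  have h3 : DifferentiableAt ℂ (fun ζ : ℂ => Complex.cosh (ζ / 2)) ζ := by fun_prop
  exact ((h1.mul (h2.inv (one_sub_tanh_sq_cpow_ne_zero hζπ _))).mul
    ((differentiableAt_const _).div (h3.const_mul 2)
      (mul_ne_zero two_ne_zero (cosh_half_ne_zero hζπ)))).differentiableWithinAt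

lemma norm_numer_le {μ : ℝ} (hdπ : d ≤ π) (ν ξ : ℝ) {f : ℂ → ℂ}
    (hf : hNorm d μ f ≤ 1) {ζ : ℂ} (hζ : |ζ.im| < d) :
    ‖numer ν ξ f ζ‖ ≤ ‖Complex.cosh (ζ / 2)‖ ^ (2 * ν - μ - 1) * (cosh (ξ / 2) / 2) := by
  have hζπ : |ζ.im| < π := lt_of_lt_of_le hζ hdπ
  have ha : 0 < ‖Complex.cosh (ζ / 2)‖ := norm_pos_iff.2 (cosh_half_ne_zero hζπ)
  have h1 := norm_le_weight hdπ hf hζ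
  rw [numer, norm_mul, norm_mul, norm_inv, norm_one_sub_tanh_sq_cpow hζπ, norm_div, norm_mul,
    Complex.norm_real, norm_of_nonneg (cosh_pos _).le, Complex.norm_two, rpow_neg ha.le, inv_inv]
  calc _ ≤ ‖Complex.cosh (ζ / 2)‖ ^ (-μ) * ‖Complex.cosh (ζ / 2)‖ ^ (2 * ν)
        * (cosh (ξ / 2) / (2 * ‖Complex.cosh (ζ / 2)‖)) := by
        have := cosh_pos (ξ / 2)
        gcongr
    _ = _ := by
      rw [← rpow_add ha, rpow_sub ha, rpow_one, show -μ + 2 * ν = 2 * ν - μ by ring]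
      field_simp

/-- On |Im ζ| = η the product of tanh factors is at least 1/2 and `kernel_le`, with exponent 2ν - μ
- 1, bounds the rest by an exponential in |Re ζ - ξ|. Neither bound involves the number or the
position of the nodes, so C can precede them. -/
lemma norm_sum_numer_residues_le {μ ν : ℝ} (hd : 0 < d) (hdπ : d < π) (hν1 : μ / 2 < ν)
    (hν2 : ν < μ / 2 + 1) : ∃ C : ℝ, 0 < C ∧ ∀ (s : Finset ι) (p : ι → ℝ), Set.InjOn p s →
      ∀ f : ℂ → ℂ, AnalyticOnNhd ℂ f (region d) → hNorm d μ f ≤ 1 → ∀ ξ : ℝ,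
      (∀ k ∈ s, ξ ≠ p k) → ∀ [DecidableEq ι],
      ‖∑ i ∈ Finset.insertNone s, numer ν ξ f ((i.elim ξ p : ℝ) : ℂ) /
        (deriv (poleFactor d ξ p i) ((i.elim ξ p : ℝ) : ℂ)
          * ∏ j ∈ (Finset.insertNone s).erase i, poleFactor d ξ p j ((i.elim ξ p : ℝ) : ℂ))‖
        ≤ C * cosh (ξ / 2) ^ (2 * ν - μ) := by
  have hpi := pi_pos
  set e := 2 * ν - μ - 1 with he
  have he1 : |e| < 1 := abs_lt.2 ⟨by linarith, by linarith⟩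
  set l := (1 - |e|) / 2 with hl
  have hl0 : 0 < l := by linarith
  set κ := cos (d / 2) with hκ
  have hκ0 : 0 < κ := cos_pos_of_mem_Ioo ⟨by linarith, by linarith⟩
  have hκ1 : κ ≤ 1 := cos_le_one _
  -- The contour satisfies η > d/2, so |sin(Im ζ / 2)| ≥ sin(d/4) on it.
  set δ := sin (d / 4) with hδ
  have hδ0 : 0 < δ := sin_pos_of_pos_of_lt_pi (by linarith) (by linarith)
  set c := π / (4 * d) with hc
  have hc0 : 0 < c := by positivity
  refine ⟨4 / (κ * δ) * (2 / l) / π, by positivity, fun s p hp f hf hfn ξ hξ _ => ?_⟩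
  obtain ⟨η, hη1, hη2, hη3⟩ := exists_tan_pow_ge hd s.card
  have hη0 : 0 < η := by linarith
  set b := cosh (ξ / 2) with hb
  have hb0 : 0 < b := cosh_pos _
  have hbe : 0 < b ^ (e + 1) := rpow_pos_of_pos hb0 _
  have hre : ∀ ζ : ℂ, (ζ / 2).re = ζ.re / 2 ∧ (ζ / 2).im = ζ.im / 2 ∧
      ((ζ - ξ) / 2).re = (ζ.re - ξ) / 2 ∧ ((ζ - ξ) / 2).im = ζ.im / 2 := fun ζ => by simp
  have hlow : ∀ ζ : ℂ, |ζ.im| < d → κ * cosh (ζ.re / 2) ≤ ‖Complex.cosh (ζ / 2)‖ := fun ζ hζ => by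
    rw [← (hre ζ).1]
    refine mul_cosh_le_norm_cosh hκ0.le ?_
    rw [(hre ζ).2.1, ← cos_abs, abs_div, abs_two]
    exact cos_le_cos_of_nonneg_of_le_pi (by positivity) (by linarith) (by linarith)
  have hup : ∀ ζ : ℂ, ‖Complex.cosh (ζ / 2)‖ ≤ cosh (ζ.re / 2) := fun ζ => by
    rw [← (hre ζ).1]; exact norm_cosh_le _
  -- This serves twice: on the horizontal lines with δ and the tangent bound, and on the far
  -- vertical sides with tanh(1/2) and tanh c, where distance from ξ and from the nodes keeps the
  -- factors away from 0.
  have hF : ∀ (ζ : ℂ) (δ' τ : ℝ), |ζ.im| < d → 0 < δ' → 0 < τ →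
      δ' * cosh ((ζ.re - ξ) / 2) ≤ ‖Complex.sinh ((ζ - ξ) / 2)‖ →
      (∀ k ∈ s, τ ≤ ‖Complex.tanh (c * (ζ - p k))‖) →
      ‖numer ν ξ f ζ / ∏ i ∈ Finset.insertNone s, poleFactor d ξ p i ζ‖
        ≤ 2 / (κ * δ') * b ^ (e + 1) * exp (-(l * |ζ.re - ξ|)) / τ ^ s.card := by
    intro ζ δ' τ hζ hδ' hτ hs ht
    have hprod : τ ^ s.card ≤ ‖∏ k ∈ s, poleFactor d ξ p (some k) ζ‖ := by
      rw [norm_prod, ← Finset.prod_const]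
      exact Finset.prod_le_prod (fun _ _ => hτ.le) ht
    have hs0 : 0 < ‖Complex.sinh ((ζ - ξ) / 2)‖ :=
      lt_of_lt_of_le (mul_pos hδ' (cosh_pos _)) hs
    rw [Finset.prod_insertNone, norm_div, norm_mul, ← div_div]
    have h1 := kernel_le (ξ := ξ) hκ0 hκ1 hδ' he1 (hlow ζ hζ) (hup ζ) rfl hs
    have h2 : ‖numer ν ξ f ζ‖ / ‖poleFactor d ξ p none ζ‖
        ≤ 2 / (κ * δ') * b ^ (e + 1) * exp (-(l * |ζ.re - ξ|)) := by
      refine le_trans ?_ h1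
      simp only [poleFactor]
      gcongr
      exact norm_numer_le hdπ.le ν ξ hfn hζ
    gcongr
  have hmain := norm_sum_residues_div_prod_le (ι := Option ι) hη0 hη2 (Finset.insertNone s)
    (q := fun i => i.elim ξ p) (A := numer ν ξ f) (h := poleFactor d ξ p)
    (G := fun u => 4 / (κ * δ) * b ^ (e + 1) * exp (-(l * |u - ξ|))) ?_ ⟨none, by simp⟩
    (differentiableOn_numer hdπ.le ν ξ hf)
    (fun i _ => differentiableOn_poleFactor hd ξ p i)
    (fun i _ ζ hζ => poleFactor_eq_zero_iff hd hdπ ξ p i hζ) ?_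
    ((integrable_exp_neg_mul_abs_sub hl0 ξ).1.const_mul _) ?_ ?_
  · rw [integral_const_mul, (integrable_exp_neg_mul_abs_sub hl0 ξ).2,
      show e + 1 = 2 * ν - μ by rw [he]; ring] at hmain
    rw [div_mul_eq_mul_div, le_div_iff₀ hpi, mul_comm _ π]
    refine hmain.trans_eq ?_
    ring
  · rintro (_ | i) hi (_ | j) hj hij
    · rfl
    · exact absurd hij (hξ j (by simpa using hj))
    · exact absurd hij.symm (hξ i (by simpa using hi))
    · exact congrArg some (hp (by simpa using hi) (by simpa using hj) hij)
  · rintro (_ | k) _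
    · simp only [Option.elim_none]
      rw [deriv_poleFactor_none]; norm_num
    · simp only [Option.elim_some]
      rw [deriv_poleFactor_some hd, Complex.ofReal_ne_zero]; positivity
  · intro ζ hζ
    have hζd : |ζ.im| < d := by linarith
    have hs : δ * cosh ((ζ.re - ξ) / 2) ≤ ‖Complex.sinh ((ζ - ξ) / 2)‖ := by
      rw [← (hre ζ).2.2.1]
      refine mul_cosh_le_norm_sinh hδ0.le ?_
      have h1 : |sin (ζ.im / 2)| = sin (|ζ.im| / 2) := by
        rw [← abs_two, ← abs_div, abs_two]
        have h2 : |ζ.im / 2| ≤ π := by rw [abs_div, abs_two]; linarith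
        exact abs_sin_eq_sin_abs_of_abs_le_pi h2
      rw [(hre ζ).2.2.2, h1, hζ]
      exact sin_le_sin_of_le_of_le_pi_div_two (by linarith) (by linarith) (by linarith)
    have hcη : c * η < π / 4 := by
      calc c * η < c * d := by gcongr
        _ = π / 4 := by rw [hc]; field_simp
    have hcη0 : 0 < c * η := by positivity
    have hτ0 : 0 < sin (c * η) / cos (c * η) :=
      div_pos (sin_pos_of_pos_of_lt_pi hcη0 (by linarith))
        (cos_pos_of_mem_Ioo ⟨by linarith, by linarith⟩)
    refine (hF ζ δ _ hζd hδ0 hτ0 hs fun k _ => ?_).trans ?_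
    · have h1 : |((c : ℂ) * (ζ - p k)).im| = c * η := by
        rw [hc, im_scaled, abs_mul, abs_of_pos hc0, hζ]
      have h2 := sin_div_cos_le_norm_tanh (w := (c : ℂ) * (ζ - p k)) (by rw [h1]; exact hcη.le)
      rwa [h1] at h2
    · rw [div_le_iff₀ (by positivity)]
      calc 2 / (κ * δ) * b ^ (e + 1) * exp (-(l * |ζ.re - ξ|))
          = 4 / (κ * δ) * b ^ (e + 1) * exp (-(l * |ζ.re - ξ|)) * (1 / 2) := by ring
        _ ≤ _ := by gcongr
  · intro ε hε
    set K := 2 / (κ * tanh (1 / 2)) * b ^ (e + 1) with hK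
    set T := tanh c ^ s.card with hT
    have hT0 : 0 < T := pow_pos (tanh_pos' hc0) _
    have hlim : Tendsto (fun R : ℝ => K * exp (-(l * (R - |ξ|))) / T) atTop (𝓝 0) := by
      have h1 : Tendsto (fun R : ℝ => l * (R - |ξ|)) atTop atTop :=
        (tendsto_atTop_add_const_right atTop (-|ξ|) tendsto_id).const_mul_atTop hl0
      simpa using ((tendsto_exp_neg_atTop_nhds_zero.comp h1).const_mul K).div_const T
    have hev : ∀ᶠ R in atTop, ∀ k ∈ s, |p k| + 1 < R :=
      (Finset.eventually_all s).2 fun k _ => eventually_gt_atTop (|p k| + 1)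
    filter_upwards [hlim.eventually (gt_mem_nhds hε), hev, eventually_gt_atTop (|ξ| + 1)]
      with R hR1 hR2 hR3 ζ hζ1 hζ2
    have hdist : ∀ x : ℝ, R - |x| ≤ |ζ.re - x| := fun x => by
      rw [← hζ2]; exact abs_sub_abs_le_abs_sub _ _
    have hs : tanh (1 / 2) * cosh ((ζ.re - ξ) / 2) ≤ ‖Complex.sinh ((ζ - ξ) / 2)‖ := by
      refine le_trans ?_ (abs_sinh_le_norm_sinh _)
      rw [(hre ζ).2.2.1]
      have h1 : tanh (1 / 2) ≤ |tanh ((ζ.re - ξ) / 2)| := tanh_le_abs_tanh (by norm_num) (by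
        rw [abs_div, abs_two]; linarith [hdist ξ])
      rw [tanh_eq_sinh_div_cosh ((ζ.re - ξ) / 2), abs_div, abs_of_pos (cosh_pos _)] at h1
      exact (le_div_iff₀ (cosh_pos _)).1 h1
    have hζd : |ζ.im| < d := hζ1.trans_lt hη2
    refine (hF ζ _ (tanh c) hζd (tanh_pos' (by norm_num)) (tanh_pos' hc0) hs fun k hk => ?_).trans
      (le_trans ?_ hR1.le)
    · refine le_trans (tanh_le_abs_tanh hc0 ?_) (abs_tanh_re_le_norm_tanh
        ((abs_im_scaled_lt hd hζd (p k)).trans (by linarith)))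
      rw [hc, re_scaled, abs_mul, abs_of_pos hc0]
      exact le_mul_of_one_le_right hc0.le (by linarith [hdist (p k), hR2 k hk])
    · have : 0 < tanh (1 / 2 : ℝ) := tanh_pos' (by norm_num)
      gcongr
      exact hdist ξ

end residues

end Ganelius

namespace Ganelius

open Real Set Filter Topology

/-! ### The sampling points and the error of the formula -/

section nodes

variable {d μ : ℝ} {N : ℕ}

/-- The preimage of `β_k` in the strip: `β_k = tanh (node k / 2)`. -/
noncomputable def node (d μ : ℝ) (N : ℕ) (k : ℤ) : ℝ := 4 * d / π * artanh (bPoint d μ N k)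

lemma betaPoint_eq (d μ : ℝ) (N : ℕ) (k : ℤ) : betaPoint d μ N k = tanh (node d μ N k / 2) := by
  rw [betaPoint, node]
  congr 1; ring

lemma mem_idx {k : ℤ} : k ∈ idx N ↔ k ≠ 0 ∧ -(N : ℤ) ≤ k ∧ k ≤ N := by
  simp [idx]

lemma sqrt_div_mem_Ico {a : ℝ} (ha : a ∈ Ioc (0 : ℝ) 1) :
    √((1 - a) / (1 + a)) ∈ Ico (0 : ℝ) 1 := by
  refine ⟨sqrt_nonneg _, ?_⟩
  rw [sqrt_lt' one_pos, one_pow, div_lt_one (by linarith [ha.1])]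
  linarith [ha.1]

lemma bPoint_mem (hd : 0 < d) (hμ : 0 < μ) {k : ℤ} (hk : k ∈ idx N) :
    bPoint d μ N k ∈ Ioo (-1 : ℝ) 1 := by
  have hr : 0 < d * μ / π := by have := pi_pos; positivity
  rw [mem_idx] at hk
  unfold bPoint
  split_ifs with h
  · have := sqrt_div_mem_Ico (ganelius_mem_Ioc hr (N := N) (k := k) hk.2.2)
    exact ⟨by linarith [this.1], this.2⟩
  · have := sqrt_div_mem_Ico (ganelius_mem_Ioc hr (N := N) (k := -k) (by omega))
    exact ⟨by linarith [this.2], by linarith [this.1]⟩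

lemma scaled_node (hd : 0 < d) (k : ℤ) :
    π / (4 * d) * node d μ N k = artanh (bPoint d μ N k) := by
  have := pi_pos
  rw [node]; field_simp

lemma node_injOn (h : FormulaDefined d μ N) : Set.InjOn (node d μ N) (idx N) := fun k hk l hl hkl =>
  h.2 hk hl (by rw [betaPoint_eq, betaPoint_eq, hkl])

lemma betaPoint_mem_region (hd : 0 < d) (k : ℤ) : (betaPoint d μ N k : ℂ) ∈ region d := by
  rw [betaPoint_eq, ← ofReal_tanh_half]
  exact tanh_half_mem_region (by simpa using hd)

lemma tanh_sub' (x y : ℝ) : tanh (x - y) = (tanh x - tanh y) / (1 - tanh y * tanh x) := by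
  have hx := (cosh_pos x).ne'
  have hy := (cosh_pos y).ne'
  have hxy := (cosh_pos (x - y)).ne'
  have h1 : 1 - tanh y * tanh x = cosh (x - y) / (cosh x * cosh y) := by
    rw [tanh_eq_sinh_div_cosh, tanh_eq_sinh_div_cosh, cosh_sub]; field_simp
  have h2 : tanh x - tanh y = sinh (x - y) / (cosh x * cosh y) := by
    rw [tanh_eq_sinh_div_cosh, tanh_eq_sinh_div_cosh, sinh_sub]; field_simp
  rw [h1, h2, tanh_eq_sinh_div_cosh]
  field_simp

/-- By the subtraction formula for tanh each factor of σ_k inverts a Blaschke factor at node k. So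
σ_k is the reciprocal that appears in the residue there. -/
lemma sigma_eq (hd : 0 < d) (hμ : 0 < μ) {k : ℤ} (hk : k ∈ idx N) :
    sigma d μ N k
      = (∏ l ∈ (idx N).erase k, tanh (π / (4 * d) * (node d μ N k - node d μ N l)))⁻¹ := by
  rw [sigma, ← Finset.prod_inv_distrib]
  refine Finset.prod_congr rfl fun l hl => ?_
  rw [mul_sub, scaled_node hd, scaled_node hd, tanh_sub', tanh_artanh (bPoint_mem hd hμ hk),
    tanh_artanh (bPoint_mem hd hμ (Finset.mem_of_mem_erase hl)), inv_div]

lemma blaschke_tanh {ζ : ℂ} (hζ : |ζ.im| < π) :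
    blaschke d μ N (Complex.tanh (ζ / 2))
      = ∏ k ∈ idx N, Complex.tanh ((π / (4 * d) : ℝ) * (ζ - node d μ N k)) := by
  refine Finset.prod_congr rfl fun k _ => ?_
  rw [betaPoint_eq, ← ofReal_tanh_half, cartanh_tanh hζ, cartanh_tanh (by simpa using pi_pos)]
  congr 1
  push_cast
  ring

lemma analyticAt_blaschke (hd : 0 < d) (hdπ : d ≤ π) {ζ : ℂ} (hζ : |ζ.im| < d) :
    AnalyticAt ℂ (blaschke d μ N) (Complex.tanh (ζ / 2)) := by
  have hζπ : |ζ.im| < π := hζ.trans_le hdπ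
  unfold blaschke
  refine Finset.analyticAt_fun_prod _ fun k _ => ?_
  refine AnalyticAt.fun_comp (g := Complex.tanh) (analyticAt_tanh ?_)
    (analyticAt_const.mul ((analyticAt_cartanh hζπ).sub analyticAt_const))
  have h := cosh_scaled_ne_zero hd hζ (node d μ N k)
  rw [betaPoint_eq, ← ofReal_tanh_half, cartanh_tanh hζπ, cartanh_tanh (by simpa using pi_pos)]
  convert h using 2
  push_cast
  ring

lemma analyticAt_dslope {f : ℂ → ℂ} {b z : ℂ} (hb : AnalyticAt ℂ f b) (hz : AnalyticAt ℂ f z) :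
    AnalyticAt ℂ (dslope f b) z := by
  by_cases h : z = b
  · obtain ⟨p, hp⟩ := hb
    rw [h]
    exact ⟨_, hp.has_fpower_series_dslope_fslope⟩
  · refine AnalyticAt.congr (f := slope f b) ?_ (dslope_eventuallyEq_slope_of_ne f h).symm
    have h1 : AnalyticAt ℂ (fun w : ℂ => (w - b)⁻¹) z :=
      (analyticAt_id.sub analyticAt_const).inv (sub_ne_zero.2 h)
    have h2 : slope f b = fun w => (w - b)⁻¹ * (f w - f b) := by
      funext w; simp [slope_def_module]
    rw [h2]
    exact h1.mul (hz.sub analyticAt_const)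

/-- The basis functions of the formula. -/
noncomputable def basisFun (d μ ν : ℝ) (N : ℕ) (k : ℤ) (z : ℂ) : ℂ :=
  ((2 * d * sigma d μ N k / π : ℝ) : ℂ)
    * ((1 - z ^ 2) ^ (ν : ℂ) / (((1 - betaPoint d μ N k ^ 2) ^ (ν - 1) : ℝ) : ℂ))
    * dslope (blaschke d μ N) (betaPoint d μ N k : ℂ) z

lemma formula_eq_sum (d μ ν : ℝ) (N : ℕ) (f : ℂ → ℂ) (z : ℂ) :
    formula d μ ν N f z = ∑ k ∈ idx N, f (betaPoint d μ N k) * basisFun d μ ν N k z :=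
  Finset.sum_congr rfl fun k _ => by rw [basisFun]; ring

lemma analyticOnNhd_basisFun (hd : 0 < d) (hdπ : d ≤ π) (ν : ℝ) (k : ℤ) :
    AnalyticOnNhd ℂ (basisFun d μ ν N k) (region d) := by
  rintro _ ⟨ζ, hζ, rfl⟩
  have hβ : AnalyticAt ℂ (blaschke d μ N) (betaPoint d μ N k : ℂ) := by
    rw [betaPoint_eq, ← ofReal_tanh_half]
    exact analyticAt_blaschke hd hdπ (by simpa using hd)
  exact (analyticAt_const.mul ((analyticAt_one_sub_sq_cpow (lt_of_lt_of_le hζ hdπ) ν).div_const)).mul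
    (analyticAt_dslope hβ (analyticAt_blaschke hd hdπ hζ))

lemma erase_none_insertNone {ι : Type*} [DecidableEq ι] (s : Finset ι) :
    (Finset.insertNone s).erase none = s.map Function.Embedding.some := by
  ext (_ | i) <;> simp

lemma erase_some_insertNone {ι : Type*} [DecidableEq ι] (s : Finset ι) (k : ι) :
    (Finset.insertNone s).erase (some k) = Finset.insertNone (s.erase k) := by
  ext (_ | i) <;> simp

lemma blaschke_ne_zero (hd : 0 < d) (hdπ : d < π) {ξ : ℝ} (hξ : ∀ k ∈ idx N, ξ ≠ node d μ N k) :
    blaschke d μ N (Complex.tanh ((ξ : ℂ) / 2)) ≠ 0 := by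
  rw [blaschke_tanh (by simpa using pi_pos)]
  refine Finset.prod_ne_zero_iff.2 fun k hk h => hξ k hk ?_
  have := (poleFactor_eq_zero_iff hd hdπ ξ (node d μ N) (some k) (ζ := (ξ : ℂ))
    (by simpa using hd)).1 h
  exact Complex.ofReal_injective this

lemma blaschke_node (k : ℤ) (hk : k ∈ idx N) : blaschke d μ N (betaPoint d μ N k : ℂ) = 0 := by
  rw [betaPoint_eq, ← ofReal_tanh_half, blaschke_tanh (by simpa using pi_pos)]
  exact Finset.prod_eq_zero hk (by rw [sub_self, mul_zero, Complex.tanh_zero])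

/-- For z = tanh(ζ/2) the same identity turns the Cauchy kernel dz/(z - x) into cosh(ξ/2) dζ / (2
cosh(ζ/2) sinh((ζ-ξ)/2)), the form used in `numer` and `poleFactor`. -/
lemma sinh_half_sub (p ξ : ℝ) :
    sinh ((p - ξ) / 2) = (tanh (p / 2) - tanh (ξ / 2)) * (cosh (p / 2) * cosh (ξ / 2)) := by
  have h1 := (cosh_pos (p / 2)).ne'
  have h2 := (cosh_pos (ξ / 2)).ne'
  rw [sub_div, sinh_sub, tanh_eq_sinh_div_cosh, tanh_eq_sinh_div_cosh]
  field_simp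

lemma numer_ofReal (ν ξ p : ℝ) (f : ℂ → ℂ) :
    numer ν ξ f (p : ℂ) = f (tanh (p / 2) : ℝ)
      * (((1 - tanh (p / 2) ^ 2) ^ ν : ℝ) : ℂ)⁻¹ * ((cosh (ξ / 2) / (2 * cosh (p / 2)) : ℝ) : ℂ) := by
  have h : (0 : ℝ) ≤ 1 - tanh (p / 2) ^ 2 := by linarith [tanh_sq_lt_one (p / 2)]
  rw [numer, ofReal_tanh_half, Complex.ofReal_cpow h]
  push_cast
  rfl

/-- The error of the formula as a sum of residues. -/
lemma sub_formula_eq (hd : 0 < d) (hdπ : d < π) (hμ : 0 < μ) (ν : ℝ)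
    (f : ℂ → ℂ) {ξ : ℝ} (hξ : ∀ k ∈ idx N, ξ ≠ node d μ N k) :
    f (tanh (ξ / 2) : ℝ) - formula d μ ν N f (tanh (ξ / 2) : ℝ)
      = (1 - Complex.tanh ((ξ : ℂ) / 2) ^ 2) ^ (ν : ℂ) * blaschke d μ N (Complex.tanh ((ξ : ℂ) / 2))
        * ∑ i ∈ Finset.insertNone (idx N), numer ν ξ f ((i.elim ξ (node d μ N) : ℝ) : ℂ) /
        (deriv (poleFactor d ξ (node d μ N) i) ((i.elim ξ (node d μ N) : ℝ) : ℂ)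
          * ∏ j ∈ (Finset.insertNone (idx N)).erase i,
            poleFactor d ξ (node d μ N) j ((i.elim ξ (node d μ N) : ℝ) : ℂ)) := by
  have hpi := pi_pos
  have hB := blaschke_ne_zero (μ := μ) (N := N) hd hdπ hξ
  have hW := one_sub_tanh_sq_cpow_ne_zero (ζ := (ξ : ℂ)) (by simpa using hpi) (ν : ℂ)
  set x := tanh (ξ / 2) with hx
  have hx1 : (0 : ℝ) < 1 - x ^ 2 := by linarith [tanh_sq_lt_one (ξ / 2)]
  rw [Finset.sum_insertNone, mul_add, sub_eq_add_neg]
  rw [ofReal_tanh_half, ← hx] at hB hW ⊢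
  congr 1
  -- The residue at ξ reproduces f(x).
  · simp only [Option.elim_none]
    rw [deriv_poleFactor_none, erase_none_insertNone, Finset.prod_map]
    have h1 : ∏ k ∈ idx N, poleFactor d ξ (node d μ N) (Function.Embedding.some k) (ξ : ℂ)
        = blaschke d μ N (x : ℂ) := by
      rw [hx, ← ofReal_tanh_half, blaschke_tanh (by simpa using hpi)]
      rfl
    have h2 : ((1 : ℂ) - (x : ℂ) ^ 2) ^ (ν : ℂ) = (((1 - x ^ 2) ^ ν : ℝ) : ℂ) := by
      rw [Complex.ofReal_cpow hx1.le]; push_cast; rfl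
    rw [h1, numer_ofReal, ← hx]
    rw [h2] at hW ⊢
    have h3 : cosh (ξ / 2) / (2 * cosh (ξ / 2)) = 1 / 2 := by
      have := (cosh_pos (ξ / 2)).ne'; field_simp
    rw [h3]
    push_cast
    field_simp
  -- The residue at node k is minus the k-th term of the formula.
  · rw [formula, ← Finset.sum_neg_distrib, Finset.mul_sum]
    refine Finset.sum_congr rfl fun k hk => ?_
    set p := node d μ N k with hp
    have hβ : betaPoint d μ N k = tanh (p / 2) := betaPoint_eq d μ N k
    simp only [Option.elim_some]
    rw [deriv_poleFactor_some hd, erase_some_insertNone, Finset.prod_insertNone, numer_ofReal,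
      ← hp, ← hβ]
    set β := betaPoint d μ N k with hβd
    have hβ1 : (0 : ℝ) < 1 - β ^ 2 := by rw [hβ]; linarith [tanh_sq_lt_one (p / 2)]
    have hne : x ≠ β := fun h => hξ k hk (by
      rw [hx, hβ] at h
      have := tanh_injective h
      linarith)
    have hne' : (x : ℂ) ≠ β := fun h => hne (Complex.ofReal_injective h)
    have h1 : ∏ l ∈ (idx N).erase k, poleFactor d ξ (node d μ N) (some l) (p : ℂ)
        = (((sigma d μ N k)⁻¹ : ℝ) : ℂ) := by
      rw [sigma_eq hd hμ hk, inv_inv]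
      push_cast
      refine Finset.prod_congr rfl fun l _ => ?_
      simp only [poleFactor, ← hp]
      push_cast
      rfl
    have h2 : poleFactor d ξ (node d μ N) none (p : ℂ)
        = (((β - x) * (cosh (p / 2) * cosh (ξ / 2)) : ℝ) : ℂ) := by
      rw [hβ, hx, ← sinh_half_sub]
      simp only [poleFactor]
      push_cast
      rfl
    have h3 : dslope (blaschke d μ N) (β : ℂ) (x : ℂ) = blaschke d μ N (x : ℂ) / ((x : ℂ) - β) := by
      rw [dslope_of_ne _ hne', slope_def_field, blaschke_node k hk, sub_zero]
    have h4 : (1 - β ^ 2) ^ ν = (1 - β ^ 2) ^ (ν - 1) * (1 - β ^ 2) := by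
      rw [rpow_sub_one hβ1.ne']; field_simp
    have h5 : 1 - β ^ 2 = (cosh (p / 2) ^ 2)⁻¹ := by
      have h6 := cosh_sq (p / 2)
      have := (cosh_pos (p / 2)).ne'
      rw [hβ, tanh_eq_sinh_div_cosh]
      field_simp
      linarith
    rw [h1, h2, h3, h4]
    have e1 : cosh (p / 2) ≠ 0 := (cosh_pos _).ne'
    have e2 : cosh (ξ / 2) ≠ 0 := (cosh_pos _).ne'
    have e3 : (1 - β ^ 2) ^ (ν - 1) ≠ 0 := (rpow_pos_of_pos hβ1 _).ne'
    have e4 : β - x ≠ 0 := sub_ne_zero.2 hne.symm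
    have hreal : ((1 - β ^ 2) ^ (ν - 1) * (1 - β ^ 2))⁻¹ * (cosh (ξ / 2) / (2 * cosh (p / 2)))
        / (π / (4 * d) * ((β - x) * (cosh (p / 2) * cosh (ξ / 2)) * (sigma d μ N k)⁻¹))
        = (2 * d * sigma d μ N k / π) / (1 - β ^ 2) ^ (ν - 1) / (β - x) := by
      generalize (1 - β ^ 2) ^ (ν - 1) = Y at e3 ⊢
      rw [h5]
      by_cases hσ : sigma d μ N k = 0
      · simp [hσ]
      · field_simp
        ring
    have hc : ∀ A B C D E : ℝ, f (β : ℂ) * (A : ℂ)⁻¹ * (B : ℂ) / ((C : ℂ) * ((D : ℂ) * (E : ℂ)))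
        = f (β : ℂ) * ((A⁻¹ * B / (C * (D * E)) : ℝ) : ℂ) := fun A B C D E => by
      push_cast; ring
    have e5 : (β : ℂ) - x = -((x : ℂ) - β) := by ring
    have e6 : (x : ℂ) - β ≠ 0 := sub_ne_zero.2 hne'
    rw [hc, hreal, Complex.ofReal_div (_ / _), Complex.ofReal_div (2 * d * sigma d μ N k / π),
      Complex.ofReal_sub, e5]
    generalize (((1 - β ^ 2) ^ (ν - 1) : ℝ) : ℂ) = Y
    field_simp

end nodes

end Ganelius

namespace Ganelius

open Real Set Filter Topology

/-! ### The error bound -/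

section upper

variable {d μ ν : ℝ} {N : ℕ}

lemma idx_succ (N : ℕ) :
    idx (N + 1) = insert ((N : ℤ) + 1) (insert (-((N : ℤ) + 1)) (idx N)) := by
  ext k
  simp only [mem_idx, Finset.mem_insert]
  push_cast
  omega

lemma prod_idx {M : Type*} [CommMonoid M] (g : ℤ → M) (N : ℕ) :
    ∏ k ∈ idx N, g k = ∏ j ∈ Finset.range N, g ((j : ℤ) + 1) * g (-((j : ℤ) + 1)) := by
  induction N with
  | zero => simp [idx]
  | succ N ih =>
    rw [idx_succ, Finset.prod_insert, Finset.prod_insert, ih, Finset.prod_range_succ, ← mul_assoc,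
      mul_comm]
    · rw [mem_idx]; omega
    · rw [Finset.mem_insert, mem_idx]; omega

/-- With w = tanh X the pair ±b gives (w² - b²)/(1 - b²w²). The involution s ↦ (1-s)/(1+s) sends w²
to 1/cosh(2X) and b² to a, and turns this quotient into a difference over a sum. This is the reason
for the definition of b_k from a_k. -/
lemma abs_tanh_sub_mul_abs_tanh_sub {a b X : ℝ} (ha : a ∈ Ioc (0 : ℝ) 1)
    (hb : b = √((1 - a) / (1 + a))) :
    |tanh (X - artanh b)| * |tanh (X - artanh (-b))|
      = |1 / cosh (2 * X) - a| / (1 / cosh (2 * X) + a) := by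
  have ha1 : 0 < 1 + a := by linarith [ha.1]
  have hbm := sqrt_div_mem_Ico ha
  rw [← hb] at hbm
  have hb2 : b ^ 2 = (1 - a) / (1 + a) := by
    rw [hb]; exact sq_sqrt (div_nonneg (by linarith [ha.2]) ha1.le)
  have hw := tanh_sq_lt_one X
  have ht : 1 / cosh (2 * X) = (1 - tanh X ^ 2) / (1 + tanh X ^ 2) := by
    have h1 := cosh_sq X
    have h2 := (cosh_pos X).ne'
    have h3 : cosh X ^ 2 + sinh X ^ 2 ≠ 0 := by positivity
    rw [cosh_two_mul, tanh_eq_sinh_div_cosh]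
    field_simp
    linarith
  rw [tanh_sub', tanh_sub', tanh_artanh ⟨by linarith [hbm.1], hbm.2⟩,
    tanh_artanh ⟨by linarith [hbm.2], by linarith [hbm.1]⟩, ht, ← abs_mul]
  have hw1 := abs_lt.1 (abs_tanh_lt_one X)
  set w := tanh X
  have hpos : 0 < (1 - w ^ 2) / (1 + w ^ 2) + a := by
    have : 0 < (1 - w ^ 2) / (1 + w ^ 2) := div_pos (by linarith) (by positivity)
    linarith [ha.1]
  have hbw : |b * w| < 1 := by
    rw [abs_mul, abs_of_nonneg hbm.1]
    calc b * |w| ≤ 1 * |w| := by gcongr; exact hbm.2.le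
      _ < 1 := by rw [one_mul]; exact abs_tanh_lt_one X
  obtain ⟨h3, h4⟩ := abs_lt.1 hbw
  have h5 : 1 - b * w ≠ 0 := by linarith
  have h6 : 1 - -b * w ≠ 0 := by linarith
  have h7 : 1 - b ^ 2 * w ^ 2 = (1 - b * w) * (1 - -b * w) := by ring
  have h8 : 1 - b ^ 2 * w ^ 2 ≠ 0 := by rw [h7]; exact mul_ne_zero h5 h6
  have e1 : (w - b) / (1 - b * w) * ((w - -b) / (1 - -b * w))
      = (w ^ 2 - b ^ 2) / (1 - b ^ 2 * w ^ 2) := by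
    rw [h7, div_mul_div_comm]; congr 1; ring
  have e2 : (w ^ 2 - b ^ 2) / (1 - b ^ 2 * w ^ 2)
      = -(((1 - w ^ 2) / (1 + w ^ 2) - a) / ((1 - w ^ 2) / (1 + w ^ 2) + a)) := by
    have h9 : (1 : ℝ) + w ^ 2 ≠ 0 := by positivity
    have h10 : 1 - w ^ 2 + a * (1 + w ^ 2) ≠ 0 := by
      have : 0 ≤ a * (1 + w ^ 2) := mul_nonneg ha.1.le (by positivity)
      linarith
    have h11 : 1 + a - (1 - a) * w ^ 2 ≠ 0 := fun h => h10 (by linarith)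
    have e3 : w ^ 2 - b ^ 2 = ((1 + a) * w ^ 2 - (1 - a)) / (1 + a) := by
      rw [hb2]; field_simp
    have e4 : 1 - b ^ 2 * w ^ 2 = (1 + a - (1 - a) * w ^ 2) / (1 + a) := by
      rw [hb2]; field_simp
    have e5 : (1 - w ^ 2) / (1 + w ^ 2) - a = (1 - w ^ 2 - a * (1 + w ^ 2)) / (1 + w ^ 2) := by
      field_simp
    have e6 : (1 - w ^ 2) / (1 + w ^ 2) + a = (1 - w ^ 2 + a * (1 + w ^ 2)) / (1 + w ^ 2) := by
      field_simp
    rw [e3, e4, e5, e6, div_div_div_cancel_right₀ ha1.ne', div_div_div_cancel_right₀ h9,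
      ← neg_div]
    congr 1 <;> ring
  rw [e1, e2, abs_neg, abs_div, abs_of_pos hpos]

lemma norm_blaschke (hd : 0 < d) (hμ : 0 < μ) (N : ℕ) (ξ : ℝ) :
    ‖blaschke d μ N (Complex.tanh ((ξ : ℂ) / 2))‖
      = ganeliusProd (d * μ / π) N (1 / cosh (2 * (π / (4 * d) * ξ))) := by
  have hr : 0 < d * μ / π := by have := pi_pos; positivity
  rw [blaschke_tanh (by simpa using pi_pos), norm_prod, prod_idx, ganeliusProd]
  refine Finset.prod_congr rfl fun j hj => ?_
  have hj := Finset.mem_range.1 hj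
  have hk := ganelius_mem_Ioc hr (N := N) (k := (j : ℤ) + 1) (by omega)
  have h1 : ∀ k, ‖Complex.tanh ((π / (4 * d) : ℝ) * ((ξ : ℂ) - node d μ N k))‖
      = |tanh (π / (4 * d) * ξ - artanh (bPoint d μ N k))| := fun k => by
    rw [← scaled_node hd k, ← mul_sub, ← Complex.ofReal_sub, ← Complex.ofReal_mul,
      ← Complex.ofReal_tanh, Complex.norm_real, norm_eq_abs]
  have h2 : bPoint d μ N (-((j : ℤ) + 1)) = -bPoint d μ N ((j : ℤ) + 1) := by
    rw [bPoint, bPoint, if_neg (by omega), if_pos (by omega), neg_neg]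
  rw [h1, h1, h2]
  exact abs_tanh_sub_mul_abs_tanh_sub hk (by rw [bPoint, if_pos (by omega)])

/-- The base on the right is at least e^(-π|ξ|/(2d)). Its power r = dμ/π is at least e^(-μ|ξ|/2),
the decay rate of the weight; this fixes r. -/
lemma cosh_half_rpow_le (hd : 0 < d) (hμ : 0 < μ) (ξ : ℝ) :
    cosh (ξ / 2) ^ (-μ) ≤ 2 ^ μ * (1 / cosh (2 * (π / (4 * d) * ξ))) ^ (d * μ / π) := by
  have hpi := pi_pos
  have h1 : exp (|ξ| / 2) / 2 ≤ cosh (ξ / 2) := by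
    rw [← cosh_abs, cosh_eq, abs_div, abs_two]
    linarith [exp_pos (-(|ξ| / 2))]
  have h2 : cosh (2 * (π / (4 * d) * ξ)) ≤ exp (2 * (π / (4 * d) * |ξ|)) := by
    have e : |2 * (π / (4 * d) * ξ)| = 2 * (π / (4 * d) * |ξ|) := by
      rw [abs_mul, abs_two, abs_mul, abs_of_pos (by positivity : 0 < π / (4 * d))]
    have h0 : 0 ≤ 2 * (π / (4 * d) * |ξ|) := by positivity
    rw [← cosh_abs, e, cosh_eq]
    have : exp (-(2 * (π / (4 * d) * |ξ|))) ≤ exp (2 * (π / (4 * d) * |ξ|)) :=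
      exp_le_exp.2 (by linarith)
    linarith
  have h3 : exp (-(μ * (|ξ| / 2))) ≤ (1 / cosh (2 * (π / (4 * d) * ξ))) ^ (d * μ / π) := by
    calc exp (-(μ * (|ξ| / 2))) = (1 / exp (2 * (π / (4 * d) * |ξ|))) ^ (d * μ / π) := by
          rw [one_div, ← exp_neg, ← exp_mul]; congr 1; field_simp; norm_num
      _ ≤ _ := by
          have := cosh_pos (2 * (π / (4 * d) * ξ))
          gcongr
  calc cosh (ξ / 2) ^ (-μ) ≤ (exp (|ξ| / 2) / 2) ^ (-μ) :=
        rpow_le_rpow_of_nonpos (by positivity) h1 (by linarith)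
    _ = 2 ^ μ * exp (-(μ * (|ξ| / 2))) := by
      rw [div_rpow (exp_pos _).le (by norm_num), rpow_neg (by norm_num : (0 : ℝ) ≤ 2), div_inv_eq_mul,
        ← exp_mul, mul_comm]
      congr 2; ring
    _ ≤ _ := by gcongr

lemma sqrt_eq_pi_mul_sqrt (hd : 0 < d) (hμ : 0 < μ) (N : ℕ) :
    π * √(d * μ / π * N) = √(π * d * μ * N) := by
  have hpi := pi_pos
  rw [show π * d * μ * N = π ^ 2 * (d * μ / π * N) by field_simp, sqrt_mul (sq_nonneg π),
    sqrt_sq hpi.le]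

lemma analyticAt_formula (hd : 0 < d) (hdπ : d ≤ π) (ν : ℝ) (N : ℕ) (f : ℂ → ℂ) {z : ℂ}
    (hz : z ∈ region d) : AnalyticAt ℂ (formula d μ ν N f) z := by
  rw [show formula d μ ν N f = fun z => ∑ k ∈ idx N, f (betaPoint d μ N k) * basisFun d μ ν N k z
    from funext (formula_eq_sum d μ ν N f)]
  exact Finset.analyticAt_fun_sum _ fun k _ =>
    analyticAt_const.mul (analyticOnNhd_basisFun hd hdπ ν k z hz)

/-- The prefactor (1 - x²)^ν contributes cosh(ξ/2)^(-2ν) and the residue sum cosh(ξ/2)^(2ν-μ). The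
exponents add up to -μ, so ν drops out before Ganelius' estimate is applied. -/
theorem exists_norm_sub_formula_le (hd : 0 < d) (hdπ : d < π) (hμ : 0 < μ) (hν1 : μ / 2 < ν)
    (hν2 : ν < μ / 2 + 1) : ∃ C : ℝ, 0 < C ∧ ∀ N : ℕ, 1 ≤ N → FormulaDefined d μ N →
      ∀ f : ℂ → ℂ, AnalyticOnNhd ℂ f (region d) → hNorm d μ f ≤ 1 → ∀ ξ : ℝ,
        ‖f (tanh (ξ / 2) : ℝ) - formula d μ ν N f (tanh (ξ / 2) : ℝ)‖
          ≤ C * exp (-√(π * d * μ * N)) := by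
  have hpi := pi_pos
  obtain ⟨C₁, hC₁, h1⟩ := norm_sum_numer_residues_le (ι := ℤ) hd hdπ hν1 hν2
  obtain ⟨C₂, hC₂, h2⟩ := rpow_mul_ganeliusProd_le (r := d * μ / π) (by positivity)
  refine ⟨C₁ * 2 ^ μ * C₂, by positivity, fun N hN hdef f hf hfn => ?_⟩
  have hmem : ∀ ξ : ℝ, Complex.tanh ((ξ : ℂ) / 2) ∈ region d := fun ξ =>
    tanh_half_mem_region (by simpa using hd)
  have hcont : Continuous fun ξ : ℝ =>
      f (tanh (ξ / 2) : ℝ) - formula d μ ν N f (tanh (ξ / 2) : ℝ) := by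
    refine continuous_iff_continuousAt.2 fun ξ => ?_
    have hg : ContinuousAt (fun z => f z - formula d μ ν N f z) (Complex.tanh ((ξ : ℂ) / 2)) :=
      ((hf _ (hmem ξ)).sub (analyticAt_formula hd hdπ.le ν N f (hmem ξ))).continuousAt
    have ht : ContinuousAt (fun ξ : ℝ => Complex.tanh ((ξ : ℂ) / 2)) ξ :=
      ContinuousAt.comp (f := fun ξ : ℝ => (ξ : ℂ)) (g := fun ζ : ℂ => Complex.tanh (ζ / 2))
        (differentiableAt_tanh_half (by simpa using hpi)).continuousAt
        Complex.continuous_ofReal.continuousAt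
    have h3 := ContinuousAt.comp (f := fun ξ : ℝ => Complex.tanh ((ξ : ℂ) / 2)) hg ht
    simpa only [Function.comp_def, ofReal_tanh_half] using h3
  set S : Set ℝ := {ξ | ‖f (tanh (ξ / 2) : ℝ) - formula d μ ν N f (tanh (ξ / 2) : ℝ)‖
          ≤ C₁ * 2 ^ μ * C₂ * exp (-√(π * d * μ * N))} with hS
  have hclosed : IsClosed S := isClosed_le hcont.norm continuous_const
  -- The residue identity excludes the nodes themselves. Off this finite set the bound holds on a
  -- dense set, and continuity of the error extends it.
  have hfin : ((idx N).image (node d μ N) : Set ℝ).Countable := Finset.countable_toSet _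
  have hsub : ((idx N).image (node d μ N) : Set ℝ)ᶜ ⊆ S := fun ξ hξ => by
    have hξ' : ∀ k ∈ idx N, ξ ≠ node d μ N k := fun k hk h => hξ (by
      rw [h]; exact Finset.mem_coe.2 (Finset.mem_image_of_mem _ hk))
    have hres := h1 (idx N) (node d μ N) (node_injOn hdef) f hf hfn ξ hξ'
    have hb : 0 < cosh (ξ / 2) := cosh_pos _
    have hcc : Complex.cosh ((ξ : ℂ) / 2) = ((cosh (ξ / 2) : ℝ) : ℂ) := by push_cast; rfl
    have hG0 := (ganeliusProd_mem_Icc (r := d * μ / π) (by positivity) (N := N)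
      (t := 1 / cosh (2 * (π / (4 * d) * ξ))) (one_div_pos.2 (cosh_pos _))).1
    simp only [hS, mem_ofPred_eq]
    rw [sub_formula_eq hd hdπ hμ ν f hξ', norm_mul, norm_mul,
      norm_one_sub_tanh_sq_cpow (by simpa using hpi), norm_blaschke hd hμ, hcc, Complex.norm_real,
      norm_of_nonneg hb.le]
    set t := 1 / cosh (2 * (π / (4 * d) * ξ)) with ht
    have ht1 : t ∈ Ioc (0 : ℝ) 1 :=
      ⟨one_div_pos.2 (cosh_pos _), (div_le_one (cosh_pos _)).2 (one_le_cosh _)⟩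
    have hG := h2 N hN hdef.1 t ht1
    rw [sqrt_eq_pi_mul_sqrt hd hμ] at hG
    have h4 := cosh_half_rpow_le hd hμ ξ
    rw [← ht] at h4
    have h5 : cosh (ξ / 2) ^ (-(2 * ν)) * cosh (ξ / 2) ^ (2 * ν - μ) = cosh (ξ / 2) ^ (-μ) := by
      rw [← rpow_add hb]; congr 1; ring
    calc _ ≤ cosh (ξ / 2) ^ (-(2 * ν)) * ganeliusProd (d * μ / π) N t
          * (C₁ * cosh (ξ / 2) ^ (2 * ν - μ)) := by gcongr
      _ = C₁ * cosh (ξ / 2) ^ (-μ) * ganeliusProd (d * μ / π) N t := by rw [← h5]; ring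
      _ ≤ C₁ * (2 ^ μ * t ^ (d * μ / π)) * ganeliusProd (d * μ / π) N t := by gcongr
      _ = C₁ * 2 ^ μ * (t ^ (d * μ / π) * ganeliusProd (d * μ / π) N t) := by ring
      _ ≤ C₁ * 2 ^ μ * (C₂ * exp (-√(π * d * μ * N))) := by gcongr
      _ = _ := by ring
  have huniv : S = univ := by
    rw [← hclosed.closure_eq]
    exact ((hfin.dense_compl ℝ).mono hsub).closure_eq
  intro ξ
  have : ξ ∈ S := huniv ▸ mem_univ ξ
  exact this

theorem exists_errorNorm_formula_le (hd : 0 < d) (hdπ : d < π) (hμ : 0 < μ) (hν1 : μ / 2 < ν)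
    (hν2 : ν < μ / 2 + 1) : ∃ C : ℝ, 0 < C ∧ ∀ N : ℕ, 1 ≤ N → FormulaDefined d μ N →
      errorNorm d μ (formula d μ ν N) ≤ ENNReal.ofReal (C * exp (-√(π * d * μ * N))) := by
  obtain ⟨C, hC, h⟩ := exists_norm_sub_formula_le hd hdπ hμ hν1 hν2
  refine ⟨C, hC, fun N hN hdef => iSup₂_le fun f hf => iSup₂_le fun x hx => ?_⟩
  obtain ⟨ξ, rfl⟩ := exists_eq_tanh_half hx
  rw [← ofReal_norm]
  exact ENNReal.ofReal_le_ofReal (h N hN hdef f hf.1.1 hf.2 ξ)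

lemma card_idx (N : ℕ) : (idx N).card = 2 * N := by
  rw [idx, Finset.card_erase_of_mem (by simp), Int.card_Icc]
  omega

theorem minError_le_errorNorm_formula (hd : 0 < d) (hdπ : d ≤ π) (ν : ℝ) (hN : 1 ≤ N) :
    minError d μ (2 * N) ≤ errorNorm d μ (formula d μ ν N) := by
  let e : Fin (idx N).card ≃ idx N := (idx N).equivFin.symm
  have hcard := card_idx N
  refine iInf_le_of_le (idx N).card (iInf_le_of_le ⟨by omega, by omega⟩
    (iInf_le_of_le (fun _ => 1) (iInf_le_of_le (by simp [hcard])
    (iInf_le_of_le (fun j => (betaPoint d μ N (e j) : ℂ))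
    (iInf_le_of_le (fun j => betaPoint_mem_region hd _)
    (iInf_le_of_le (fun j _ => basisFun d μ ν N (e j))
    (iInf_le_of_le (fun j _ => analyticOnNhd_basisFun hd hdπ ν _) (le_of_eq ?_))))))))
  congr 1
  funext f z
  rw [formula_eq_sum, generalFormula, ← Finset.sum_coe_sort (idx N), ← e.sum_comp]
  simp

end upper

end Ganelius

namespace Ganelius

open Real Set Filter Topology MeasureTheory

open scoped ENNReal

/-! ### The lower bound for the minimum error norm -/

section lower

/-- The Blaschke factor of the strip `|Im ζ| < d` with zero `α`. -/
noncomputable def stripFactor (d : ℝ) (α ζ : ℂ) : ℂ :=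
  Complex.sinh ((π / (4 * d) : ℝ) * (ζ - α)) /
    Complex.cosh ((π / (4 * d) : ℝ) * (ζ - (starRingEnd ℂ) α))

/-- The product of the weight `w_μ` and the Blaschke factors of `Λ_d` with zeros
`tanh (α_j / 2)` of multiplicity `m_j`. -/
noncomputable def weightedBlaschke {ι : Type*} [Fintype ι] (d μ : ℝ) (m : ι → ℕ) (α : ι → ℂ)
    (z : ℂ) : ℂ :=
  weight μ z * ∏ j, stripFactor d (α j) (2 * cartanh z) ^ m j

variable {d μ : ℝ} {α ζ : ℂ}

lemma re_ofReal_mul_sub (c : ℝ) (ζ α : ℂ) : ((c : ℂ) * (ζ - α)).re = c * (ζ.re - α.re) := by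
  simp

lemma im_ofReal_mul_sub (c : ℝ) (ζ α : ℂ) : ((c : ℂ) * (ζ - α)).im = c * (ζ.im - α.im) := by
  simp

lemma abs_pi_div_mul_lt (hd : 0 < d) {y : ℝ} (hy : |y| < d) : |π / (4 * d) * y| < π / 4 := by
  have hpi := pi_pos
  rw [abs_mul, abs_of_pos (by positivity : (0 : ℝ) < π / (4 * d))]
  calc π / (4 * d) * |y| < π / (4 * d) * d := by gcongr
    _ = π / 4 := by field_simp

lemma cosh_stripFactor_ne_zero (hd : 0 < d) (hα : |α.im| < d) (hζ : |ζ.im| < d) :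
    Complex.cosh ((π / (4 * d) : ℝ) * (ζ - (starRingEnd ℂ) α)) ≠ 0 := by
  refine cosh_ne_zero_of_abs_im_lt ?_
  rw [im_ofReal_mul_sub, Complex.conj_im, mul_sub]
  have h1 := abs_lt.1 (abs_pi_div_mul_lt hd hα)
  have h2 := abs_lt.1 (abs_pi_div_mul_lt hd hζ)
  rw [abs_lt]
  constructor <;> linarith

/-- It rests on cos²(a+b) - sin²(a-b) = cos 2a cos 2b, which is positive because |a|, |b| < π/4. -/
lemma norm_stripFactor_le_one (hd : 0 < d) (hα : |α.im| < d) (hζ : |ζ.im| < d) :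
    ‖stripFactor d α ζ‖ ≤ 1 := by
  rw [stripFactor, norm_div,
    div_le_one (norm_pos_iff.2 (cosh_stripFactor_ne_zero hd hα hζ))]
  refine le_of_sq_le_sq ?_ (norm_nonneg _)
  rw [norm_sq_sinh, norm_sq_cosh]
  simp only [re_ofReal_mul_sub, im_ofReal_mul_sub, Complex.conj_im, Complex.conj_re]
  have h1 := abs_lt.1 (abs_pi_div_mul_lt hd hα)
  have h2 := abs_lt.1 (abs_pi_div_mul_lt hd hζ)
  have e1 : π / (4 * d) * (ζ.im - α.im) = π / (4 * d) * ζ.im - π / (4 * d) * α.im := by ring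
  have e2 : π / (4 * d) * (ζ.im - -α.im) = π / (4 * d) * ζ.im + π / (4 * d) * α.im := by ring
  rw [e1, e2]
  generalize π / (4 * d) * ζ.im = a at *
  generalize π / (4 * d) * α.im = b at *
  have h3 : 0 < cos (2 * a) := cos_pos_of_mem_Ioo ⟨by linarith, by linarith⟩
  have h4 : 0 < cos (2 * b) := cos_pos_of_mem_Ioo ⟨by linarith, by linarith⟩
  have h5 : cos (a + b) ^ 2 - sin (a - b) ^ 2 = cos (2 * a) * cos (2 * b) := by
    rw [cos_add, sin_sub, cos_two_mul', cos_two_mul']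
    ring
  have h6 := mul_pos h3 h4
  linarith

/-- Moving a zero vertically onto the real axis can only decrease the factor at real points, so real
zeros are the worst case. -/
lemma abs_tanh_le_norm_stripFactor (hd : 0 < d) (hα : |α.im| < d) (ξ : ℝ) :
    |tanh (π / (4 * d) * (ξ - α.re))| ≤ ‖stripFactor d α ξ‖ := by
  have h0 : 0 < ‖Complex.cosh ((π / (4 * d) : ℝ) * (ξ - (starRingEnd ℂ) α))‖ :=
    norm_pos_iff.2 (cosh_stripFactor_ne_zero hd hα (by simpa using hd))
  have h1 := abs_sinh_le_norm_sinh ((π / (4 * d) : ℝ) * ((ξ : ℂ) - α))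
  have h2 := norm_cosh_le ((π / (4 * d) : ℝ) * ((ξ : ℂ) - (starRingEnd ℂ) α))
  rw [re_ofReal_mul_sub, Complex.ofReal_re] at h1 h2
  rw [Complex.conj_re] at h2
  rw [tanh_eq_sinh_div_cosh, abs_div, abs_of_pos (cosh_pos _), stripFactor, norm_div]
  gcongr

lemma exp_le_norm_stripFactor (hd : 0 < d) (hα : |α.im| < d) {ξ : ℝ} (hξ : ξ ≠ α.re) :
    exp (-logCoth |π / (2 * d) * (ξ - α.re)|) ≤ ‖stripFactor d α ξ‖ := by
  refine le_trans (le_of_eq ?_) (abs_tanh_le_norm_stripFactor hd hα ξ)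
  have hpi := pi_pos
  rw [abs_tanh_eq (mul_ne_zero (by positivity) (sub_ne_zero.2 hξ)), abs_mul, abs_mul,
    abs_of_pos (by positivity : (0 : ℝ) < π / (2 * d)),
    abs_of_pos (by positivity : (0 : ℝ) < π / (4 * d))]
  congr 3
  field_simp
  ring

lemma analyticAt_stripFactor_cartanh (hd : 0 < d) (hdπ : d ≤ π) (hα : |α.im| < d)
    (hζ : |ζ.im| < d) :
    AnalyticAt ℂ (fun z => stripFactor d α (2 * cartanh z)) (Complex.tanh (ζ / 2)) := by
  have hζπ := hζ.trans_le hdπ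
  have h := analyticAt_cartanh hζπ
  have h2 : 2 * cartanh (Complex.tanh (ζ / 2)) = ζ := by rw [cartanh_tanh hζπ]; ring
  unfold stripFactor
  refine AnalyticAt.div ?_ ?_ ?_
  · exact Complex.analyticAt_sinh.comp
      (analyticAt_const.fun_mul ((analyticAt_const.fun_mul h).fun_sub analyticAt_const))
  · exact Complex.analyticAt_cosh.comp
      (analyticAt_const.fun_mul ((analyticAt_const.fun_mul h).fun_sub analyticAt_const))
  · rw [h2]
    exact cosh_stripFactor_ne_zero hd hα hζ

section weightedBlaschke

variable {ι : Type*} [Fintype ι] {m : ι → ℕ} {α : ι → ℂ}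

lemma weightedBlaschke_tanh (hζ : |ζ.im| < π) :
    weightedBlaschke d μ m α (Complex.tanh (ζ / 2)) =
      weight μ (Complex.tanh (ζ / 2)) * ∏ j, stripFactor d (α j) ζ ^ m j := by
  rw [weightedBlaschke, cartanh_tanh hζ, mul_div_cancel₀ _ two_ne_zero]

lemma analyticAt_weightedBlaschke (hd : 0 < d) (hdπ : d ≤ π) (hα : ∀ j, |(α j).im| < d)
    (hζ : |ζ.im| < d) : AnalyticAt ℂ (weightedBlaschke d μ m α) (Complex.tanh (ζ / 2)) :=
  (analyticAt_one_sub_sq_cpow (hζ.trans_le hdπ) _).mul (Finset.analyticAt_fun_prod _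
    fun j _ => (analyticAt_stripFactor_cartanh hd hdπ (hα j) hζ).fun_pow (m j))

lemma hNorm_weightedBlaschke_le_one (hd : 0 < d) (hdπ : d ≤ π) (hα : ∀ j, |(α j).im| < d) :
    hNorm d μ (weightedBlaschke d μ m α) ≤ 1 := by
  refine hNorm_le_one hdπ fun ζ hζ => ?_
  rw [weightedBlaschke_tanh (hζ.trans_le hdπ), norm_mul, norm_prod]
  refine mul_le_of_le_one_right (norm_nonneg _) (Finset.prod_le_one (fun _ _ => norm_nonneg _)
    fun j _ => ?_)
  rw [norm_pow]
  exact pow_le_one₀ (norm_nonneg _) (norm_stripFactor_le_one hd (hα j) hζ)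

/-- Separating the j-th factor shows that the analytic order at its zero is at least m j. Coinciding
zeros only raise the order. -/
lemma iteratedDeriv_weightedBlaschke_eq_zero (hd : 0 < d) (hdπ : d ≤ π)
    (hα : ∀ j, |(α j).im| < d) (j : ι) {k : ℕ} (hk : k < m j) :
    iteratedDeriv k (weightedBlaschke d μ m α) (Complex.tanh (α j / 2)) = 0 := by
  classical
  refine (natCast_le_analyticOrderAt_iff_iteratedDeriv_eq_zero
    (analyticAt_weightedBlaschke hd hdπ hα (hα j))).1 ?_ k hk
  set F : ℂ → ℂ := fun z => stripFactor d (α j) (2 * cartanh z) with hF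
  set R : ℂ → ℂ := fun z => weight μ z *
    ∏ i ∈ Finset.univ.erase j, stripFactor d (α i) (2 * cartanh z) ^ m i with hR
  have hFa : AnalyticAt ℂ F (Complex.tanh (α j / 2)) :=
    analyticAt_stripFactor_cartanh hd hdπ (hα j) (hα j)
  have hRa : AnalyticAt ℂ R (Complex.tanh (α j / 2)) :=
    (analyticAt_one_sub_sq_cpow ((hα j).trans_le hdπ) _).mul (Finset.analyticAt_fun_prod _
      fun i _ => (analyticAt_stripFactor_cartanh hd hdπ (hα i) (hα j)).fun_pow (m i))
  have he : weightedBlaschke d μ m α = F ^ m j * R := by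
    funext z
    simp only [weightedBlaschke, Pi.mul_apply, Pi.pow_apply, hF, hR]
    rw [← Finset.mul_prod_erase _ _ (Finset.mem_univ j)]
    ring
  have h0 : F (Complex.tanh (α j / 2)) = 0 := by
    simp [hF, stripFactor, cartanh_tanh ((hα j).trans_le hdπ), mul_div_cancel₀]
  have h1 : 1 ≤ analyticOrderAt F (Complex.tanh (α j / 2)) :=
    Order.one_le_iff_ne_zero.2 (hFa.analyticOrderAt_ne_zero.2 h0)
  rw [he, analyticOrderAt_mul (hFa.pow _) hRa, analyticOrderAt_pow hFa]
  calc ((m j : ℕ) : ℕ∞) = m j • (1 : ℕ∞) := by simp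
    _ ≤ m j • analyticOrderAt F (Complex.tanh (α j / 2)) := by gcongr
    _ ≤ _ := le_self_add

lemma exp_le_norm_weight (hμ : 0 ≤ μ) (ξ : ℝ) :
    exp (-(μ * |ξ| / 2)) ≤ ‖weight μ (Complex.tanh ((ξ : ℂ) / 2))‖ := by
  have h1 : ‖Complex.cosh ((ξ : ℂ) / 2)‖ = cosh (ξ / 2) := by
    rw [show Complex.cosh ((ξ : ℂ) / 2) = ((cosh (ξ / 2) : ℝ) : ℂ) by push_cast; rfl,
      Complex.norm_real, norm_of_nonneg (cosh_pos _).le]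
  rw [norm_weight (by simpa using pi_pos), h1,
    show exp (-(μ * |ξ| / 2)) = exp (|ξ| / 2) ^ (-μ) by rw [← exp_mul]; congr 1; ring]
  refine rpow_le_rpow_of_nonpos (cosh_pos _) ?_ (by linarith)
  rw [← cosh_abs, cosh_eq, abs_div, abs_two]
  have : exp (-(|ξ| / 2)) ≤ exp (|ξ| / 2) := exp_le_exp.2 (by linarith [abs_nonneg ξ])
  linarith

lemma exp_le_norm_weightedBlaschke (hd : 0 < d) (hμ : 0 ≤ μ) (hα : ∀ j, |(α j).im| < d)
    {ξ : ℝ} (hξ : ∀ j, ξ ≠ (α j).re) :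
    exp (-(μ * |ξ| / 2 + ∑ j, m j * logCoth |π / (2 * d) * (ξ - (α j).re)|)) ≤
      ‖weightedBlaschke d μ m α (Complex.tanh ((ξ : ℂ) / 2))‖ := by
  rw [weightedBlaschke_tanh (by simpa using pi_pos), norm_mul, norm_prod, neg_add, exp_add,
    ← Finset.sum_neg_distrib, exp_sum]
  gcongr with j
  · exact exp_le_norm_weight hμ ξ
  · rw [norm_pow, ← mul_neg, exp_nat_mul]
    gcongr
    exact exp_le_norm_stripFactor hd (hα j) (hξ j)

end weightedBlaschke

/-! ### The averaging argument -/

lemma integrable_logCoth_abs_mul_sub {q : ℝ} (hq : 0 < q) (x : ℝ) :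
    Integrable fun ξ => logCoth |q * (ξ - x)| :=
  (integrable_logCoth_abs.comp_mul_left' hq.ne').comp_sub_right x

lemma integral_logCoth_abs_mul_sub {q : ℝ} (hq : 0 < q) (x : ℝ) :
    ∫ ξ, logCoth |q * (ξ - x)| = π ^ 2 / (2 * q) := by
  rw [integral_sub_right_eq_self (fun ξ => logCoth |q * ξ|) x,
    Measure.integral_comp_mul_left (fun ξ => logCoth |ξ|), integral_comp_abs, integral_logCoth,
    abs_of_pos (inv_pos.2 hq), smul_eq_mul]
  field_simp
  ring

lemma integral_abs_symm {L : ℝ} (hL : 0 ≤ L) : ∫ ξ in (-L)..L, |ξ| = L ^ 2 := by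
  have h1 : ∫ ξ in (0 : ℝ)..L, |ξ| = L ^ 2 / 2 := by
    rw [intervalIntegral.integral_congr (g := fun ξ => ξ) fun ξ hξ => ?_, integral_id]
    · ring
    · rw [uIcc_of_le hL] at hξ
      exact abs_of_nonneg hξ.1
  have h2 : ∫ ξ in (-L)..0, |ξ| = L ^ 2 / 2 := by
    have h := intervalIntegral.integral_comp_neg (a := 0) (b := L) fun ξ : ℝ => |ξ|
    simpa only [abs_neg, neg_zero, h1] using h.symm
  rw [← intervalIntegral.integral_add_adjacent_intervals (b := 0)
    (continuous_abs.intervalIntegrable _ _) (continuous_abs.intervalIntegrable _ _), h1, h2]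
  ring

/-- The mean over [-L, L] is at most μL/4 + πdN/L, whatever the zeros are, since each translate of
`logCoth` has the same integral over ℝ. Some point does no worse than the mean. -/
lemma exists_potential_le {ι : Type*} [Fintype ι] (hd : 0 < d) (hμ : 0 < μ) {N : ℕ} (hN : 1 ≤ N)
    {m : ι → ℕ} (hm : ∑ j, m j = 2 * N) (x : ι → ℝ) :
    ∃ ξ : ℝ, (∀ j, ξ ≠ x j) ∧
      μ * |ξ| / 2 + ∑ j, m j * logCoth |π / (2 * d) * (ξ - x j)| ≤ √(π * d * μ * N) := by
  have hpi := pi_pos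
  have hN0 : (0 : ℝ) < N := by exact_mod_cast hN
  have hq : 0 < π / (2 * d) := by positivity
  set s := √(π * d * μ * N) with hs
  have hs0 : 0 < s := by positivity
  have hs2 : s ^ 2 = π * d * μ * N := sq_sqrt (by positivity)
  -- This L minimizes μL/4 + πdN/L, and the minimum is s.
  set L := 2 * s / μ with hL
  have hL0 : 0 < L := by positivity
  set g : ℝ → ℝ := fun ξ => ∑ j, m j * logCoth |π / (2 * d) * (ξ - x j)| with hg
  have hgi : Integrable g := integrable_finsetSum _ fun j _ =>
    (integrable_logCoth_abs_mul_sub hq (x j)).const_mul _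
  have hg0 : ∀ ξ, 0 ≤ g ξ := fun ξ => Finset.sum_nonneg fun j _ =>
    mul_nonneg (Nat.cast_nonneg _) (logCoth_nonneg (abs_nonneg _))
  have hgv : ∫ ξ, g ξ = 2 * π * d * N := by
    rw [integral_finsetSum _ fun j _ => (integrable_logCoth_abs_mul_sub hq (x j)).const_mul _]
    simp only [integral_const_mul, integral_logCoth_abs_mul_sub hq]
    rw [← Finset.sum_mul, ← Nat.cast_sum, hm]
    push_cast
    field_simp
  have hai : IntegrableOn (fun ξ : ℝ => μ * |ξ| / 2) (Ioc (-L) L) :=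
    ((continuous_const.mul continuous_abs).div_const 2).integrableOn_Ioc
  have hav : ∫ ξ in Ioc (-L) L, μ * |ξ| / 2 = μ * L ^ 2 / 2 := by
    rw [← intervalIntegral.integral_of_le (by linarith), intervalIntegral.integral_div,
      intervalIntegral.integral_const_mul, integral_abs_symm hL0.le]
  have hvol : volume (Ioc (-L) L) ≠ 0 := by
    rw [Real.volume_Ioc]; simp [hL0]
  have hnull : (volume.restrict (Ioc (-L) L)) (range x) = 0 :=
    Measure.restrict_le_self.absolutelyContinuous ((finite_range x).measure_zero _)
  have hne : volume.restrict (Ioc (-L) L) ≠ 0 := by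
    rwa [Ne, Measure.restrict_eq_zero]
  -- The point must avoid the zeros, where `logCoth 0` is finite by convention and says nothing
  -- about the Blaschke factor.
  obtain ⟨ξ, hξ, h⟩ := exists_notMem_null_le_average hne (hai.add hgi.integrableOn) hnull
  refine ⟨ξ, fun j hj => hξ ⟨j, hj.symm⟩, h.trans ?_⟩
  rw [setAverage_eq, measureReal_def, Real.volume_Ioc, ENNReal.toReal_ofReal (by linarith),
    smul_eq_mul]
  have h1 : ∫ ξ in Ioc (-L) L, ((fun ξ => μ * |ξ| / 2) + g) ξ ≤ μ * L ^ 2 / 2 + 2 * π * d * N := by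
    rw [integral_add' hai hgi.integrableOn, hav, ← hgv]
    gcongr
    · exact Eventually.of_forall hg0
    · exact Measure.restrict_le_self
  calc (L - -L)⁻¹ * _ ≤ (L - -L)⁻¹ * (μ * L ^ 2 / 2 + 2 * π * d * N) := by
        have : 0 ≤ (L - -L)⁻¹ := by rw [sub_neg_eq_add]; positivity
        gcongr
    _ = s := by
      have : 2 * π * d * N = 2 * s ^ 2 / μ := by rw [hs2]; field_simp
      rw [this, hL]
      field_simp
      ring

theorem exp_le_minError (hd : 0 < d) (hdπ : d ≤ π) (hμ : 0 < μ) {N : ℕ} (hN : 1 ≤ N) :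
    ENNReal.ofReal (exp (-√(π * d * μ * N))) ≤ minError d μ (2 * N) := by
  refine le_iInf₂ fun l _ => le_iInf₂ fun m hm => le_iInf₂ fun a ha => le_iInf₂ fun φ _ => ?_
  choose α hα hαa using ha
  replace hα : ∀ j, |(α j).im| < d := hα
  have hnorm := hNorm_weightedBlaschke_le_one (μ := μ) (m := m) hd hdπ hα
  have hmem : weightedBlaschke d μ m α ∈ hSpace d μ := by
    refine ⟨?_, hnorm.trans_lt ENNReal.one_lt_top⟩
    rintro _ ⟨ζ, hζ, rfl⟩
    exact analyticAt_weightedBlaschke hd hdπ hα hζ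
  -- The formula sees only derivatives of order below m j at a j, all of which vanish, so the error
  -- at any point is the test function itself.
  have hzero (z : ℂ) : generalFormula m a φ (weightedBlaschke d μ m α) z = 0 := by
    refine Finset.sum_eq_zero fun j _ => Finset.sum_eq_zero fun k _ => ?_
    rw [← hαa j]
    simp only
    rw [iteratedDeriv_weightedBlaschke_eq_zero hd hdπ hα j k.2, zero_mul]
  obtain ⟨ξ, hξ, h⟩ := exists_potential_le hd hμ hN hm fun j => (α j).re
  have hx : tanh (ξ / 2) ∈ Ioo (-1 : ℝ) 1 := ⟨neg_one_lt_tanh _, tanh_lt_one _⟩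
  refine le_trans ?_ (le_iSup₂_of_le _ ⟨hmem, hnorm⟩ (le_iSup₂_of_le _ hx le_rfl))
  rw [hzero, sub_zero, ← ofReal_norm, ← ofReal_tanh_half]
  exact ENNReal.ofReal_le_ofReal ((exp_le_exp.2 (neg_le_neg h)).trans
    (exp_le_norm_weightedBlaschke hd hμ.le hα hξ))

end lower

end Ganelius

theorem theorem3p1 (d μ ν : ℝ) (hd0 : 0 < d) (hdπ : d < Real.pi) (hμ : 0 < μ)
    (hν1 : μ / 2 < ν) (hν2 : ν < μ / 2 + 1) :
    -- the error bound
    (∃ C : ℝ, 0 < C ∧ ∀ N : ℕ, 1 ≤ N → Ganelius.FormulaDefined d μ N →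
      Ganelius.errorNorm d μ (Ganelius.formula d μ ν N)
        ≤ ENNReal.ofReal (C * Real.exp (-√(Real.pi * d * μ * N)))) ∧
    -- optimality of its order among all 2N-point formulas
    (∃ c : ℝ, 0 < c ∧ ∀ N : ℕ, 1 ≤ N →
      ENNReal.ofReal (c * Real.exp (-√(Real.pi * d * μ * N)))
        ≤ Ganelius.minError d μ (2 * N)) ∧
    (∀ N : ℕ, 1 ≤ N → Ganelius.FormulaDefined d μ N →
      Ganelius.minError d μ (2 * N)
        ≤ Ganelius.errorNorm d μ (Ganelius.formula d μ ν N)) :=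
  ⟨Ganelius.exists_errorNorm_formula_le hd0 hdπ hμ hν1 hν2,
    ⟨1, one_pos, fun N hN => by
      rw [one_mul]
      exact Ganelius.exp_le_minError hd0 hdπ.le hμ hN⟩,
    fun _ hN _ => Ganelius.minError_le_errorNorm_formula hd0 hdπ.le ν hN⟩
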